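/- **Game.** Let $G=(V,E)$ be a finite undirected graph with $V\neq\emptyset$; loops are allowed (and count as edges), and every vertex lies on at least one edge. For $c\in V$ let $E_c$ be the set of edges incident to $c$ and $N[c]$ the closed neighbourhood of $c$, and for $c\in V$, $e\in E$ let $q_{E_c}(e)\in[0,1]$ be given: the probability of surviving the crossing of $e$ when the cop stands on $c$. The *Cop and Fast Defending Robber game* is the following turn-based game with perfect information. A state is either the jail $j^*$, which is the only final state and is absorbing, or a pair $(c,r)$ with $c\in V\cup\{i_{\rm cop}\}$, $r\in V\cup\{i_{\rm rob}\}$, where $i_{\rm cop},i_{\rm rob}\notin V$ are the starting points. In each turn the cop moves first: from $i_{\rm cop}$ he goes to any vertex, and from $c\in V$ to any $c'\in N[c]$. Then the robber moves: from $i_{\rm rob}$ she goes to any vertex; from $r\in V$ she chooses a path $\pi$ of any positive finite length (number of edges) starting in $r$, where vertices and edges may be repeated. Let $E_\pi$ be the set of edges of $\pi$ and $\pi[*]$ its last vertex. If the cop is on $c$ and $E_\pi\cap E_c=\emptyset$, the next state is $(c,\pi[*])$; if $E_\pi\cap E_c\ne\emptyset$, the next state is $(c,\pi[*])$ with probability $\prod_{e\in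 E_\pi}q_{E_c}(e)$ and $j^*$ otherwise. (While the cop is still at $i_{\rm cop}$ no edge is watched.) With $S$ the state set, $T_{\rm cop},T_{\rm rob}$ the transition functions and $A_{\rm cop}(s),A_{\rm rob}(s)$ the available actions, let $w_n(j^*)=1$ for all $n\ge 0$ and, for $s\neq j^*$, $w_0(s)=0$ and $$w_{n}(s)=\max_{a\in A_{\rm cop}(s)}\sum_{s'\in S}T_{\rm cop}(s,a,s')\min_{a'\in A_{\rm rob}(s')}\sum_{s''\in S}T_{\rm rob}(s',a',s'')\,w_{n-1}(s'')\qquad(n\ge1),$$ the probability that the robber is captured within $n$ turns from $s$ under optimal play. **Machine.** Operations are counted on a random access machine with a word memory (natural numbers, with addition, truncated subtraction, multiplication, integer division, comparison and indirect addressing) and a real memory (real numbers, with addition, subtraction, multiplication and comparison); each instruction and each test costs one operation, and there is no conversion between reals and words. **Proposition.** There are a single program and a constant $K$ such that, for every such $G$ and $q$ and every $n\in\mathbb N$, given $|V|$, $|E|$, $n$, a list of the edges in any order and the table of the values $q_{E_c}(e)$, the program computes the exact values $w_n(s)$ for all states $s$ (in particular $w_n(i_0)$ for the initial state $i_0=(i_{\rm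 cop},i_{\rm rob})$) with at most $$K\left(|V|^3\log|V|+(n+1)\,|V|^2\,|E|\right)$$ operations, using at most $K|V|^3$ word cells and $K|V|^3$ real cells (the input included) besides a constant number of registers, all words during the computation being at most $K(|V|^3+n)$. -/

import Mathlib

/-! ### Generalized probabilistic Cops and Robbers games and the recursion `w` -/

/-- A probabilistic, turn-based, perfect-information Cops and Robbers game with finite state
set `S`, cop actions `A` and robber actions `B`. `copT s a s'` is the probability that the cop,
playing `a` in `s`, arrives in `s'`; the total mass is `1` if `a` is playable in `s` and `0`
otherwise. Similarly for the robber. Final states are absorbing. -/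
structure GPCRGame (S A B : Type) [Fintype S] where
  init : S
  final : Set S
  copT : S → A → S → ℝ
  robT : S → B → S → ℝ
  copT_nonneg : ∀ s a s', 0 ≤ copT s a s'
  robT_nonneg : ∀ s b s', 0 ≤ robT s b s'
  copT_sum : ∀ s a, ∑ s', copT s a s' = 0 ∨ ∑ s', copT s a s' = 1
  robT_sum : ∀ s b, ∑ s', robT s b s' = 0 ∨ ∑ s', robT s b s' = 1
  exists_copPlayable : ∀ s, ∃ a, ∑ s', copT s a s' = 1
  exists_robPlayable : ∀ s, ∃ b, ∑ s', robT s b s' = 1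
  copT_final : ∀ s ∈ final, ∀ a, copT s a s = 1
  robT_final : ∀ s ∈ final, ∀ b, robT s b s = 1

namespace GPCRGame

variable {S A B : Type} [Fintype S]

/-- Action `a` is available to the cop in state `s`. -/
def CopPlayable (G : GPCRGame S A B) (s : S) (a : A) : Prop := ∑ s', G.copT s a s' = 1

/-- Action `b` is available to the robber in state `s`. -/
def RobPlayable (G : GPCRGame S A B) (s : S) (b : B) : Prop := ∑ s', G.robT s b s' = 1

open Classical in
/-- `G.w n s` is the probability that the robber is captured within `n` turns from state `s`,
the cop being next to move and both players playing optimally. (The action sets are never empty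
and the values are bounded, so that `⨆` and `⨅` are a true supremum and infimum.) -/
noncomputable def w (G : GPCRGame S A B) : ℕ → S → ℝ
  | 0, s => if s ∈ G.final then 1 else 0
  | n + 1, s =>
      if s ∈ G.final then 1
      else ⨆ a : {a : A // G.CopPlayable s a}, ∑ s', G.copT s a s' *
        ⨅ b : {b : B // G.RobPlayable s' b}, ∑ s'', G.robT s' b s'' * w G n s''

end GPCRGame

/-! ### The Cop and Fast Defending Robber game -/

namespace FastRobber

/-- The data of a Cop and Fast Defending Robber game: a finite undirected graph on the vertex set
`V`, in which loops are allowed (staying on a vertex is crossing its loop) and in which every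
vertex lies on an edge, so that the robber can always move; and the probability `survival c e`
that the robber survives crossing the edge `e` while the cop, standing on `c`, guards the edges
incident to `c`. -/
structure Arena (V : Type) where
  edges : Finset (Sym2 V)
  exists_edge : ∀ v, ∃ u, s(v, u) ∈ edges
  survival : V → Sym2 V → ℝ
  survival_nonneg : ∀ c, ∀ e ∈ edges, 0 ≤ survival c e
  survival_le_one : ∀ c, ∀ e ∈ edges, survival c e ≤ 1

/-- States of the game: the jail, where the robber has been captured, and the positions `(c, r)`
of cop and robber, where `none` stands for the starting point of a player who has not yet chosen
a vertex. The watch zone is a function of the cop's position, see `Arena.watch`. -/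
inductive Pos (V : Type) where
  | jail : Pos V
  | at (c r : Option V) : Pos V
  deriving DecidableEq

/-- The states are the jail and the pairs of positions. -/
def Pos.equiv (V : Type) : Pos V ≃ Option (Option V × Option V) where
  toFun
    | .jail => none
    | .at c r => some (c, r)
  invFun
    | none => .jail
    | some (c, r) => .at c r
  left_inv s := by cases s <;> rfl
  right_inv s := by rcases s with _ | ⟨c, r⟩ <;> rfl

instance {V : Type} [Fintype V] : Fintype (Pos V) := Fintype.ofEquiv _ (Pos.equiv V).symm

/-- A robber action is a nonempty finite sequence of vertices `first, rest₀, rest₁, …`. -/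
structure Route (V : Type) where
  first : V
  rest : List V

namespace Route

variable {V : Type}

/-- All the vertices of the route, in order. -/
def vertices (π : Route V) : List V := π.first :: π.rest

/-- The last vertex of the route. -/
def last (π : Route V) : V := π.vertices.getLast (by simp [vertices])

/-- The set of edges of the route. -/
def edgeSet [DecidableEq V] (π : Route V) : Finset (Sym2 V) :=
  (List.zipWith (fun u v => s(u, v)) π.vertices π.rest).toFinset

end Route

namespace Arena

variable {V : Type}

/-- The watch zone of the cop: the edges incident to his position; nothing before he starts. -/
def watch [DecidableEq V] (A : Arena V) : Option V → Finset (Sym2 V)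
  | none => ∅
  | some c => A.edges.filter (fun e => c ∈ e)

/-- `v` belongs to the closed neighbourhood `N[c]`. -/
def InClosedNbhd (A : Arena V) (c v : V) : Prop := v = c ∨ s(c, v) ∈ A.edges

/-- `π` is a path from `r` of positive finite length: consecutive vertices span edges of the graph;
vertices and edges may be repeated. -/
def IsPathFrom (A : Arena V) (r : V) (π : Route V) : Prop :=
  π.first = r ∧ π.rest ≠ [] ∧ List.IsChain (fun u v => s(u, v) ∈ A.edges) π.vertices

/-- The point mass at `s`. -/
def dirac [DecidableEq V] (s : Pos V) : Pos V → ℝ := fun x => if x = s then 1 else 0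

/-- The probability that all the edges of `π` are crossed successfully against a cop on `c`. -/
def pathSurvival [DecidableEq V] (A : Arena V) (c : V) (π : Route V) : ℝ := ∏ e ∈ π.edgeSet, A.survival c e

open Classical in
/-- The cop's transition function: any vertex from his starting point, then a vertex of the closed
neighbourhood. -/
noncomputable def copT [DecidableEq V] (A : Arena V) : Pos V → V → Pos V → ℝ
  | .jail, _ => dirac .jail
  | .at none r, c' => dirac (.at (some c') r)
  | .at (some c) r, c' => if A.InClosedNbhd c c' then dirac (.at (some c') r) else 0

open Classical in
/-- The distribution of the state after the robber has run along `π` against a cop at `c`. -/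
noncomputable def runT [DecidableEq V] (A : Arena V) (c : Option V) (π : Route V) : Pos V → ℝ :=
  match c with
  | none => dirac (.at none (some π.last))
  | some c =>
      if π.edgeSet ∩ A.watch (some c) = ∅ then dirac (.at (some c) (some π.last))
      else fun x =>
        if x = .at (some c) (some π.last) then A.pathSurvival c π
        else if x = .jail then 1 - A.pathSurvival c π
        else 0

open Classical in
/-- The robber's transition function: from her starting point she chooses any vertex; from a vertex
she chooses a path of positive length. -/
noncomputable def robT [DecidableEq V] (A : Arena V) : Pos V → Route V → Pos V → ℝ
  | .jail, _ => dirac .jail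
  | .at c none, π => if π.rest = [] then dirac (.at c (some π.first)) else 0
  | .at c (some r), π => if A.IsPathFrom r π then A.runT c π else 0

lemma sum_dirac [Fintype V] [DecidableEq V] (s : Pos V) : ∑ x, dirac s x = 1 := by
  simp [dirac]

lemma dirac_nonneg [DecidableEq V] (s x : Pos V) : 0 ≤ dirac s x := by
  unfold dirac; split_ifs <;> norm_num

lemma edgeSet_subset [DecidableEq V] (A : Arena V) {r : V} {π : Route V} (h : A.IsPathFrom r π) :
    π.edgeSet ⊆ A.edges := by
  obtain ⟨-, -, h⟩ := h
  rcases π with ⟨a, l⟩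
  simp only [Route.edgeSet, Route.vertices] at h ⊢
  induction l generalizing a with
  | nil => simp
  | cons b l ih =>
    rw [List.isChain_cons_cons] at h
    intro e he
    rw [List.zipWith_cons_cons, List.toFinset_cons, Finset.mem_insert] at he
    rcases he with rfl | he
    · exact h.1
    · exact ih b h.2 he

lemma pathSurvival_mem [DecidableEq V] (A : Arena V) {r : V} {π : Route V} (h : A.IsPathFrom r π) (c : V) :
    0 ≤ A.pathSurvival c π ∧ A.pathSurvival c π ≤ 1 :=
  ⟨Finset.prod_nonneg fun e he => A.survival_nonneg c e (A.edgeSet_subset h he),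
   Finset.prod_le_one (fun e he => A.survival_nonneg c e (A.edgeSet_subset h he))
    fun e he => A.survival_le_one c e (A.edgeSet_subset h he)⟩

lemma sum_runT [Fintype V] [DecidableEq V] (A : Arena V) (c : Option V) (π : Route V) : ∑ x, A.runT c π x = 1 := by
  unfold runT
  rcases c with _ | c
  · exact sum_dirac _
  · dsimp only
    split_ifs with h
    · exact sum_dirac _
    · have key : ∀ x : Pos V, (if x = .at (some c) (some π.last) then A.pathSurvival c π
          else if x = .jail then 1 - A.pathSurvival c π else 0) =
          (if x = .at (some c) (some π.last) then A.pathSurvival c π else 0) +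
          (if x = .jail then 1 - A.pathSurvival c π else 0) := by
        intro x
        rcases x with _ | ⟨c', r'⟩ <;> simp
      simp only [key, Finset.sum_add_distrib, Finset.sum_ite_eq', Finset.mem_univ, if_true]
      ring

lemma runT_nonneg [DecidableEq V] (A : Arena V) {r : V} {π : Route V} (h : A.IsPathFrom r π) (c : Option V)
    (x : Pos V) : 0 ≤ A.runT c π x := by
  unfold runT
  rcases c with _ | c
  · exact dirac_nonneg _ _
  · have := A.pathSurvival_mem h c
    dsimp only
    split_ifs
    · exact dirac_nonneg _ _
    · dsimp only
      split_ifs <;> linarith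

lemma exists_isPathFrom (A : Arena V) (r : V) : ∃ π, A.IsPathFrom r π := by
  obtain ⟨u, hu⟩ := A.exists_edge r
  exact ⟨⟨r, [u]⟩, rfl, by simp, by simpa [Route.vertices] using hu⟩

/-- The Cop and Fast Defending Robber game. -/
noncomputable def game [Fintype V] [DecidableEq V] [Nonempty V] (A : Arena V) : GPCRGame (Pos V) V (Route V) where
  init := .at none none
  final := {.jail}
  copT := A.copT
  robT := A.robT
  copT_nonneg := by
    rintro (_ | ⟨_ | c, r⟩) a x
    · exact dirac_nonneg _ _
    · exact dirac_nonneg _ _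
    · simp only [copT]; split_ifs
      · exact dirac_nonneg _ _
      · exact le_rfl
  robT_nonneg := by
    rintro (_ | ⟨c, _ | r⟩) π x
    · exact dirac_nonneg _ _
    · simp only [robT]; split_ifs
      · exact dirac_nonneg _ _
      · exact le_rfl
    · simp only [robT]; split_ifs with h
      · exact A.runT_nonneg h _ _
      · exact le_rfl
  copT_sum := by
    rintro (_ | ⟨_ | c, r⟩) a
    · exact Or.inr (sum_dirac _)
    · exact Or.inr (sum_dirac _)
    · simp only [copT]; split_ifs
      · exact Or.inr (sum_dirac _)
      · left; simp
  robT_sum := by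
    rintro (_ | ⟨c, _ | r⟩) π
    · exact Or.inr (sum_dirac _)
    · simp only [robT]; split_ifs
      · exact Or.inr (sum_dirac _)
      · left; simp
    · simp only [robT]; split_ifs with h
      · exact Or.inr (A.sum_runT _ _)
      · left; simp
  exists_copPlayable := by
    rintro (_ | ⟨_ | c, r⟩)
    · exact ⟨Classical.arbitrary V, sum_dirac _⟩
    · exact ⟨Classical.arbitrary V, sum_dirac _⟩
    · have h : A.InClosedNbhd c c := Or.inl rfl
      refine ⟨c, ?_⟩
      simp only [copT, h, if_true]
      exact sum_dirac _
  exists_robPlayable := by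
    rintro (_ | ⟨c, _ | r⟩)
    · exact ⟨⟨Classical.arbitrary V, []⟩, sum_dirac _⟩
    · refine ⟨⟨Classical.arbitrary V, []⟩, ?_⟩
      simp only [robT, if_true]
      exact sum_dirac _
    · obtain ⟨π, hπ⟩ := A.exists_isPathFrom r
      refine ⟨π, ?_⟩
      simp only [robT, hπ, if_true]
      exact A.sum_runT _ _
  copT_final := by
    rintro s rfl a
    simp [copT, dirac]
  robT_final := by
    rintro s rfl a
    simp [robT, dirac]

end Arena

/-! ### A random access machine with word memory and real memory -/

/-- Memory contents: registers and random access cells, both for machine words (natural numbers)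
and for real numbers. A program names finitely many registers; cells are addressed by words. -/
structure Store where
  wreg : ℕ → ℕ
  rreg : ℕ → ℝ
  wmem : ℕ → ℕ
  rmem : ℕ → ℝ

/-- Arithmetic on words (`sub` is truncated, `div` is the integer quotient). -/
inductive WordOp where
  | add | sub | mul | div

/-- Arithmetic on real numbers. -/
inductive RealOp where
  | add | sub | mul

/-- The value of a word operation. -/
def WordOp.eval : WordOp → ℕ → ℕ → ℕ
  | .add, a, b => a + b
  | .sub, a, b => a - b
  | .mul, a, b => a * b
  | .div, a, b => a / b

/-- The value of a real operation. -/
noncomputable def RealOp.eval : RealOp → ℝ → ℝ → ℝ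
  | .add, a, b => a + b
  | .sub, a, b => a - b
  | .mul, a, b => a * b

/-- Tests: comparison of two word registers, or of two real registers. -/
inductive Test where
  | wordLT (x y : ℕ)
  | realLT (x y : ℕ)

/-- The truth value of a test. -/
def Test.Holds : Test → Store → Prop
  | .wordLT x y, σ => σ.wreg x < σ.wreg y
  | .realLT x y, σ => σ.rreg x < σ.rreg y

/-- Programs. There is no conversion between words and reals, and no rounding. -/
inductive Prog where
  /-- do nothing -/
  | skip
  /-- word register `x` := the constant `k` -/
  | wconst (x k : ℕ)
  /-- word register `x` := `y op z` -/
  | wop (op : WordOp) (x y z : ℕ)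
  /-- word register `x` := the word cell whose address is in word register `y` -/
  | wload (x y : ℕ)
  /-- the word cell whose address is in word register `x` := word register `y` -/
  | wstore (x y : ℕ)
  /-- real register `x` := 0 -/
  | rzero (x : ℕ)
  /-- real register `x` := 1 -/
  | rone (x : ℕ)
  /-- real register `x` := `y op z` -/
  | rop (op : RealOp) (x y z : ℕ)
  /-- real register `x` := the real cell whose address is in word register `y` -/
  | rload (x y : ℕ)
  /-- the real cell whose address is in word register `x` := real register `y` -/
  | rstore (x y : ℕ)
  /-- sequential composition -/
  | seq (p q : Prog)
  /-- if the test holds then `p` else `q` -/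
  | cond (b : Test) (p q : Prog)
  /-- as long as the test holds, do `p` -/
  | loop (b : Test) (p : Prog)

/-- `Run M W p σ t τ`: on a machine with `M` word cells and `M` real cells (addresses
`0, …, M - 1`) whose words are natural numbers at most `W`, the program `p` started on `σ` halts
with memory contents `τ` after `t` elementary operations. Every instruction and every evaluation
of a test is one operation. A computation that would leave the address range or the word range
has no run. -/
inductive Run (M W : ℕ) : Prog → Store → ℕ → Store → Prop where
  | skip (σ : Store) : Run M W .skip σ 1 σ
  | wconst (σ : Store) (x k : ℕ) (hk : k ≤ W) :
      Run M W (.wconst x k) σ 1 { σ with wreg := Function.update σ.wreg x k }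
  | wop (σ : Store) (op : WordOp) (x y z : ℕ) (hW : op.eval (σ.wreg y) (σ.wreg z) ≤ W) :
      Run M W (.wop op x y z) σ 1
        { σ with wreg := Function.update σ.wreg x (op.eval (σ.wreg y) (σ.wreg z)) }
  | wload (σ : Store) (x y : ℕ) (hM : σ.wreg y < M) :
      Run M W (.wload x y) σ 1
        { σ with wreg := Function.update σ.wreg x (σ.wmem (σ.wreg y)) }
  | wstore (σ : Store) (x y : ℕ) (hM : σ.wreg x < M) :
      Run M W (.wstore x y) σ 1
        { σ with wmem := Function.update σ.wmem (σ.wreg x) (σ.wreg y) }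
  | rzero (σ : Store) (x : ℕ) :
      Run M W (.rzero x) σ 1 { σ with rreg := Function.update σ.rreg x 0 }
  | rone (σ : Store) (x : ℕ) :
      Run M W (.rone x) σ 1 { σ with rreg := Function.update σ.rreg x 1 }
  | rop (σ : Store) (op : RealOp) (x y z : ℕ) :
      Run M W (.rop op x y z) σ 1
        { σ with rreg := Function.update σ.rreg x (op.eval (σ.rreg y) (σ.rreg z)) }
  | rload (σ : Store) (x y : ℕ) (hM : σ.wreg y < M) :
      Run M W (.rload x y) σ 1
        { σ with rreg := Function.update σ.rreg x (σ.rmem (σ.wreg y)) }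
  | rstore (σ : Store) (x y : ℕ) (hM : σ.wreg x < M) :
      Run M W (.rstore x y) σ 1
        { σ with rmem := Function.update σ.rmem (σ.wreg x) (σ.rreg y) }
  | seq {σ τ υ : Store} {p q : Prog} {t u : ℕ} (hp : Run M W p σ t τ) (hq : Run M W q τ u υ) :
      Run M W (.seq p q) σ (t + u) υ
  | condTrue {σ τ : Store} {b : Test} {p q : Prog} {t : ℕ} (hb : b.Holds σ)
      (hp : Run M W p σ t τ) : Run M W (.cond b p q) σ (t + 1) τ
  | condFalse {σ τ : Store} {b : Test} {p q : Prog} {t : ℕ} (hb : ¬ b.Holds σ)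
      (hq : Run M W q σ t τ) : Run M W (.cond b p q) σ (t + 1) τ
  | loopTrue {σ τ υ : Store} {b : Test} {p : Prog} {t u : ℕ} (hb : b.Holds σ)
      (hp : Run M W p σ t τ) (hl : Run M W (.loop b p) τ u υ) :
      Run M W (.loop b p) σ (t + u + 1) υ
  | loopFalse {σ : Store} {b : Test} {p : Prog} (hb : ¬ b.Holds σ) :
      Run M W (.loop b p) σ 1 σ

/-! ### Input and output conventions -/

/-- `L` lists every edge of the graph exactly once, in some order, by its two endpoints. -/
def IsEdgeList {N : ℕ} (A : Arena (Fin N)) (L : List (Fin N × Fin N)) : Prop :=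
  (L.map fun a => s(a.1, a.2)).Nodup ∧ (L.map fun a => s(a.1, a.2)).toFinset = A.edges

/-- The initial memory: the word registers `0, 1, 2` hold `|V|`, `|E|` and the number of turns; the
word cells hold the edge list (two endpoints per edge); the real cell `c * |E| + j` holds the
survival probability of the `j`-th edge against a cop on `c`; everything else is zero. -/
noncomputable def inputStore {N : ℕ} (A : Arena (Fin N)) (L : List (Fin N × Fin N)) (n : ℕ) :
    Store where
  wreg x := [N, L.length, n].getD x 0
  rreg _ := 0
  wmem a := (L.flatMap fun e => [(e.1 : ℕ), (e.2 : ℕ)]).getD a 0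
  rmem a := ((List.finRange N).flatMap fun c => L.map fun e => A.survival c s(e.1, e.2)).getD a 0

/-- The number of a position of one player: vertices keep their number, the starting point has
number `N`. -/
def posIndex {N : ℕ} : Option (Fin N) → ℕ
  | none => N
  | some v => v

/-- The output cell of a state. -/
def stateIndex {N : ℕ} : Pos (Fin N) → ℕ
  | .at c r => posIndex c * (N + 1) + posIndex r
  | .jail => (N + 1) * (N + 1)

end FastRobber

namespace FastRobber

/-! ### A structured language over numbered arrays, compiled to `Prog` -/

/-! A route matters only through its last vertex and its set of edges, and every survival factor
lies in [0,1]. Hence, for a cop on c, the robber only needs the largest survival probability P(r,r')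
of a route from r to r'. There are three cases.

If r = r', crossing one edge back and forth is optimal, because every route from r contains an edge
at r (`IsBest.of_edges`). If r ≠ r' and the two are joined in the graph without the edges at c, then
P(r,r') = 1 (`IsBest.of_reachable`). Otherwise the edges of any route from r to r' contain a simple
path through c. Dropping edges does not lower a product, and cutting the path at c bounds it by
D(r)D(r'), where D(x) is the best product along a walk between x and c. Conversely, joining two
optimal walks at c does at least as well, since an edge they share is charged only once
(`IsBest.of_not_reachable`). The all-pairs problem for c thus reduces to a single-source problem.

For each c, D is found by relaxing all E edges in N rounds, and the components avoiding c by
propagating minimal labels in the same way. This costs O(NE) per c, and the table of all P takes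
O(N³) further operations. As no vertex is isolated, N ≤ 2E and N³ ≤ 2N²E, so everything fits into
O(N²E) and the logarithmic term of the bound is never needed. With the table, after the cop has
moved to a the robber's best chance is U(a,r) = max over r' of P(r,r')(1 - w(a,r')), and the new
value is the maximum of 1 - U over the cop's moves (`robValue_run`, `w_succ_at`). One turn costs
O(N³ + NE).

To prove this about machine code, the algorithm is written in a small language with eight arrays of
length B = (N+1)³ and counting loops. `Cmd.run` shows once and for all that compiled code obeys its
precondition, its frame and its syntactic time bound. The maximization and minimization loops are
then handled by `Cmd.wp_iter` in one style: every stored value stays zero or one of the candidates,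
values move in one direction, and pass k makes the cell at least as good as candidate k. This
determines the optimum without describing intermediate states. -/

/-- Numbered arrays of words and of real numbers. -/
structure Mem where
  w : ℕ → ℕ → ℕ
  r : ℕ → ℕ → ℝ

/-- Overwrite one word. -/
def Mem.setW (m : Mem) (k a v : ℕ) : Mem :=
  { m with w := Function.update m.w k (Function.update (m.w k) a v) }

/-- Overwrite one real number. -/
noncomputable def Mem.setR (m : Mem) (k a : ℕ) (v : ℝ) : Mem :=
  { m with r := Function.update m.r k (Function.update (m.r k) a v) }

/-- Word expressions; `var x` is word register `x`, and `load k a` is entry `a` of array `k`. -/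
inductive WExp where
  | var (x : ℕ)
  | lit (k : ℕ)
  | load (k : ℕ) (a : WExp)
  | add (a b : WExp)
  | mul (a b : WExp)

/-- Real expressions. -/
inductive RExp where
  | zero
  | one
  | load (k : ℕ) (a : WExp)
  | sub (a b : RExp)
  | mul (a b : RExp)

/-- Commands. In `iter b c`, word register `b` holds the number of repetitions, and the loop counter
lives in the first free word register. -/
inductive Cmd where
  | skip
  | wset (k : ℕ) (a e : WExp)
  | wmin (k : ℕ) (a e : WExp)
  | rset (k : ℕ) (a : WExp) (e : RExp)
  | rmax (k : ℕ) (a : WExp) (e : RExp)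
  | ite (a b : WExp) (c₁ c₂ : Cmd)
  | seq (c₁ c₂ : Cmd)
  | iter (b : ℕ) (c : Cmd)

namespace WExp

/-- The value of a word expression. -/
def eval (env : ℕ → ℕ) (m : Mem) : WExp → ℕ
  | var x => env x
  | lit k => k
  | load k a => m.w k (a.eval env m)
  | add a b => a.eval env m + b.eval env m
  | mul a b => a.eval env m * b.eval env m

/-- Evaluation stays within the word bound `W` and the array length `B`, with `d` registers
in use. -/
def Safe (W B d : ℕ) (env : ℕ → ℕ) (m : Mem) : WExp → Prop
  | var x => x < d
  | lit k => k ≤ W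
  | load k a => k < 8 ∧ a.Safe W B d env m ∧ a.eval env m < B
  | add a b => a.Safe W B d env m ∧ b.Safe W B d env m ∧ a.eval env m + b.eval env m ≤ W
  | mul a b => a.Safe W B d env m ∧ b.Safe W B d env m ∧ a.eval env m * b.eval env m ≤ W

end WExp

/-- Turn the offset in register `d` into the address in array `k`. -/
def shift (k d : ℕ) : Prog :=
  .seq (.wconst (d + 1) k) (.seq (.wop .mul (d + 1) (d + 1) 4) (.wop .add d d (d + 1)))

namespace WExp

/-- Code that evaluates a word expression into register `d`. -/
def compile : WExp → ℕ → Prog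
  | var x, d => .seq (.wconst d 0) (.wop .add d d x)
  | lit k, d => .wconst d k
  | load k a, d => .seq (a.compile d) (.seq (shift k d) (.wload d d))
  | add a b, d => .seq (a.compile d) (.seq (b.compile (d + 1)) (.wop .add d d (d + 1)))
  | mul a b, d => .seq (a.compile d) (.seq (b.compile (d + 1)) (.wop .mul d d (d + 1)))

/-- The running time of the code. -/
def cost : WExp → ℕ
  | var _ => 2
  | lit _ => 1
  | load _ a => a.cost + 4
  | add a b => a.cost + b.cost + 1
  | mul a b => a.cost + b.cost + 1

end WExp

namespace RExp

/-- The value of a real expression. -/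
noncomputable def eval (env : ℕ → ℕ) (m : Mem) : RExp → ℝ
  | zero => 0
  | one => 1
  | load k a => m.r k (a.eval env m)
  | sub a b => a.eval env m - b.eval env m
  | mul a b => a.eval env m * b.eval env m

/-- Evaluation stays within the bounds. -/
def Safe (W B d : ℕ) (env : ℕ → ℕ) (m : Mem) : RExp → Prop
  | zero => True
  | one => True
  | load k a => k < 8 ∧ a.Safe W B d env m ∧ a.eval env m < B
  | sub a b => a.Safe W B d env m ∧ b.Safe W B d env m
  | mul a b => a.Safe W B d env m ∧ b.Safe W B d env m

/-- Code that evaluates a real expression into real register `e`, with `d` word registers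
in use. -/
def compile : RExp → ℕ → ℕ → Prog
  | zero, _, e => .rzero e
  | one, _, e => .rone e
  | load k a, d, e => .seq (a.compile d) (.seq (shift k d) (.rload e d))
  | sub a b, d, e => .seq (a.compile d e) (.seq (b.compile d (e + 1)) (.rop .sub e e (e + 1)))
  | mul a b, d, e => .seq (a.compile d e) (.seq (b.compile d (e + 1)) (.rop .mul e e (e + 1)))

/-- The running time of the code. -/
def cost : RExp → ℕ
  | zero => 1
  | one => 1
  | load _ a => a.cost + 4
  | sub a b => a.cost + b.cost + 1
  | mul a b => a.cost + b.cost + 1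

end RExp

namespace Cmd

/-- The word arrays a command may change. -/
def wArrays : Cmd → Finset ℕ
  | wset k _ _ | wmin k _ _ => {k}
  | skip | rset _ _ _ | rmax _ _ _ => ∅
  | ite _ _ c₁ c₂ | seq c₁ c₂ => c₁.wArrays ∪ c₂.wArrays
  | iter _ c => c.wArrays

/-- The real arrays a command may change. -/
def rArrays : Cmd → Finset ℕ
  | rset k _ _ | rmax k _ _ => {k}
  | skip | wset _ _ _ | wmin _ _ _ => ∅
  | ite _ _ c₁ c₂ | seq c₁ c₂ => c₁.rArrays ∪ c₂.rArrays
  | iter _ c => c.rArrays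

/-- Only arrays that `c` may change differ. -/
def Frame (c : Cmd) (m m' : Mem) : Prop :=
  (∀ k ∉ c.wArrays, m'.w k = m.w k) ∧ ∀ k ∉ c.rArrays, m'.r k = m.r k

lemma Frame.refl (c : Cmd) (m : Mem) : c.Frame m m := ⟨fun _ _ => rfl, fun _ _ => rfl⟩

lemma Frame.trans {c : Cmd} {m₁ m₂ m₃ : Mem} (h : c.Frame m₁ m₂) (h' : c.Frame m₂ m₃) :
    c.Frame m₁ m₃ :=
  ⟨fun k hk => (h'.1 k hk).trans (h.1 k hk), fun k hk => (h'.2 k hk).trans (h.2 k hk)⟩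

lemma Frame.mono {c c' : Cmd} {m m' : Mem} (h : c.Frame m m') (hw : c.wArrays ⊆ c'.wArrays)
    (hr : c.rArrays ⊆ c'.rArrays) : c'.Frame m m' :=
  ⟨fun k hk => h.1 k fun h => hk (hw h), fun k hk => h.2 k fun h => hk (hr h)⟩

/-- Sufficient precondition for `c`, run with `d` registers in use, to stay within the bounds and to
end in `Q`. -/
def wp (W B : ℕ) : Cmd → ℕ → (ℕ → ℕ) → (Mem → Prop) → Mem → Prop
  | skip, _, _, Q, m => Q m
  | wset k a e, d, env, Q, m => k < 8 ∧ a.Safe W B d env m ∧ a.eval env m < B ∧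
      e.Safe W B d env m ∧ Q (m.setW k (a.eval env m) (e.eval env m))
  | wmin k a e, d, env, Q, m => k < 8 ∧ a.Safe W B d env m ∧ a.eval env m < B ∧
      e.Safe W B d env m ∧
      Q (m.setW k (a.eval env m) (min (m.w k (a.eval env m)) (e.eval env m)))
  | rset k a e, d, env, Q, m => k < 8 ∧ a.Safe W B d env m ∧ a.eval env m < B ∧
      e.Safe W B d env m ∧ Q (m.setR k (a.eval env m) (e.eval env m))
  | rmax k a e, d, env, Q, m => k < 8 ∧ a.Safe W B d env m ∧ a.eval env m < B ∧
      e.Safe W B d env m ∧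
      Q (m.setR k (a.eval env m) (max (m.r k (a.eval env m)) (e.eval env m)))
  | ite a b c₁ c₂, d, env, Q, m => a.Safe W B d env m ∧ b.Safe W B d env m ∧
      (a.eval env m < b.eval env m → c₁.wp W B d env Q m) ∧
      (¬ a.eval env m < b.eval env m → c₂.wp W B d env Q m)
  | seq c₁ c₂, d, env, Q, m => c₁.wp W B d env (c₂.wp W B d env Q) m
  -- The bound `b < 5` selects a parameter register. Code runs with `4 < d` and writes no register
  -- below `d`, so loop lengths are known from the start and the running time can be read off the
  -- syntax.
  | iter b c, d, env, Q, m => b < 5 ∧ ∃ I : ℕ → Mem → Prop, I 0 m ∧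
      (∀ k < env b, ∀ m', c.Frame m m' → I k m' →
        c.wp W B (d + 1) (Function.update env d k) (I (k + 1)) m') ∧
      ∀ m', c.Frame m m' → I (env b) m' → Q m'

/-- Code for a command, with `d` word registers in use. -/
def compile : Cmd → ℕ → Prog
  | skip, _ => .skip
  | wset k a e, d => .seq (e.compile d) (.seq (a.compile (d + 1)) (.seq (shift k (d + 1))
      (.wstore (d + 1) d)))
  | wmin k a e, d => .seq (e.compile d) (.seq (a.compile (d + 1)) (.seq (shift k (d + 1))
      (.seq (.wload (d + 2) (d + 1)) (.cond (.wordLT d (d + 2)) (.wstore (d + 1) d) .skip))))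
  | rset k a e, d => .seq (e.compile d 0) (.seq (a.compile d) (.seq (shift k d) (.rstore d 0)))
  | rmax k a e, d => .seq (e.compile d 0) (.seq (a.compile d) (.seq (shift k d)
      (.seq (.rload 1 d) (.cond (.realLT 1 0) (.rstore d 0) .skip))))
  | ite a b c₁ c₂, d => .seq (a.compile d) (.seq (b.compile (d + 1))
      (.cond (.wordLT d (d + 1)) (c₁.compile d) (c₂.compile d)))
  | seq c₁ c₂, d => .seq (c₁.compile d) (c₂.compile d)
  | iter b c, d => .seq (.wconst d 0) (.loop (.wordLT d b)
      (.seq (c.compile (d + 1)) (.seq (.wconst (d + 1) 1) (.wop .add d d (d + 1)))))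

/-- A bound on the running time of the code, where `p` gives the values of the first five word
registers. -/
def cost (p : ℕ → ℕ) : Cmd → ℕ
  | skip => 1
  | wset _ a e => e.cost + a.cost + 4
  | wmin _ a e => e.cost + a.cost + 6
  | rset _ a e => e.cost + a.cost + 4
  | rmax _ a e => e.cost + a.cost + 6
  | ite a b c₁ c₂ => a.cost + b.cost + 1 + (c₁.cost p + c₂.cost p)
  | seq c₁ c₂ => c₁.cost p + c₂.cost p
  | iter b c => p b * (c.cost p + 3) + 2

end Cmd

/-- The store `σ` holds the arrays `m` (of length `B`), and the values `env` in the first `d` word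
registers. -/
structure Holds (W B d : ℕ) (env : ℕ → ℕ) (m : Mem) (σ : Store) : Prop where
  reg : ∀ x < d, σ.wreg x = env x
  le : ∀ x < d, env x ≤ W
  base : env 4 = B
  word : ∀ k < 8, ∀ a < B, σ.wmem (k * B + a) = m.w k a
  real : ∀ k < 8, ∀ a < B, σ.rmem (k * B + a) = m.r k a

/-- `τ` agrees with `σ` on memory and on the first `d` word and `e` real registers. -/
structure Agree (d e : ℕ) (σ τ : Store) : Prop where
  wreg : ∀ x < d, τ.wreg x = σ.wreg x
  rreg : ∀ x < e, τ.rreg x = σ.rreg x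
  wmem : τ.wmem = σ.wmem
  rmem : τ.rmem = σ.rmem

lemma Agree.trans {d e d' e' : ℕ} {σ τ υ : Store} (h : Agree d e σ τ) (h' : Agree d' e' τ υ)
    (hd : d ≤ d') (he : e ≤ e') : Agree d e σ υ :=
  ⟨fun x hx => (h'.wreg x (by omega)).trans (h.wreg x hx),
   fun x hx => (h'.rreg x (by omega)).trans (h.rreg x hx),
   h'.wmem.trans h.wmem, h'.rmem.trans h.rmem⟩

lemma Holds.agree {W B d e d' : ℕ} {env : ℕ → ℕ} {m : Mem} {σ τ : Store} (h : Holds W B d env m σ)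
    (h' : Agree d' e σ τ) (hd : d ≤ d') : Holds W B d env m τ :=
  ⟨fun x hx => (h'.wreg x (by omega)).trans (h.reg x hx), h.le, h.base,
   by rw [h'.wmem]; exact h.word, by rw [h'.rmem]; exact h.real⟩

/-! ### Correctness and running time of the compiled code. -/

section Soundness

variable {M W B : ℕ}

/-- Register 4 supplies the common array length and `d + 1` is scratch. Since `k < 8`, the address
stays below `8 * B` and fits in a word. -/
lemma run_shift (hM : 8 * B ≤ W) (hB : 0 < B) {k d : ℕ} (hk : k < 8) (hd : 4 < d) (e : ℕ)
    {σ : Store} (h4 : σ.wreg 4 = B) (ha : σ.wreg d < B) :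
    ∃ τ, Run M W (shift k d) σ 3 τ ∧ τ.wreg d = k * B + σ.wreg d ∧ Agree d e σ τ := by
  have h1 : k * B ≤ 7 * B := Nat.mul_le_mul_right _ (by omega)
  refine ⟨_, .seq (.wconst _ _ _ (by omega)) (.seq (.wop _ _ _ _ _ ?_) (.wop _ _ _ _ _ ?_)), ?_, ?_⟩
  · simp [WordOp.eval, Function.update_of_ne (show (4 : ℕ) ≠ d + 1 by omega), h4]; omega
  · simp [WordOp.eval, Function.update_of_ne (show (4 : ℕ) ≠ d + 1 by omega), h4]; omega
  · simp [WordOp.eval, Function.update_of_ne (show (4 : ℕ) ≠ d + 1 by omega), h4]; omega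
  · refine ⟨fun x hx => ?_, fun _ _ => rfl, rfl, rfl⟩
    simp [Function.update_of_ne (show x ≠ d by omega), Function.update_of_ne (show x ≠ d + 1 by omega)]

/-- Registers are used as a stack: code with target `d` leaves everything below `d` alone, so a
first operand in `d` survives while the second is evaluated into `d + 1`. The meaningful registers
end at a fixed `d₀`, whereas the target moves up with the recursion. The number `e` is arbitrary
because no real register is touched. -/
lemma WExp.run (hM : 8 * B ≤ M) (hW : 8 * B ≤ W) (hB : 0 < B) {env : ℕ → ℕ} {m : Mem} {d₀ : ℕ}
    (a : WExp) : ∀ {d : ℕ} (e : ℕ) {σ : Store}, 4 < d₀ → d₀ ≤ d → Holds W B d₀ env m σ →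
      a.Safe W B d₀ env m →
      ∃ τ, Run M W (a.compile d) σ a.cost τ ∧ τ.wreg d = a.eval env m ∧ Agree d e σ τ := by
  induction a with
  | var x =>
    intro d e σ hd hd' h hs
    -- The code clears `d` before adding register `x`, so the two must differ.
    have hx : x ≠ d := by simp only [Safe] at hs; omega
    refine ⟨_, .seq (.wconst _ _ _ (Nat.zero_le _)) (.wop _ _ _ _ _ ?_), ?_, ?_⟩
    · simpa [WordOp.eval, hx, h.reg x hs] using h.le x hs
    · simp [WordOp.eval, hx, h.reg x hs, eval]
    · refine ⟨fun y hy => ?_, fun _ _ => rfl, rfl, rfl⟩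
      simp [Function.update_of_ne (show y ≠ d by omega)]
  | lit k =>
    intro d e σ hd hd' h hs
    refine ⟨_, .wconst _ _ _ hs, by simp [eval], fun y hy => ?_, fun _ _ => rfl, rfl, rfl⟩
    simp [Function.update_of_ne (show y ≠ d by omega)]
  | load k a ih =>
    intro d e σ hd hd' h hs
    obtain ⟨hk, hs, ha⟩ := hs
    obtain ⟨τ, hr, hv, hA⟩ := ih e hd hd' h hs
    have h' := h.agree hA hd'
    obtain ⟨υ, hr', hv', hA'⟩ := run_shift (M := M) hW hB hk (by omega : 4 < d) e
      ((h'.reg 4 hd).trans h.base) (by rw [hv]; exact ha)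
    have h'' := h'.agree hA' hd'
    have h1 : k * B ≤ 7 * B := Nat.mul_le_mul_right _ (by omega)
    rw [hv] at hv'
    refine ⟨_, .seq hr (.seq hr' (.wload _ _ _ (by omega))), ?_,
      (hA.trans hA' le_rfl le_rfl).trans (d' := d) (e' := e) ?_ le_rfl le_rfl⟩
    · simp [hv', h''.word k hk _ ha, eval]
    · refine ⟨fun y hy => ?_, fun _ _ => rfl, rfl, rfl⟩
      simp [Function.update_of_ne (show y ≠ d by omega)]
  | add a b iha ihb =>
    intro d e σ hd hd' h hs
    obtain ⟨hsa, hsb, hab⟩ := hs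
    obtain ⟨τ, hr, hv, hA⟩ := iha e hd hd' h hsa
    obtain ⟨υ, hr', hv', hA'⟩ := ihb (d := d + 1) e hd (by omega) (h.agree hA hd') hsb
    have hv := (hA'.wreg d (by omega)).trans hv
    refine ⟨_, by rw [cost, add_assoc]; exact .seq hr (.seq hr' (.wop _ _ _ _ _ (by simpa [WordOp.eval, hv, hv'] using hab))), ?_,
      (hA.trans hA' (by omega) le_rfl).trans (d' := d) (e' := e) ?_ le_rfl le_rfl⟩
    · simp [WordOp.eval, hv', hv, eval]
    · refine ⟨fun y hy => ?_, fun _ _ => rfl, rfl, rfl⟩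
      simp [Function.update_of_ne (show y ≠ d by omega)]
  | mul a b iha ihb =>
    intro d e σ hd hd' h hs
    obtain ⟨hsa, hsb, hab⟩ := hs
    obtain ⟨τ, hr, hv, hA⟩ := iha e hd hd' h hsa
    obtain ⟨υ, hr', hv', hA'⟩ := ihb (d := d + 1) e hd (by omega) (h.agree hA hd') hsb
    have hv := (hA'.wreg d (by omega)).trans hv
    refine ⟨_, by rw [cost, add_assoc]; exact .seq hr (.seq hr' (.wop _ _ _ _ _ (by simpa [WordOp.eval, hv, hv'] using hab))), ?_,
      (hA.trans hA' (by omega) le_rfl).trans (d' := d) (e' := e) ?_ le_rfl le_rfl⟩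
    · simp [WordOp.eval, hv', hv, eval]
    · refine ⟨fun y hy => ?_, fun _ _ => rfl, rfl, rfl⟩
      simp [Function.update_of_ne (show y ≠ d by omega)]

/-- Evaluation of an address. -/
lemma WExp.run_shift (hM : 8 * B ≤ M) (hW : 8 * B ≤ W) (hB : 0 < B) {env : ℕ → ℕ} {m : Mem} {d₀ : ℕ}
    (a : WExp) {d : ℕ} (e : ℕ) {σ : Store} {k : ℕ} (hd : 4 < d₀) (hd' : d₀ ≤ d)
    (h : Holds W B d₀ env m σ) (hk : k < 8) (hs : a.Safe W B d₀ env m) (ha : a.eval env m < B) :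
    ∃ τ υ, Run M W (a.compile d) σ a.cost τ ∧ Run M W (shift k d) τ 3 υ ∧
      υ.wreg d = k * B + a.eval env m ∧ υ.wreg d < M ∧ Agree d e σ υ := by
  obtain ⟨τ, hr, hv, hA⟩ := a.run hM hW hB e hd hd' h hs
  obtain ⟨υ, hr', hv', hA'⟩ := FastRobber.run_shift (M := M) hW hB hk (by omega : 4 < d) e
    (((h.agree hA hd').reg 4 hd).trans h.base) (by rw [hv]; exact ha)
  have h1 : k * B ≤ 7 * B := Nat.mul_le_mul_right _ (by omega)
  rw [hv] at hv'
  exact ⟨τ, υ, hr, hr', hv', by omega, hA.trans hA' le_rfl le_rfl⟩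

/-- Only the real registers form a stack here: words serve as addresses and are dead after the load,
so each subexpression may reuse word register `d`. -/
lemma RExp.run (hM : 8 * B ≤ M) (hW : 8 * B ≤ W) (hB : 0 < B) {env : ℕ → ℕ} {m : Mem} {d : ℕ}
    (hd : 4 < d) (a : RExp) : ∀ (e : ℕ) {σ : Store}, Holds W B d env m σ → a.Safe W B d env m →
      ∃ τ, Run M W (a.compile d e) σ a.cost τ ∧ τ.rreg e = a.eval env m ∧ Agree d e σ τ := by
  induction a with
  | zero =>
    intro e σ h hs
    refine ⟨_, .rzero _ _, by simp [eval], fun _ _ => rfl, fun y hy => ?_, rfl, rfl⟩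
    simp [Function.update_of_ne (show y ≠ e by omega)]
  | one =>
    intro e σ h hs
    refine ⟨_, .rone _ _, by simp [eval], fun _ _ => rfl, fun y hy => ?_, rfl, rfl⟩
    simp [Function.update_of_ne (show y ≠ e by omega)]
  | load k a =>
    intro e σ h hs
    obtain ⟨hk, hs, ha⟩ := hs
    obtain ⟨τ, υ, hr, hr', hv', hlt, hA⟩ := a.run_shift hM hW hB e hd le_rfl h hk hs ha
    refine ⟨_, .seq hr (.seq hr' (.rload _ _ _ hlt)), ?_,
      hA.trans (d' := d) (e' := e) ?_ le_rfl le_rfl⟩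
    · simp [hv', (h.agree hA le_rfl).real k hk _ ha, eval]
    · refine ⟨fun _ _ => rfl, fun y hy => ?_, rfl, rfl⟩
      simp [Function.update_of_ne (show y ≠ e by omega)]
  | sub a b iha ihb =>
    intro e σ h hs
    obtain ⟨τ, hr, hv, hA⟩ := iha e h hs.1
    obtain ⟨υ, hr', hv', hA'⟩ := ihb (e + 1) (h.agree hA le_rfl) hs.2
    have hv := (hA'.rreg e (by omega)).trans hv
    refine ⟨_, by rw [cost, add_assoc]; exact .seq hr (.seq hr' (.rop _ _ _ _ _)), ?_,
      (hA.trans hA' le_rfl (by omega)).trans (d' := d) (e' := e) ?_ le_rfl le_rfl⟩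
    · simp [RealOp.eval, hv', hv, eval]
    · refine ⟨fun _ _ => rfl, fun y hy => ?_, rfl, rfl⟩
      simp [Function.update_of_ne (show y ≠ e by omega)]
  | mul a b iha ihb =>
    intro e σ h hs
    obtain ⟨τ, hr, hv, hA⟩ := iha e h hs.1
    obtain ⟨υ, hr', hv', hA'⟩ := ihb (e + 1) (h.agree hA le_rfl) hs.2
    have hv := (hA'.rreg e (by omega)).trans hv
    refine ⟨_, by rw [cost, add_assoc]; exact .seq hr (.seq hr' (.rop _ _ _ _ _)), ?_,
      (hA.trans hA' le_rfl (by omega)).trans (d' := d) (e' := e) ?_ le_rfl le_rfl⟩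
    · simp [RealOp.eval, hv', hv, eval]
    · refine ⟨fun _ _ => rfl, fun y hy => ?_, rfl, rfl⟩
      simp [Function.update_of_ne (show y ≠ e by omega)]

/-- Uniqueness of quotient and remainder modulo `B`. It keeps the arrays disjoint in memory, and
later separates the entries of square and cubic arrays. -/
lemma address_inj {k k' a a' : ℕ} (ha : a < B) (ha' : a' < B) (h : k * B + a = k' * B + a') :
    k = k' ∧ a = a' := by
  have hB : 0 < B := by omega
  have h1 := congrArg (· / B) h
  have h2 := congrArg (· % B) h
  simp only [mul_comm _ B, Nat.mul_add_div hB, Nat.mul_add_mod, Nat.div_eq_of_lt ha,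
    Nat.div_eq_of_lt ha', Nat.mod_eq_of_lt ha, Nat.mod_eq_of_lt ha'] at h1 h2
  omega

lemma Holds.setW {d : ℕ} {env : ℕ → ℕ} {m : Mem} {σ : Store} (h : Holds W B d env m σ) {k a : ℕ}
    (ha : a < B) (v : ℕ) :
    Holds W B d env (m.setW k a v) { σ with wmem := Function.update σ.wmem (k * B + a) v } := by
  refine ⟨h.reg, h.le, h.base, fun k' hk' a' ha' => ?_, h.real⟩
  by_cases he : k' = k ∧ a' = a
  · obtain ⟨rfl, rfl⟩ := he
    simp [Mem.setW]
  · have : k' * B + a' ≠ k * B + a := fun h => he (address_inj ha' ha h)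
    simp only [Function.update_of_ne this, h.word k' hk' a' ha', Mem.setW]
    by_cases hk : k' = k
    · subst hk
      have : a' ≠ a := fun h => he ⟨rfl, h⟩
      simp [this]
    · simp [hk]

lemma Holds.setR {d : ℕ} {env : ℕ → ℕ} {m : Mem} {σ : Store} (h : Holds W B d env m σ) {k a : ℕ}
    (ha : a < B) (v : ℝ) :
    Holds W B d env (m.setR k a v) { σ with rmem := Function.update σ.rmem (k * B + a) v } := by
  refine ⟨h.reg, h.le, h.base, h.word, fun k' hk' a' ha' => ?_⟩
  by_cases he : k' = k ∧ a' = a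
  · obtain ⟨rfl, rfl⟩ := he
    simp [Mem.setR]
  · have : k' * B + a' ≠ k * B + a := fun h => he (address_inj ha' ha h)
    simp only [Function.update_of_ne this, h.real k' hk' a' ha', Mem.setR]
    by_cases hk : k' = k
    · subst hk
      have : a' ≠ a := fun h => he ⟨rfl, h⟩
      simp [this]
    · simp [hk]

lemma Mem.setW_same (m : Mem) (k a : ℕ) : m.setW k a (m.w k a) = m := by simp [Mem.setW]

lemma Mem.setR_same (m : Mem) (k a : ℕ) : m.setR k a (m.r k a) = m := by simp [Mem.setR]

lemma Mem.setW_frame (m : Mem) (k a v : ℕ) :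
    (∀ k' ∉ ({k} : Finset ℕ), (m.setW k a v).w k' = m.w k') := by
  intro k' hk'
  simp only [Finset.mem_singleton] at hk'
  simp [Mem.setW, hk']

lemma Mem.setR_frame (m : Mem) (k a : ℕ) (v : ℝ) :
    (∀ k' ∉ ({k} : Finset ℕ), (m.setR k a v).r k' = m.r k') := by
  intro k' hk'
  simp only [Finset.mem_singleton] at hk'
  simp [Mem.setR, hk']

lemma Holds.of_reg {d : ℕ} {env : ℕ → ℕ} {m : Mem} {σ : Store} (h : Holds W B d env m σ)
    {f : ℕ → ℕ} {g : ℕ → ℝ} (hf : ∀ x < d, f x = σ.wreg x) :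
    Holds W B d env m { σ with wreg := f, rreg := g } :=
  ⟨fun x hx => (hf x hx).trans (h.reg x hx), h.le, h.base, h.word, h.real⟩

/-- A command whose precondition holds runs within the bounds, in the estimated time. -/
theorem Cmd.run (hM : 8 * B ≤ M) (hW : 8 * B ≤ W) (hB : 0 < B) {p : ℕ → ℕ} (c : Cmd) :
    ∀ {d : ℕ} {env : ℕ → ℕ} {m : Mem} {Q : Mem → Prop} {σ : Store}, 4 < d → (∀ x < 5, env x = p x) →
      Holds W B d env m σ → c.wp W B d env Q m →
      ∃ t τ m', Run M W (c.compile d) σ t τ ∧ t ≤ c.cost p ∧ Holds W B d env m' τ ∧ c.Frame m m' ∧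
        Q m' := by
  induction c with
  | skip =>
    intro d env m Q σ hd hp h hs
    exact ⟨1, σ, m, .skip _, le_rfl, h, .refl _ _, hs⟩
  | wset k a e =>
    intro d env m Q σ hd hp h hs
    obtain ⟨hk, hsa, ha, hse, hQ⟩ := hs
    obtain ⟨τ, hr, hv, hA⟩ := e.run hM hW hB 0 hd le_rfl h hse
    have h' := h.agree hA le_rfl
    obtain ⟨υ, ζ, hr₁, hr₂, hv', hlt, hA'⟩ :=
      a.run_shift hM hW hB 0 hd (Nat.le_succ d) h' hk hsa ha
    have h'' := h'.agree hA' (Nat.le_succ d)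
    refine ⟨_, _, _, .seq hr (.seq hr₁ (.seq hr₂ (.wstore _ _ _ hlt))), ?_, ?_, ?_, hQ⟩
    · simp only [cost]; omega
    · rw [hv', hA'.wreg d (by omega), hv]
      exact h''.setW ha _
    · exact ⟨m.setW_frame k _ _, fun _ _ => rfl⟩
  | wmin k a e =>
    intro d env m Q σ hd hp h hs
    obtain ⟨hk, hsa, ha, hse, hQ⟩ := hs
    obtain ⟨τ, hr, hv, hA⟩ := e.run hM hW hB 0 hd le_rfl h hse
    have h' := h.agree hA le_rfl
    obtain ⟨υ, ζ, hr₁, hr₂, hv', hlt, hA'⟩ :=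
      a.run_shift hM hW hB 0 hd (Nat.le_succ d) h' hk hsa ha
    have h'' := h'.agree hA' (Nat.le_succ d)
    have hv := (hA'.wreg d (by omega)).trans hv
    have h3 : Holds W B d env m { ζ with wreg := Function.update ζ.wreg (d + 2) (m.w k (a.eval env m)) } :=
      h''.of_reg (g := ζ.rreg) fun x hx => by simp [Function.update_of_ne (show x ≠ d + 2 by omega)]
    have hl : Run M W (.wload (d + 2) (d + 1)) ζ 1
        { ζ with wreg := Function.update ζ.wreg (d + 2) (m.w k (a.eval env m)) } := by
      rw [← h''.word k hk _ ha, ← hv']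
      exact .wload _ _ _ hlt
    by_cases hc : e.eval env m < m.w k (a.eval env m)
    · refine ⟨_, _, _, .seq hr (.seq hr₁ (.seq hr₂ (.seq hl (.condTrue ?_ (.wstore _ _ _ ?_))))), ?_, ?_, ?_,
        hQ⟩
      · simpa [Test.Holds, hv] using hc
      · simpa using hlt
      · simp only [cost]; omega
      · have := h3.setW (k := k) ha (e.eval env m)
        rw [min_eq_right hc.le]
        convert this using 2
        simp [hv', hv]
      · exact ⟨m.setW_frame k _ _, fun _ _ => rfl⟩
    · refine ⟨_, _, _, .seq hr (.seq hr₁ (.seq hr₂ (.seq hl (.condFalse ?_ (.skip _))))), ?_, ?_, ?_,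
        hQ⟩
      · simpa [Test.Holds, hv] using hc
      · simp only [cost]; omega
      · rw [min_eq_left (not_lt.1 hc), Mem.setW_same]
        exact h3
      · exact ⟨m.setW_frame k _ _, fun _ _ => rfl⟩
  | rset k a e =>
    intro d env m Q σ hd hp h hs
    obtain ⟨hk, hsa, ha, hse, hQ⟩ := hs
    obtain ⟨τ, hr, hv, hA⟩ := e.run hM hW hB hd 0 h hse
    have h' := h.agree hA le_rfl
    -- The argument `1` records that real register 0, which holds the value to be stored, survives
    -- the computation of the address.
    obtain ⟨υ, ζ, hr₁, hr₂, hv', hlt, hA'⟩ := a.run_shift hM hW hB 1 hd le_rfl h' hk hsa ha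
    have h'' := h'.agree hA' le_rfl
    refine ⟨_, _, _, .seq hr (.seq hr₁ (.seq hr₂ (.rstore _ _ _ hlt))), ?_, ?_, ?_, hQ⟩
    · simp only [cost]; omega
    · rw [hv', hA'.rreg 0 (by omega), hv]
      exact h''.setR ha _
    · exact ⟨fun _ _ => rfl, m.setR_frame k _ _⟩
  | rmax k a e =>
    intro d env m Q σ hd hp h hs
    obtain ⟨hk, hsa, ha, hse, hQ⟩ := hs
    obtain ⟨τ, hr, hv, hA⟩ := e.run hM hW hB hd 0 h hse
    have h' := h.agree hA le_rfl
    obtain ⟨υ, ζ, hr₁, hr₂, hv', hlt, hA'⟩ := a.run_shift hM hW hB 1 hd le_rfl h' hk hsa ha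
    have h'' := h'.agree hA' le_rfl
    have hv := (hA'.rreg 0 (by omega)).trans hv
    have h3 : Holds W B d env m { ζ with rreg := Function.update ζ.rreg 1 (m.r k (a.eval env m)) } :=
      h''.of_reg (f := ζ.wreg) fun x hx => rfl
    have hl : Run M W (.rload 1 d) ζ 1
        { ζ with rreg := Function.update ζ.rreg 1 (m.r k (a.eval env m)) } := by
      rw [← h''.real k hk _ ha, ← hv']
      exact .rload _ _ _ hlt
    by_cases hc : m.r k (a.eval env m) < e.eval env m
    · refine ⟨_, _, _, .seq hr (.seq hr₁ (.seq hr₂ (.seq hl (.condTrue ?_ (.rstore _ _ _ ?_))))), ?_, ?_, ?_,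
        hQ⟩
      · simpa [Test.Holds, hv] using hc
      · simpa using hlt
      · simp only [cost]; omega
      · have := h3.setR (k := k) ha (e.eval env m)
        rw [max_eq_right hc.le]
        convert this using 2
        simp [hv', hv]
      · exact ⟨fun _ _ => rfl, m.setR_frame k _ _⟩
    · refine ⟨_, _, _, .seq hr (.seq hr₁ (.seq hr₂ (.seq hl (.condFalse ?_ (.skip _))))), ?_, ?_, ?_,
        hQ⟩
      · simpa [Test.Holds, hv] using hc
      · simp only [cost]; omega
      · rw [max_eq_left (not_lt.1 hc), Mem.setR_same]
        exact h3
      · exact ⟨fun _ _ => rfl, m.setR_frame k _ _⟩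
  | ite a b c₁ c₂ ih₁ ih₂ =>
    intro d env m Q σ hd hp h hs
    obtain ⟨hsa, hsb, h1, h2⟩ := hs
    obtain ⟨τ, hr, hv, hA⟩ := a.run hM hW hB 0 hd le_rfl h hsa
    have h' := h.agree hA le_rfl
    obtain ⟨υ, hr', hv', hA'⟩ := b.run hM hW hB 0 hd (Nat.le_succ d) h' hsb
    have h'' := h'.agree hA' (Nat.le_succ d)
    have hv := (hA'.wreg d (by omega)).trans hv
    by_cases hc : a.eval env m < b.eval env m
    · obtain ⟨t, τ, m', hr₃, ht, h3, hF, hQ⟩ := ih₁ hd hp h'' (h1 hc)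
      refine ⟨_, τ, m', .seq hr (.seq hr' (.condTrue ?_ hr₃)), ?_, h3,
        hF.mono Finset.subset_union_left Finset.subset_union_left, hQ⟩
      · simpa [Test.Holds, hv, hv'] using hc
      · simp only [cost]; omega
    · obtain ⟨t, τ, m', hr₃, ht, h3, hF, hQ⟩ := ih₂ hd hp h'' (h2 hc)
      refine ⟨_, τ, m', .seq hr (.seq hr' (.condFalse ?_ hr₃)), ?_, h3,
        hF.mono Finset.subset_union_right Finset.subset_union_right, hQ⟩
      · simpa [Test.Holds, hv, hv'] using hc
      · simp only [cost]; omega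
  | seq c₁ c₂ ih₁ ih₂ =>
    intro d env m Q σ hd hp h hs
    obtain ⟨t, τ, m', hr, ht, h', hF, hs'⟩ := ih₁ hd hp h hs
    obtain ⟨t', τ', m'', hr', ht', h'', hF', hQ⟩ := ih₂ hd hp h' hs'
    exact ⟨_, τ', m'', .seq hr hr', add_le_add ht ht', h'',
      (hF.mono Finset.subset_union_left Finset.subset_union_left).trans
        (hF'.mono Finset.subset_union_right Finset.subset_union_right), hQ⟩
  | iter b c ih =>
    intro d env m Q σ hd hp h hs
    obtain ⟨hb, I, h0, hstep, hfin⟩ := hs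
    have hbd : b ≠ d := by omega
    -- Induction on the number `i` of remaining passes. A pass costs the body plus 3 (test,
    -- constant, increment), and the last failing test accounts for the `+ 1`.
    suffices H : ∀ i k, k + i = env b → ∀ σ' m', σ'.wreg d = k → Holds W B d env m' σ' →
        c.Frame m m' → I k m' → ∃ t τ m'', Run M W (.loop (.wordLT d b)
          (.seq (c.compile (d + 1)) (.seq (.wconst (d + 1) 1) (.wop .add d d (d + 1))))) σ' t τ ∧
          t ≤ i * (c.cost p + 3) + 1 ∧ Holds W B d env m'' τ ∧ c.Frame m m'' ∧ I (env b) m'' by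
      obtain ⟨t, τ, m'', hr, ht, h'', hF, hI⟩ := H (env b) 0 (Nat.zero_add _)
        { σ with wreg := Function.update σ.wreg d 0 } m (by simp)
        (h.of_reg (g := σ.rreg) fun x hx => by simp [Function.update_of_ne (show x ≠ d by omega)]) (.refl _ _) h0
      refine ⟨_, τ, m'', .seq (.wconst _ _ _ (Nat.zero_le _)) hr, ?_, h'', hF, hfin m'' hF hI⟩
      simp only [cost]
      rw [← hp b hb]; omega
    intro i
    induction i with
    | zero =>
      intro k hk σ' m' hd' h' hF hI
      refine ⟨1, σ', m', .loopFalse ?_, by omega, h', hF, by simpa [← hk] using hI⟩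
      simp [Test.Holds, hd', h'.reg b (by omega), ← hk]
    | succ i ihi =>
      intro k hk σ' m' hd' h' hF hI
      have hkW : k ≤ W := by have := h.le b (by omega); omega
      -- Inside the body the counter becomes one more meaningful register.
      have hcar : Holds W B (d + 1) (Function.update env d k) m' σ' := by
        refine ⟨fun x hx => ?_, fun x hx => ?_, ?_, h'.word, h'.real⟩
        · rcases Nat.lt_succ_iff_lt_or_eq.1 hx with hx | rfl
          · rw [Function.update_of_ne (by omega), h'.reg x hx]
          · simp [hd']
        · rcases Nat.lt_succ_iff_lt_or_eq.1 hx with hx | rfl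
          · rw [Function.update_of_ne (by omega)]; exact h'.le x hx
          · simpa using hkW
        · rw [Function.update_of_ne (by omega)]; exact h'.base
      obtain ⟨t, τ, m'', hr, ht, h'', hF', hI'⟩ := ih (by omega)
        (fun x hx => by rw [Function.update_of_ne (by omega)]; exact hp x hx) hcar
        (hstep k (by omega) m' hF hI)
      have hτd : τ.wreg d = k := by simpa using h''.reg d (by omega)
      obtain ⟨t', υ, m₃, hr', ht', h₃, hF₃, hI₃⟩ := ihi (k + 1) (by omega)
        { τ with wreg := Function.update (Function.update τ.wreg (d + 1) 1) d (k + 1) } m''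
        (by simp) (by
          refine ⟨fun x hx => ?_, h'.le, h'.base, h''.word, h''.real⟩
          have := h''.reg x (by omega)
          rw [Function.update_of_ne (by omega)] at this
          simp [Function.update_of_ne (show x ≠ d by omega),
            Function.update_of_ne (show x ≠ d + 1 by omega), this])
        (hF.trans hF') hI'
      have hstep' : Run M W (.seq (.wconst (d + 1) 1) (.wop .add d d (d + 1))) τ 2
          { τ with wreg := Function.update (Function.update τ.wreg (d + 1) 1) d (k + 1) } := by
        have hw : k + 1 ≤ W := by have := h.le b (by omega); omega
        have := Run.seq (M := M) (.wconst τ (d + 1) 1 (by omega : 1 ≤ W))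
          (.wop _ .add d d (d + 1) (by simpa [WordOp.eval, hτd] using hw))
        simpa [WordOp.eval, hτd] using this
      refine ⟨_, υ, m₃, .loopTrue ?_ (.seq hr hstep') hr', ?_, h₃, hF₃, hI₃⟩
      · simp [Test.Holds, hd', h'.reg b (by omega)]; omega
      · rw [add_mul]; omega

end Soundness

/-- The implication is required only for memories within the frame of `c`. For a loop the invariant
is kept and only the exit condition is weakened. -/
lemma Cmd.wp_mono {W B : ℕ} (c : Cmd) : ∀ {d : ℕ} {env : ℕ → ℕ} {Q Q' : Mem → Prop} {m : Mem},
    c.wp W B d env Q m → (∀ m', c.Frame m m' → Q m' → Q' m') → c.wp W B d env Q' m := by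
  induction c with
  | skip => intro d env Q Q' m h hQ; exact hQ m (.refl _ _) h
  | wset k a e =>
    intro d env Q Q' m h hQ
    exact ⟨h.1, h.2.1, h.2.2.1, h.2.2.2.1, hQ _ ⟨m.setW_frame k _ _, fun _ _ => rfl⟩ h.2.2.2.2⟩
  | wmin k a e =>
    intro d env Q Q' m h hQ
    exact ⟨h.1, h.2.1, h.2.2.1, h.2.2.2.1, hQ _ ⟨m.setW_frame k _ _, fun _ _ => rfl⟩ h.2.2.2.2⟩
  | rset k a e =>
    intro d env Q Q' m h hQ
    exact ⟨h.1, h.2.1, h.2.2.1, h.2.2.2.1, hQ _ ⟨fun _ _ => rfl, m.setR_frame k _ _⟩ h.2.2.2.2⟩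
  | rmax k a e =>
    intro d env Q Q' m h hQ
    exact ⟨h.1, h.2.1, h.2.2.1, h.2.2.2.1, hQ _ ⟨fun _ _ => rfl, m.setR_frame k _ _⟩ h.2.2.2.2⟩
  | ite a b c₁ c₂ ih₁ ih₂ =>
    intro d env Q Q' m h hQ
    exact ⟨h.1, h.2.1,
      fun hc => ih₁ (h.2.2.1 hc) fun m' hF => hQ m'
        (hF.mono Finset.subset_union_left Finset.subset_union_left),
      fun hc => ih₂ (h.2.2.2 hc) fun m' hF => hQ m'
        (hF.mono Finset.subset_union_right Finset.subset_union_right)⟩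
  | seq c₁ c₂ ih₁ ih₂ =>
    intro d env Q Q' m h hQ
    exact ih₁ h fun m₁ hF₁ h₁ => ih₂ h₁ fun m₂ hF₂ h₂ => hQ m₂
      ((hF₁.mono Finset.subset_union_left Finset.subset_union_left).trans
        (hF₂.mono Finset.subset_union_right Finset.subset_union_right)) h₂
  | iter b c ih =>
    intro d env Q Q' m h hQ
    obtain ⟨hb, I, h0, hs, hf⟩ := h
    exact ⟨hb, I, h0, hs, fun m' hF hI => hQ m' hF (hf m' hF hI)⟩

/-- A loop whose steps preserve `J`, change the memory along the preorder `R`, and establish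
facts `Φ k` that persist along `R`. -/
lemma Cmd.wp_iter {W B b d : ℕ} {c : Cmd} {env : ℕ → ℕ} {Q : Mem → Prop} {m₀ : Mem}
    (J : Mem → Prop) (R : Mem → Mem → Prop) (Φ : ℕ → Mem → Prop) (hb : b < 5) (hJ : J m₀)
    (hrefl : R m₀ m₀) (htrans : ∀ m m', R m₀ m → R m m' → R m₀ m')
    (hΦ : ∀ k m m', R m m' → Φ k m → Φ k m')
    (hstep : ∀ k < env b, ∀ m, c.Frame m₀ m → J m →
      c.wp W B (d + 1) (Function.update env d k) (fun m' => J m' ∧ R m m' ∧ Φ k m') m)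
    (hQ : ∀ m, c.Frame m₀ m → J m → R m₀ m → (∀ k < env b, Φ k m) → Q m) :
    (Cmd.iter b c).wp W B d env Q m₀ := by
  refine ⟨hb, fun k m => J m ∧ R m₀ m ∧ ∀ i < k, Φ i m, ⟨hJ, hrefl, fun i hi => absurd hi (by omega)⟩,
    fun k hk m hF hI => ?_, fun m hF hI => hQ m hF hI.1 hI.2.1 hI.2.2⟩
  refine c.wp_mono (hstep k hk m hF hI.1) fun m' _ h => ⟨h.1, htrans _ _ hI.2.1 h.2.1, fun i hi => ?_⟩
  rcases Nat.lt_succ_iff_lt_or_eq.1 hi with hi | rfl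
  · exact hΦ i m m' h.2.1 (hI.2.2 i hi)
  · exact h.2.2

end FastRobber

namespace FastRobber.Arena

/-! ### Optimal escape probabilities -/

variable {V : Type}

lemma prod_survival_mem (A : Arena V) (c : V) {F : Finset (Sym2 V)} (hF : F ⊆ A.edges) :
    0 ≤ ∏ e ∈ F, A.survival c e ∧ ∏ e ∈ F, A.survival c e ≤ 1 :=
  ⟨Finset.prod_nonneg fun e he => A.survival_nonneg c e (hF he),
   Finset.prod_le_one (fun e he => A.survival_nonneg c e (hF he))
    fun e he => A.survival_le_one c e (hF he)⟩

/-- The graph without its loops. -/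
def graph (A : Arena V) : SimpleGraph V := SimpleGraph.fromEdgeSet (A.edges : Set (Sym2 V))

/-- The graph without its loops and without the edges that meet `c`. -/
def avoid (A : Arena V) (c : V) : SimpleGraph V :=
  SimpleGraph.fromEdgeSet {e | e ∈ A.edges ∧ c ∉ e}

lemma graph_adj {A : Arena V} {u v : V} : A.graph.Adj u v ↔ s(u, v) ∈ A.edges ∧ u ≠ v := by simp [graph]

lemma avoid_adj {A : Arena V} {c u v : V} :
    (A.avoid c).Adj u v ↔ (s(u, v) ∈ A.edges ∧ c ≠ u ∧ c ≠ v) ∧ u ≠ v := by simp [avoid]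

variable [DecidableEq V]

/-- The probability that the robber survives the route `π` against a cop on `c`. -/
noncomputable def crossProb (A : Arena V) (c : V) (π : Route V) : ℝ :=
  if π.edgeSet ∩ A.watch (some c) = ∅ then 1 else A.pathSurvival c π

lemma crossProb_mem (A : Arena V) {r : V} {π : Route V} (h : A.IsPathFrom r π) (c : V) :
    0 ≤ A.crossProb c π ∧ A.crossProb c π ≤ 1 := by
  unfold crossProb
  split_ifs
  · exact ⟨zero_le_one, le_rfl⟩
  · exact A.pathSurvival_mem h c

/-- `x` is the largest survival probability of a route from `r` to `r'`, or zero if there is none. -/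
structure IsBest (A : Arena V) (c r r' : V) (x : ℝ) : Prop where
  nonneg : 0 ≤ x
  upper : ∀ π, A.IsPathFrom r π → π.last = r' → A.crossProb c π ≤ x
  attained : x = 0 ∨ ∃ π, A.IsPathFrom r π ∧ π.last = r' ∧ x ≤ A.crossProb c π

/-- Some walk from `u` to `v` has edge set `F`. -/
inductive Joins (A : Arena V) : V → V → Finset (Sym2 V) → Prop
  | refl (v : V) : Joins A v v ∅
  | cons {u v w : V} {F : Finset (Sym2 V)} (he : s(u, v) ∈ A.edges) (h : Joins A v w F) :
      Joins A u w (insert s(u, v) F)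

variable {A : Arena V}

lemma Joins.trans {u v w : V} {F F' : Finset (Sym2 V)} (h : A.Joins u v F) (h' : A.Joins v w F') :
    A.Joins u w (F ∪ F') := by
  induction h with
  | refl => simpa using h'
  | cons he _ ih => rw [Finset.insert_union]; exact .cons he (ih h')

lemma Joins.symm {u v : V} {F : Finset (Sym2 V)} (h : A.Joins u v F) : A.Joins v u F := by
  induction h with
  | refl => exact .refl _
  | @cons u v w F he _ ih =>
    have := ih.trans (.cons (Sym2.eq_swap ▸ he) (.refl u))
    rwa [insert_empty_eq, Finset.union_comm, ← Finset.insert_eq, Sym2.eq_swap] at this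

lemma Joins.subset {u v : V} {F : Finset (Sym2 V)} (h : A.Joins u v F) : F ⊆ A.edges := by
  induction h with
  | refl => simp
  | cons he _ ih => exact Finset.insert_subset he ih

/-- A route must have positive length, so the empty walk, which `Joins` allows, has to be excluded.
-/
lemma Joins.exists_isPathFrom {u v : V} {F : Finset (Sym2 V)} (h : A.Joins u v F)
    (hF : F.Nonempty) : ∃ π, A.IsPathFrom u π ∧ π.last = v ∧ π.edgeSet = F := by
  have key : ∃ l : List V, List.IsChain (fun u v => s(u, v) ∈ A.edges) (u :: l) ∧
      (⟨u, l⟩ : Route V).last = v ∧ (⟨u, l⟩ : Route V).edgeSet = F := by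
    clear hF
    induction h with
    | refl v => exact ⟨[], by simp, rfl, by simp [Route.edgeSet, Route.vertices]⟩
    | @cons u v w F he _ ih =>
      obtain ⟨l, hl, hw, hF⟩ := ih
      refine ⟨v :: l, ?_, ?_, ?_⟩
      · exact List.isChain_cons_cons.2 ⟨he, hl⟩
      · rw [← hw]
        simp [Route.last, Route.vertices]
      · rw [← hF]
        simp [Route.edgeSet, Route.vertices]
  obtain ⟨l, hl, hv, he⟩ := key
  refine ⟨⟨u, l⟩, ⟨rfl, ?_, hl⟩, hv, he⟩
  rintro rfl
  rw [← he] at hF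
  simp [Route.edgeSet, Route.vertices] at hF

lemma IsPathFrom.joins {r : V} {π : Route V} (h : A.IsPathFrom r π) :
    A.Joins r π.last π.edgeSet := by
  obtain ⟨rfl, -, h⟩ := h
  obtain ⟨a, l⟩ := π
  simp only [Route.vertices] at h
  induction l generalizing a with
  | nil => exact .refl a
  | cons b l ih =>
    rw [List.isChain_cons_cons] at h
    have := Joins.cons h.1 (ih b h.2)
    simpa [Route.last, Route.edgeSet, Route.vertices] using this

lemma IsPathFrom.exists_first_edge {r : V} {π : Route V} (h : A.IsPathFrom r π) :
    ∃ u, s(r, u) ∈ π.edgeSet := by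
  obtain ⟨rfl, hr, -⟩ := h
  obtain ⟨a, _ | ⟨b, l⟩⟩ := π
  · exact absurd rfl hr
  · exact ⟨b, by simp [Route.edgeSet, Route.vertices]⟩

section Products

variable (A) (c : V)

lemma prod_survival_anti {F F' : Finset (Sym2 V)} (h : F ⊆ F') (hF : F' ⊆ A.edges) :
    ∏ e ∈ F', A.survival c e ≤ ∏ e ∈ F, A.survival c e := by
  rw [← Finset.prod_sdiff h]
  exact mul_le_of_le_one_left (A.prod_survival_mem c (h.trans hF)).1
    (A.prod_survival_mem c (Finset.sdiff_subset.trans hF)).2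

/-- Edges in both sets occur twice on the left and once on the right, and a factor at most 1 can be
dropped. -/
lemma prod_survival_union {F F' : Finset (Sym2 V)} (h : F ⊆ A.edges) (h' : F' ⊆ A.edges) :
    (∏ e ∈ F, A.survival c e) * ∏ e ∈ F', A.survival c e ≤ ∏ e ∈ F ∪ F', A.survival c e := by
  have hd : Disjoint F (F' \ F) := Finset.disjoint_sdiff
  rw [← Finset.union_sdiff_self_eq_union, Finset.prod_union hd]
  exact mul_le_mul_of_nonneg_left (A.prod_survival_anti c Finset.sdiff_subset h')
    (A.prod_survival_mem c h).1

end Products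

/-- `y` is at most the survival probability of some walk from `c` to `x`, every edge of which
counts. -/
def Attained (A : Arena V) (c x : V) (y : ℝ) : Prop :=
  0 ≤ y ∧ (y = 0 ∨ ∃ F, A.Joins c x F ∧ y ≤ ∏ e ∈ F, A.survival c e)

lemma attained_one (c : V) : A.Attained c c 1 :=
  ⟨zero_le_one, .inr ⟨∅, .refl c, by simp⟩⟩

/-- This is soundness of one relaxation. If the new edge already lies on the walk, it is charged
again in the value but not in the product over the edge set, which is why `Attained` asks only for
an inequality. -/
lemma Attained.step {c x z : V} {y : ℝ} (h : A.Attained c x y) (he : s(x, z) ∈ A.edges) :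
    A.Attained c z (y * A.survival c s(x, z)) := by
  have hq := A.survival_nonneg c _ he
  refine ⟨mul_nonneg h.1 hq, ?_⟩
  rcases h.2 with h0 | ⟨F, hF, hy⟩
  · exact .inl (by rw [h0, zero_mul])
  · refine .inr ⟨_, hF.trans (.cons he (.refl z)), ?_⟩
    refine le_trans ?_ (A.prod_survival_union c hF.subset (by simpa using he))
    simpa using mul_le_mul_of_nonneg_right hy hq

/-- A route from r contains some edge at r. If that edge is watched, it is one of the factors;
otherwise 1 is the trivial bound. Going along the edge and back attains either value. -/
lemma IsBest.of_edges {c r : V} {S : ℝ}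
    (hge : ∀ u, s(r, u) ∈ A.edges → (if c ∈ s(r, u) then A.survival c s(r, u) else 1) ≤ S)
    (hat : S = 0 ∨ ∃ u, s(r, u) ∈ A.edges ∧
      S = if c ∈ s(r, u) then A.survival c s(r, u) else 1) : A.IsBest c r r S := by
  have hroute : ∀ u, s(r, u) ∈ A.edges → ∃ π, A.IsPathFrom r π ∧ π.last = r ∧
      (if c ∈ s(r, u) then A.survival c s(r, u) else 1) = A.crossProb c π := by
    intro u hu
    -- The walk r, u, r has a single edge in its edge set, so its factor is counted once.
    have hJ := Joins.cons hu (.cons (Sym2.eq_swap ▸ hu) (.refl r))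
    obtain ⟨π, h1, h2, h3⟩ := hJ.exists_isPathFrom (by simp)
    refine ⟨π, h1, h2, ?_⟩
    have h4 : π.edgeSet = {s(r, u)} := by rw [h3, Sym2.eq_swap (a := u)]; simp
    simp only [crossProb, h4, pathSurvival, Finset.prod_singleton, watch]
    by_cases hc : c ∈ s(r, u)
    · rw [if_pos hc, if_neg]
      exact Finset.nonempty_iff_ne_empty.1 ⟨s(r, u), by simp [hu, hc]⟩
    · rw [if_neg hc, if_pos]
      ext e
      simp only [Finset.mem_inter, Finset.mem_singleton, Finset.mem_filter, Finset.notMem_empty,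
        iff_false, not_and]
      rintro rfl _
      exact hc
  refine ⟨?_, fun π hπ _ => ?_, ?_⟩
  · rcases hat with h | ⟨u, hu, h⟩
    · exact h.ge
    · rw [h]
      split_ifs
      · exact A.survival_nonneg c _ hu
      · exact zero_le_one
  · obtain ⟨u, hu⟩ := hπ.exists_first_edge
    have hs := A.edgeSet_subset hπ
    refine le_trans ?_ (hge u (hs hu))
    split_ifs with hc
    · rw [crossProb, if_neg]
      · simpa [pathSurvival] using A.prod_survival_anti c (Finset.singleton_subset_iff.2 hu) hs
      · exact Finset.nonempty_iff_ne_empty.1 ⟨s(r, u), by simpa [watch, hu, hs hu] using hc⟩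
    · exact (A.crossProb_mem hπ c).2
  · rcases hat with h | ⟨u, hu, h⟩
    · exact .inl h
    · obtain ⟨π, h1, h2, h3⟩ := hroute u hu
      exact .inr ⟨π, h1, h2, (h.trans h3).le⟩

/-- A route that meets no watched edge is safe by the rules, whatever factors its edges carry. The
hypothesis `r ≠ r'` makes it nonempty. -/
lemma IsBest.of_reachable {c r r' : V} (hr : r ≠ r') (h : (A.avoid c).Reachable r r') :
    A.IsBest c r r' 1 := by
  refine ⟨zero_le_one, fun π hπ _ => (A.crossProb_mem hπ c).2, .inr ?_⟩
  have key : ∀ {u v : V}, (A.avoid c).Walk u v → ∃ F, A.Joins u v F ∧ ∀ e ∈ F, c ∉ e := by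
    intro u v p
    induction p with
    | nil => exact ⟨∅, .refl _, by simp⟩
    | cons ha _ ih =>
      obtain ⟨F, hF, hc⟩ := ih
      rw [avoid_adj] at ha
      refine ⟨_, .cons ha.1.1 hF, ?_⟩
      simp only [Finset.mem_insert, forall_eq_or_imp, Sym2.mem_iff, not_or]
      exact ⟨ha.1.2, hc⟩
  obtain ⟨p⟩ := h
  obtain ⟨F, hF, hc⟩ := key p
  have hne : F.Nonempty := by
    rcases F.eq_empty_or_nonempty with rfl | h
    · exfalso
      -- The index must be a variable before case analysis on `Joins`; the `cons` case then fails
      -- because `insert` is nonempty.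
      generalize hE : (∅ : Finset (Sym2 V)) = E at hF
      cases hF with
      | refl => exact hr rfl
      | cons => exact Finset.insert_ne_empty _ _ hE.symm
    · exact h
  obtain ⟨π, h1, h2, h3⟩ := hF.exists_isPathFrom hne
  refine ⟨π, h1, h2, ?_⟩
  rw [crossProb, if_pos]
  rw [h3, ← Finset.disjoint_iff_inter_eq_empty, Finset.disjoint_left]
  intro e he
  simp [watch, hc e he]

/-- Every route has to pass through c, so the two ends decouple. The hypotheses on `D` are exactly
what the relaxation provides: it dominates the product along every walk to c of length below |V|,
and it never exceeds what some walk achieves, or is zero. Unreachable pairs come out as 0. -/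
lemma IsBest.of_not_reachable [Fintype V] {c r r' : V} (hr : r ≠ r')
    (h : ¬ (A.avoid c).Reachable r r') {D : V → ℝ}
    (hlow : ∀ x (p : A.graph.Walk x c), p.length < Fintype.card V →
      (p.edges.map (A.survival c)).prod ≤ D x)
    (hat : ∀ x, A.Attained c x (D x)) : A.IsBest c r r' (D r * D r') := by
  refine ⟨mul_nonneg (hat r).1 (hat r').1, fun π hπ hl => ?_, ?_⟩
  · subst hl
    have hs := A.edgeSet_subset hπ
    have hJ := hπ.joins
    generalize π.last = r' at hr h hJ
    -- The simple path is sought in the graph spanned by the route's own edges, so that its product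
    -- dominates that of the route.
    have hreach : (SimpleGraph.fromEdgeSet (π.edgeSet : Set (Sym2 V))).Reachable r r' := by
      suffices ∀ {u v : V} {F : Finset (Sym2 V)}, A.Joins u v F → F ⊆ π.edgeSet →
          (SimpleGraph.fromEdgeSet (π.edgeSet : Set (Sym2 V))).Reachable u v from
        this hJ subset_rfl
      intro u v F hJ
      induction hJ with
      | refl => intro _; exact .refl _
      | @cons u v w F he _ ih =>
        intro hF
        rw [Finset.insert_subset_iff] at hF
        refine SimpleGraph.Reachable.trans ?_ (ih hF.2)
        by_cases huv : u = v
        · subst huv; exact .refl _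
        · exact SimpleGraph.Adj.reachable (by simp [hF.1, huv])
    have hle : SimpleGraph.fromEdgeSet (π.edgeSet : Set (Sym2 V)) ≤ A.graph :=
      SimpleGraph.fromEdgeSet_mono (by exact_mod_cast hs)
    obtain ⟨p₀, hp₀⟩ := hreach.exists_isPath
    obtain ⟨p, hp, hpe⟩ : ∃ p : A.graph.Walk r r', p.IsPath ∧ ∀ e ∈ p.edges, e ∈ π.edgeSet := by
      refine ⟨p₀.mapLe hle, (SimpleGraph.Walk.isPath_mapLe hle).2 hp₀, fun e he => ?_⟩
      have := p₀.edges_subset_edgeSet (e := e) (by simpa using he)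
      simp at this
      exact this.1
    have hc : c ∈ p.support := by
      by_contra hc
      apply h
      refine ⟨p.transfer (A.avoid c) fun e he => ?_⟩
      have h1 := hs (hpe e he)
      have h2 : ¬ e.IsDiag := A.graph.not_isDiag_of_mem_edgeSet (p.edges_subset_edgeSet he)
      simp only [avoid, SimpleGraph.edgeSet_fromEdgeSet]
      refine ⟨⟨h1, fun hce => hc ?_⟩, h2⟩
      exact p.mem_support_of_mem_edges he hce
    have hedges : p.edges = (p.takeUntil c hc).edges ++ (p.dropUntil c hc).edges := by
      rw [← SimpleGraph.Walk.edges_append, SimpleGraph.Walk.take_spec]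
    -- Both pieces of a simple path are simple, hence have fewer than |V| edges and are covered by
    -- `hlow`; the second is reversed to end at c.
    have h1 := hlow r (p.takeUntil c hc) (hp.takeUntil hc).length_lt
    have h2 := hlow r' (p.dropUntil c hc).reverse (hp.dropUntil hc).reverse.length_lt
    rw [SimpleGraph.Walk.edges_reverse, List.map_reverse, List.prod_reverse] at h2
    have hprod : (p.edges.map (A.survival c)).prod = ∏ e ∈ p.edges.toFinset, A.survival c e :=
      (List.prod_toFinset _ hp.isTrail.edges_nodup).symm
    -- As `r ≠ r'`, the path has an edge at c. So the route is watched and its probability is the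
    -- full product.
    have hcross : A.crossProb c π ≤ (p.edges.map (A.survival c)).prod := by
      rw [crossProb, if_neg, hprod]
      · exact A.prod_survival_anti c (fun e he => hpe e (by simpa using he)) hs
      · intro h0
        have hne : p.edges ≠ [] := by
          intro h0
          cases p with
          | nil => exact hr rfl
          | cons => simp at h0
        obtain ⟨e, he, hce⟩ : ∃ e ∈ p.edges, c ∈ e := by
          have hnil : ¬ p.Nil := by
            intro h0; exact hr h0.eq
          exact (SimpleGraph.Walk.mem_support_iff_exists_mem_edges_of_not_nil hnil).1 hc
        have : e ∈ π.edgeSet ∩ A.watch (some c) := by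
          simp [watch, hpe e he, hs (hpe e he), hce]
        rw [h0] at this
        simp at this
    refine hcross.trans ?_
    rw [hedges, List.map_append, List.prod_append]
    refine mul_le_mul h1 h2 ?_ (hat r).1
    refine List.prod_nonneg fun x hx => ?_
    obtain ⟨e, he, rfl⟩ := List.mem_map.1 hx
    exact A.survival_nonneg c e (hs (hpe e (by rw [hedges]; simp [he])))
  · rcases (hat r).2 with h0 | ⟨F, hF, hy⟩
    · exact .inl (by rw [h0, zero_mul])
    rcases (hat r').2 with h0 | ⟨F', hF', hy'⟩
    · exact .inl (by rw [h0, mul_zero])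
    have hJ := hF.symm.trans hF'
    have hne : (F ∪ F').Nonempty := by
      rcases (F ∪ F').eq_empty_or_nonempty with h0 | h
      · exfalso
        rw [h0] at hJ
        generalize hE : (∅ : Finset (Sym2 V)) = E at hJ
        cases hJ with
        | refl => exact hr rfl
        | cons => exact Finset.insert_ne_empty _ _ hE.symm
      · exact h
    obtain ⟨π, h1, h2, h3⟩ := hJ.exists_isPathFrom hne
    refine .inr ⟨π, h1, h2, ?_⟩
    have h4 := mul_le_mul hy hy' (hat r').1 (A.prod_survival_mem c hF.subset).1
    have h5 := h4.trans (A.prod_survival_union c hF.subset hF'.subset)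
    rw [crossProb, pathSurvival, h3]
    split_ifs
    · exact h5.trans (A.prod_survival_mem c (Finset.union_subset hF.subset hF'.subset)).2
    · exact h5

end FastRobber.Arena

/-! ### The recursion of the game -/

namespace GPCRGame

variable {S A B : Type} [Fintype S]

/-- The value of a state with the robber to move, `n` turns remaining after her move. -/
noncomputable def robValue (G : GPCRGame S A B) (n : ℕ) (s : S) : ℝ :=
  ⨅ b : {b : B // G.RobPlayable s b}, ∑ s'', G.robT s b s'' * G.w n s''

lemma average_mem {T x : S → ℝ} (hT : ∀ s, 0 ≤ T s) (h1 : ∑ s, T s = 1)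
    (hx : ∀ s, 0 ≤ x s ∧ x s ≤ 1) : 0 ≤ ∑ s, T s * x s ∧ ∑ s, T s * x s ≤ 1 := by
  refine ⟨Finset.sum_nonneg fun s _ => mul_nonneg (hT s) (hx s).1, ?_⟩
  rw [← h1]
  exact Finset.sum_le_sum fun s _ => mul_le_of_le_one_right (hT s) (hx s).2

lemma iInf_mem {ι : Type} [Nonempty ι] {x : ι → ℝ} (hx : ∀ i, 0 ≤ x i ∧ x i ≤ 1) :
    0 ≤ ⨅ i, x i ∧ ⨅ i, x i ≤ 1 :=
  ⟨le_ciInf fun i => (hx i).1, ciInf_le_of_le ⟨0, by rintro _ ⟨i, rfl⟩; exact (hx i).1⟩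
    (Classical.arbitrary ι) (hx _).2⟩

lemma iSup_mem {ι : Type} [Nonempty ι] {x : ι → ℝ} (hx : ∀ i, 0 ≤ x i ∧ x i ≤ 1) :
    0 ≤ ⨆ i, x i ∧ ⨆ i, x i ≤ 1 :=
  ⟨le_ciSup_of_le ⟨1, by rintro _ ⟨i, rfl⟩; exact (hx i).2⟩ (Classical.arbitrary ι) (hx _).1,
    ciSup_le fun i => (hx i).2⟩

variable (G : GPCRGame S A B)

lemma w_mem (n : ℕ) : ∀ s, 0 ≤ G.w n s ∧ G.w n s ≤ 1 := by
  induction n with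
  | zero => intro s; rw [w]; split_ifs <;> simp
  | succ n ih =>
    intro s
    rw [w]
    split_ifs
    · simp
    · have : Nonempty {a : A // G.CopPlayable s a} := by
        obtain ⟨a, ha⟩ := G.exists_copPlayable s; exact ⟨⟨a, ha⟩⟩
      refine iSup_mem fun a => average_mem (G.copT_nonneg _ _) a.2 fun s' => ?_
      have : Nonempty {b : B // G.RobPlayable s' b} := by
        obtain ⟨b, hb⟩ := G.exists_robPlayable s'; exact ⟨⟨b, hb⟩⟩
      exact iInf_mem fun b => average_mem (G.robT_nonneg _ _) b.2 ih

lemma robValue_nonneg (n : ℕ) (s : S) : 0 ≤ G.robValue n s := by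
  have : Nonempty {b : B // G.RobPlayable s b} := by
    obtain ⟨b, hb⟩ := G.exists_robPlayable s; exact ⟨⟨b, hb⟩⟩
  exact (iInf_mem fun b => average_mem (G.robT_nonneg _ _) b.2 (G.w_mem n)).1

lemma robValue_eq {n : ℕ} {s : S} {x : ℝ}
    (hle : ∀ b, G.RobPlayable s b → x ≤ ∑ s', G.robT s b s' * G.w n s')
    (hat : ∃ b, G.RobPlayable s b ∧ ∑ s', G.robT s b s' * G.w n s' ≤ x) : G.robValue n s = x := by
  obtain ⟨b, hb, hx⟩ := hat
  have : Nonempty {b : B // G.RobPlayable s b} := ⟨⟨b, hb⟩⟩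
  refine le_antisymm (ciInf_le_of_le ⟨x, ?_⟩ ⟨b, hb⟩ hx) (le_ciInf fun b => hle b b.2)
  rintro _ ⟨b, rfl⟩
  exact hle b b.2

lemma w_succ_eq {n : ℕ} {s : S} {x : ℝ} (hs : s ∉ G.final)
    (hle : ∀ a, G.CopPlayable s a → ∑ s', G.copT s a s' * G.robValue n s' ≤ x)
    (hat : ∃ a, G.CopPlayable s a ∧ x ≤ ∑ s', G.copT s a s' * G.robValue n s') :
    G.w (n + 1) s = x := by
  obtain ⟨a, ha, hx⟩ := hat
  have : Nonempty {a : A // G.CopPlayable s a} := ⟨⟨a, ha⟩⟩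
  rw [w, if_neg hs]
  refine le_antisymm (ciSup_le fun a => hle a a.2) (le_ciSup_of_le ⟨x, ?_⟩ ⟨a, ha⟩ hx)
  rintro _ ⟨a, rfl⟩
  exact hle a a.2

end GPCRGame

/-! ### The recursion expressed through best escape probabilities. -/

namespace FastRobber.Arena

variable {V : Type} [Fintype V] [DecidableEq V]

lemma sum_dirac_mul (s : Pos V) (x : Pos V → ℝ) : ∑ s', dirac s s' * x s' = x s := by
  simp [dirac]

/-- With `crossProb` equal to 1 on unwatched routes, the two cases of the transition rule become one
formula. -/
lemma sum_runT_mul (A : Arena V) (c : V) (π : Route V) (x : Pos V → ℝ) :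
    ∑ s, A.runT (some c) π s * x s =
      A.crossProb c π * x (.at (some c) (some π.last)) + (1 - A.crossProb c π) * x .jail := by
  unfold runT crossProb
  dsimp only
  split_ifs with h
  · rw [sum_dirac_mul]; ring
  · have key : ∀ s : Pos V, (if s = .at (some c) (some π.last) then A.pathSurvival c π
        else if s = .jail then 1 - A.pathSurvival c π else 0) * x s =
        (if s = .at (some c) (some π.last) then A.pathSurvival c π * x s else 0) +
        (if s = .jail then (1 - A.pathSurvival c π) * x s else 0) := by
      intro s
      rcases s with _ | ⟨c', r'⟩ <;> simp
    simp only [key, Finset.sum_add_distrib, Finset.sum_ite_eq', Finset.mem_univ, if_true]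

/-- The cop, being on `c`, may go to `a`. -/
def CopMove (A : Arena V) : Option V → V → Prop
  | none, _ => True
  | some c, a => A.InClosedNbhd c a

variable [Nonempty V] (A : Arena V)

lemma w_jail (n : ℕ) : A.game.w n .jail = 1 := by
  cases n <;> simp [GPCRGame.w, game]

lemma w_zero_at (c r : Option V) : A.game.w 0 (.at c r) = 0 := by
  simp [GPCRGame.w, game]

lemma copT_at (c r : Option V) (a : V) :
    (A.game.CopPlayable (.at c r) a ↔ A.CopMove c a) ∧
    (A.CopMove c a → A.game.copT (.at c r) a = dirac (.at (some a) r)) := by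
  rcases c with _ | c
  · exact ⟨⟨fun _ => trivial, fun _ => sum_dirac _⟩, fun _ => rfl⟩
  · by_cases h : A.InClosedNbhd c a <;>
      simp [GPCRGame.CopPlayable, game, copT, CopMove, h, sum_dirac]

lemma w_succ_at {n : ℕ} {c r : Option V} {U : V → ℝ}
    (hU : ∀ a, A.game.robValue n (.at (some a) r) = 1 - U a) {x : ℝ}
    (hge : ∀ a, A.CopMove c a → 1 - U a ≤ x) (hat : ∃ a, A.CopMove c a ∧ x = 1 - U a) :
    A.game.w (n + 1) (.at c r) = x := by
  have hsum : ∀ a, A.CopMove c a →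
      ∑ s', A.game.copT (.at c r) a s' * A.game.robValue n s' = 1 - U a := by
    intro a ha
    rw [(A.copT_at c r a).2 ha, sum_dirac_mul, hU]
  refine A.game.w_succ_eq (by simp [game]) (fun a ha => ?_) ?_
  · have ha := (A.copT_at c r a).1.1 ha
    rw [hsum a ha]; exact hge a ha
  · obtain ⟨a, ha, hx⟩ := hat
    exact ⟨a, (A.copT_at c r a).1.2 ha, by rw [hsum a ha, hx]⟩

lemma robValue_start {n : ℕ} {a : V} {u : ℝ}
    (hge : ∀ r, 1 - A.game.w n (.at (some a) (some r)) ≤ u)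
    (hat : ∃ r, u = 1 - A.game.w n (.at (some a) (some r))) :
    A.game.robValue n (.at (some a) none) = 1 - u := by
  have hplay : ∀ π : Route V, A.game.RobPlayable (.at (some a) none) π ↔ π.rest = [] := by
    intro π
    by_cases h : π.rest = [] <;> simp [GPCRGame.RobPlayable, game, robT, h, sum_dirac]
  have hsum : ∀ π : Route V, π.rest = [] →
      ∑ s', A.game.robT (.at (some a) none) π s' * A.game.w n s' =
        A.game.w n (.at (some a) (some π.first)) := by
    intro π h
    rw [← sum_dirac_mul (.at (some a) (some π.first)) (A.game.w n)]
    simp [game, robT, h]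
  refine A.game.robValue_eq (fun π hπ => ?_) ?_
  · rw [hsum π ((hplay π).1 hπ)]
    linarith [hge π.first]
  · obtain ⟨r, hr⟩ := hat
    refine ⟨⟨r, []⟩, (hplay _).2 rfl, ?_⟩
    rw [hsum _ rfl]
    linarith

/-- As the jail has value 1, a route yields 1 minus its survival probability times 1 - w at its end.
For a fixed end this decreases with the survival probability, so only the best route to each vertex
matters. -/
lemma robValue_run {n : ℕ} {a r : V} {P : V → ℝ} (hP : ∀ r', A.IsBest a r r' (P r')) {u : ℝ}
    (hge : ∀ r', P r' * (1 - A.game.w n (.at (some a) (some r'))) ≤ u)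
    (hat : u = 0 ∨ ∃ r', u = P r' * (1 - A.game.w n (.at (some a) (some r')))) :
    A.game.robValue n (.at (some a) (some r)) = 1 - u := by
  have hplay : ∀ π : Route V, A.game.RobPlayable (.at (some a) (some r)) π ↔ A.IsPathFrom r π := by
    intro π
    by_cases h : A.IsPathFrom r π <;> simp [GPCRGame.RobPlayable, game, robT, h, sum_runT]
  have hsum : ∀ π : Route V, A.IsPathFrom r π →
      ∑ s', A.game.robT (.at (some a) (some r)) π s' * A.game.w n s' =
        1 - A.crossProb a π * (1 - A.game.w n (.at (some a) (some π.last))) := by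
    intro π h
    have : A.game.robT (.at (some a) (some r)) π = A.runT (some a) π := by simp [game, robT, h]
    rw [this, sum_runT_mul, w_jail]
    ring
  have hw : ∀ r', 0 ≤ 1 - A.game.w n (.at (some a) (some r')) := fun r' =>
    sub_nonneg.2 (A.game.w_mem n _).2
  refine A.game.robValue_eq (fun π hπ => ?_) ?_
  · have hπ := (hplay π).1 hπ
    rw [hsum π hπ]
    linarith [hge π.last, mul_le_mul_of_nonneg_right ((hP π.last).upper π hπ rfl) (hw π.last)]
  -- A zero may be the initial value of a maximum, or the entry of an unreachable end, and need not
  -- come from a route. Then any playable route serves, since its value is at most 1.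
  · have hzero : u = 0 → ∃ π, A.game.RobPlayable (.at (some a) (some r)) π ∧
        ∑ s', A.game.robT (.at (some a) (some r)) π s' * A.game.w n s' ≤ 1 - u := by
      intro h0
      obtain ⟨π, hπ⟩ := A.exists_isPathFrom r
      refine ⟨π, (hplay π).2 hπ, ?_⟩
      rw [hsum π hπ]
      linarith [mul_nonneg (A.crossProb_mem hπ a).1 (hw π.last)]
    rcases hat with h0 | ⟨r', hu⟩
    · exact hzero h0
    rcases (hP r').attained with h0 | ⟨π, hπ, hl, hle⟩
    · exact hzero (by rw [hu, h0, zero_mul])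
    · refine ⟨π, (hplay π).2 hπ, ?_⟩
      rw [hsum π hπ, hl, hu]
      linarith [mul_le_mul_of_nonneg_right hle (hw r')]

end FastRobber.Arena

namespace FastRobber

/-! ### The program -/

@[simp] lemma Mem.setR_r_same (m : Mem) (k a : ℕ) (v : ℝ) :
    (m.setR k a v).r k = Function.update (m.r k) a v := by simp [setR]

@[simp] lemma Mem.setR_r_of_ne (m : Mem) {k k' : ℕ} (h : k' ≠ k) (a : ℕ) (v : ℝ) :
    (m.setR k a v).r k' = m.r k' := by simp [setR, h]

@[simp] lemma Mem.setR_w (m : Mem) (k a : ℕ) (v : ℝ) : (m.setR k a v).w = m.w := rfl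

@[simp] lemma Mem.setW_w_same (m : Mem) (k a v : ℕ) :
    (m.setW k a v).w k = Function.update (m.w k) a v := by simp [setW]

@[simp] lemma Mem.setW_w_of_ne (m : Mem) {k k' : ℕ} (h : k' ≠ k) (a v : ℕ) :
    (m.setW k a v).w k' = m.w k' := by simp [setW, h]

@[simp] lemma Mem.setW_r (m : Mem) (k a v : ℕ) : (m.setW k a v).r = m.r := rfl

/-- Branching on inequality. -/
def Cmd.ifNe (a b : WExp) (c₁ c₂ : Cmd) : Cmd := .ite a b c₁ (.ite b a c₁ c₂)

lemma Cmd.wp_ifNe {W B d : ℕ} {a b : WExp} {c₁ c₂ : Cmd} {env : ℕ → ℕ} {Q : Mem → Prop} {m : Mem}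
    (ha : a.Safe W B d env m) (hb : b.Safe W B d env m)
    (h₁ : a.eval env m ≠ b.eval env m → c₁.wp W B d env Q m)
    (h₂ : a.eval env m = b.eval env m → c₂.wp W B d env Q m) :
    (Cmd.ifNe a b c₁ c₂).wp W B d env Q m :=
  ⟨ha, hb, fun h => h₁ h.ne, fun h => ⟨hb, ha, fun h' => h₁ h'.ne', fun h' => h₂ (by omega)⟩⟩

lemma Cmd.wp_seq {W B d : ℕ} {c₁ c₂ : Cmd} {env : ℕ → ℕ} {Q : Mem → Prop} {m : Mem}
    (h : c₁.wp W B d env (c₂.wp W B d env Q) m) : (Cmd.seq c₁ c₂).wp W B d env Q m := h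

lemma Cmd.wp_rset {W B d k : ℕ} {a : WExp} {e : RExp} {env : ℕ → ℕ} {Q : Mem → Prop} {m : Mem}
    (x : ℕ) (v : ℝ) (hk : k < 8) (ha : a.Safe W B d env m) (hx : a.eval env m = x) (hxB : x < B)
    (he : e.Safe W B d env m) (hv : e.eval env m = v) (hQ : Q (m.setR k x v)) :
    (Cmd.rset k a e).wp W B d env Q m := by
  subst hx hv
  exact ⟨hk, ha, hxB, he, hQ⟩

/-- A step of a maximization: values keep a property `p` shared by the candidates, do not decrease,
and dominate the new candidate. -/
lemma Cmd.wp_rmax {W B d k : ℕ} {a : WExp} {e : RExp} {env : ℕ → ℕ} {Q : Mem → Prop} {m : Mem}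
    {p : ℕ → ℝ → Prop} (hJ : ∀ b, p b (m.r k b)) (x : ℕ) (v : ℝ) (hk : k < 8)
    (ha : a.Safe W B d env m) (hx : a.eval env m = x) (hxB : x < B) (he : e.Safe W B d env m)
    (hv : e.eval env m = v) (hp : p x v)
    (hQ : ∀ m', m'.w = m.w → (∀ k' ≠ k, m'.r k' = m.r k') → (∀ b, p b (m'.r k b)) →
      (∀ b, m.r k b ≤ m'.r k b) → v ≤ m'.r k x → Q m') :
    (Cmd.rmax k a e).wp W B d env Q m := by
  subst hx hv
  refine ⟨hk, ha, hxB, he, hQ _ rfl (fun k' hk' => Mem.setR_r_of_ne _ hk' _ _) (fun b => ?_)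
    (fun b => ?_) ?_⟩
  · rw [Mem.setR_r_same]
    by_cases hb : b = a.eval env m
    · subst hb
      rw [Function.update_self]
      rcases max_choice (m.r k (a.eval env m)) (e.eval env m) with h' | h' <;> rw [h']
      · exact hJ _
      · exact hp
    · rw [Function.update_of_ne hb]; exact hJ b
  · rw [Mem.setR_r_same]
    by_cases hb : b = a.eval env m
    · subst hb; simp
    · rw [Function.update_of_ne hb]
  · simp

/-- A step of a minimization. -/
lemma Cmd.wp_wmin {W B d k : ℕ} {a e : WExp} {env : ℕ → ℕ} {Q : Mem → Prop} {m : Mem}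
    {p : ℕ → ℕ → Prop} (hJ : ∀ b, p b (m.w k b)) (x : ℕ) (v : ℕ) (hk : k < 8)
    (ha : a.Safe W B d env m) (hx : a.eval env m = x) (hxB : x < B) (he : e.Safe W B d env m)
    (hv : e.eval env m = v) (hp : p x v)
    (hQ : ∀ m', m'.r = m.r → (∀ k' ≠ k, m'.w k' = m.w k') → (∀ b, p b (m'.w k b)) →
      (∀ b, m'.w k b ≤ m.w k b) → m'.w k x ≤ v → Q m') :
    (Cmd.wmin k a e).wp W B d env Q m := by
  subst hx hv
  refine ⟨hk, ha, hxB, he, hQ _ rfl (fun k' hk' => Mem.setW_w_of_ne _ hk' _ _) (fun b => ?_)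
    (fun b => ?_) ?_⟩
  · rw [Mem.setW_w_same]
    by_cases hb : b = a.eval env m
    · subst hb
      rw [Function.update_self]
      rcases min_choice (m.w k (a.eval env m)) (e.eval env m) with h' | h' <;> rw [h']
      · exact hJ _
      · exact hp
    · rw [Function.update_of_ne hb]; exact hJ b
  · rw [Mem.setW_w_same]
    by_cases hb : b = a.eval env m
    · subst hb; simp
    · rw [Function.update_of_ne hb]
  · simp

/-- Position `(a, b)` in a square array with rows of length `N + 1`. -/
def idx₂ (a b : WExp) : WExp := .add (.mul a (.var 3)) b

/-- Position `(a, b, c)` in a cubic array with rows of length `N + 1`. -/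
def idx₃ (a b c : WExp) : WExp := idx₂ (idx₂ a b) c

/-- The first endpoint of the edge whose number is in register `j`. -/
def fstEnd (j : ℕ) : WExp := .load 0 (.add (.var j) (.var j))

/-- The second endpoint of the edge whose number is in register `j`. -/
def sndEnd (j : ℕ) : WExp := .load 0 (.add (.add (.var j) (.var j)) (.lit 1))

/-- The survival probability of edge `j` against a cop on the vertex in register `5`. -/
def survExp (j : ℕ) : RExp := .load 0 (.add (.mul (.var 5) (.var 1)) (.var j))

/-- Initialize the arrays for a cop on the vertex in register `5`. -/
def initProg : Cmd :=
  .seq (.iter 0 (.seq (.rset 1 (.var 6) .zero) (.seq (.rset 2 (.var 6) .zero)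
    (.wset 1 (.var 6) (.var 6))))) (.rset 1 (.var 5) .one)

/-- Raise array `2` at both endpoints of the edge in register `6` to the given value. -/
def markProg (e : RExp) : Cmd := .seq (.rmax 2 (fstEnd 6) e) (.rmax 2 (sndEnd 6) e)

/-- Put into array `2` the best survival probability of a single edge at each vertex. -/
def edgeProg : Cmd :=
  .iter 1 (.ifNe (fstEnd 6) (.var 5)
    (.ifNe (sndEnd 6) (.var 5) (markProg .one) (markProg (survExp 6)))
    (markProg (survExp 6)))

/-- Put into array `1` the best survival probability of a walk to the cop. -/
def walkProg : Cmd :=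
  .iter 0 (.iter 1 (.seq
    (.rmax 1 (sndEnd 7) (.mul (.load 1 (fstEnd 7)) (survExp 7)))
    (.rmax 1 (fstEnd 7) (.mul (.load 1 (sndEnd 7)) (survExp 7)))))

/-- Put into word array `1` labels of the components of the unwatched edges. -/
def labelProg : Cmd :=
  .iter 0 (.iter 1 (.ifNe (fstEnd 7) (.var 5) (.ifNe (sndEnd 7) (.var 5) (.seq
    (.wmin 1 (sndEnd 7) (.load 1 (fstEnd 7)))
    (.wmin 1 (fstEnd 7) (.load 1 (sndEnd 7)))) .skip) .skip))

/-- Put into array `3` the best survival probabilities between any two vertices. -/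
def tableProg : Cmd :=
  .iter 0 (.iter 0 (.ifNe (.var 6) (.var 7)
    (.ifNe (.load 1 (.var 6)) (.load 1 (.var 7))
      (.rset 3 (idx₃ (.var 5) (.var 6) (.var 7)) (.mul (.load 1 (.var 6)) (.load 1 (.var 7))))
      (.rset 3 (idx₃ (.var 5) (.var 6) (.var 7)) .one))
    (.rset 3 (idx₃ (.var 5) (.var 6) (.var 7)) (.load 2 (.var 6)))))

/-- Fill array `3` for all positions of the cop. -/
def prepProg : Cmd :=
  .iter 0 (.seq initProg (.seq edgeProg (.seq walkProg (.seq labelProg tableProg))))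

/-- Set the square array `k` to zero, with `d` registers in use. -/
def resetProg (k d : ℕ) : Cmd := .iter 3 (.iter 3 (.rset k (idx₂ (.var d) (.var (d + 1))) .zero))

/-- Raise array `4` to the robber's best chances from her vertex. -/
def runProg : Cmd :=
  .iter 0 (.iter 0 (.iter 0 (.rmax 4 (idx₂ (.var 6) (.var 7))
    (.mul (.load 3 (idx₃ (.var 6) (.var 7) (.var 8)))
      (.sub .one (.load 0 (idx₂ (.var 6) (.var 8))))))))

/-- Raise array `4` to the robber's best chances from her starting point. -/
def startProg : Cmd :=
  .iter 0 (.iter 0 (.rmax 4 (idx₂ (.var 6) (.var 0)) (.sub .one (.load 0 (idx₂ (.var 6) (.var 7))))))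

/-- The cop's options of staying and of choosing his first vertex. -/
def stayProg : Cmd :=
  .iter 0 (.iter 3 (.seq
    (.rmax 0 (idx₂ (.var 6) (.var 7)) (.sub .one (.load 4 (idx₂ (.var 6) (.var 7)))))
    (.rmax 0 (idx₂ (.var 0) (.var 7)) (.sub .one (.load 4 (idx₂ (.var 6) (.var 7)))))))

/-- The cop's option of crossing an edge. -/
def crossProg : Cmd :=
  .iter 1 (.iter 3 (.seq
    (.rmax 0 (idx₂ (fstEnd 6) (.var 7)) (.sub .one (.load 4 (idx₂ (sndEnd 6) (.var 7)))))
    (.rmax 0 (idx₂ (sndEnd 6) (.var 7)) (.sub .one (.load 4 (idx₂ (fstEnd 6) (.var 7)))))))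

/-- One step of the recursion. -/
def turnProg : Cmd :=
  .seq (resetProg 4 6) (.seq runProg (.seq startProg (.seq (resetProg 0 6) (.seq stayProg crossProg))))

/-- The whole computation, after the registers `3` and `4` are set. -/
def mainCmd : Cmd :=
  .seq prepProg (.seq (resetProg 0 5) (.seq (.rset 0 (.mul (.var 3) (.var 3)) .one)
    (.iter 2 turnProg)))

/-! ### Bounds -/

/-- The registers hold the parameters of an instance with `N` vertices and `E` edges, and words up
to `W` and arrays of length `B` suffice. -/
structure Ctx (N E W B : ℕ) (env : ℕ → ℕ) : Prop where
  h0 : env 0 = N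
  h1 : env 1 = E
  h3 : env 3 = N + 1
  hE : E ≤ N * N
  hB : (N + 1) * (N + 1) * (N + 1) ≤ B
  hW : 8 * B ≤ W

namespace Ctx

variable {N E W B d : ℕ} {env : ℕ → ℕ} {m : Mem}

lemma update (h : Ctx N E W B env) {i : ℕ} (hi : 4 < i) (k : ℕ) :
    Ctx N E W B (Function.update env i k) :=
  ⟨by rw [Function.update_of_ne (by omega), h.h0], by rw [Function.update_of_ne (by omega), h.h1],
   by rw [Function.update_of_ne (by omega), h.h3], h.hE, h.hB, h.hW⟩

lemma sq_le (h : Ctx N E W B env) : (N + 1) * (N + 1) ≤ B := by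
  have := h.hB; nlinarith

lemma lt_base (h : Ctx N E W B env) {x : ℕ} (hx : x ≤ N) : x < B := by
  have := h.sq_le; nlinarith

lemma safe_idx₂ (h : Ctx N E W B env) {a b : WExp} (hd : 3 < d) (ha : a.Safe W B d env m)
    (hb : b.Safe W B d env m) (hva : a.eval env m < (N + 1) * (N + 1)) (hvb : b.eval env m ≤ N) :
    (idx₂ a b).Safe W B d env m ∧ (idx₂ a b).eval env m < B := by
  have h1 : a.eval env m * (N + 1) + b.eval env m < B := by have := h.hB; nlinarith
  have := h.hW
  refine ⟨⟨⟨ha, hd, ?_⟩, hb, ?_⟩, ?_⟩ <;> (try simp only [idx₂, WExp.eval, h.h3]) <;> nlinarith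

lemma sq_lt {a b : ℕ} (ha : a ≤ N) (hb : b ≤ N) : a * (N + 1) + b < (N + 1) * (N + 1) := by
  nlinarith

lemma safe_idx₂' (h : Ctx N E W B env) {a b : WExp} (hd : 3 < d) (ha : a.Safe W B d env m)
    (hb : b.Safe W B d env m) (hva : a.eval env m ≤ N) (hvb : b.eval env m ≤ N) :
    (idx₂ a b).Safe W B d env m ∧ (idx₂ a b).eval env m < B :=
  h.safe_idx₂ hd ha hb (by nlinarith) hvb

lemma safe_idx₃ (h : Ctx N E W B env) {a b c : WExp} (hd : 3 < d) (ha : a.Safe W B d env m)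
    (hb : b.Safe W B d env m) (hc : c.Safe W B d env m) (hva : a.eval env m ≤ N)
    (hvb : b.eval env m ≤ N) (hvc : c.eval env m ≤ N) :
    (idx₃ a b c).Safe W B d env m ∧ (idx₃ a b c).eval env m < B := by
  refine h.safe_idx₂ hd (h.safe_idx₂' hd ha hb hva hvb).1 hc ?_ hvc
  simpa only [idx₂, WExp.eval, h.h3] using sq_lt hva hvb

/-- The bound `E ≤ N * N` makes the 2E endpoints fit into one array of length at least (N+1)³. -/
lemma safe_ends (h : Ctx N E W B env) {j : ℕ} (hd : j < d) (hj : env j < E) :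
    (fstEnd j).Safe W B d env m ∧ (sndEnd j).Safe W B d env m := by
  have h1 := h.hE
  have h2 : env j + env j + 1 < B := by have := h.hB; nlinarith
  have := h.hW
  refine ⟨⟨by omega, ⟨hd, hd, ?_⟩, ?_⟩, ⟨by omega, ⟨⟨hd, hd, ?_⟩, ?_, ?_⟩, ?_⟩⟩ <;>
    (try simp only [WExp.eval, WExp.Safe]) <;> omega

lemma safe_surv (h : Ctx N E W B env) {j : ℕ} (hd : j < d) (hd' : 5 < d) (hj : env j < E)
    (h5 : env 5 < N) : (survExp j).Safe W B d env m := by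
  have h1 := h.hE
  have h2 : env 5 * E + env j < B := by
    have h3 : env 5 * E + env j < N * E := by nlinarith
    have h4 : N * E ≤ N * (N * N) := Nat.mul_le_mul_left _ h1
    have := h.hB
    nlinarith
  have := h.hW
  refine ⟨by omega, ⟨⟨hd', (show 1 < d by omega), ?_⟩, hd, ?_⟩, ?_⟩ <;>
    simp only [WExp.eval, h.h1] <;> omega

end Ctx

lemma idx_inj {P a b a' b' : ℕ} (hb : b < P) (hb' : b' < P) :
    a * P + b = a' * P + b' ↔ a = a' ∧ b = b' :=
  ⟨fun h => address_inj hb hb' h, by rintro ⟨rfl, rfl⟩; rfl⟩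

/-! ### Correctness of the table of best survival probabilities. -/

section Specs

variable {N W B : ℕ} {A : Arena (Fin N)} {L : List (Fin N × Fin N)}

/-- The words `f` hold the edge list `L`. -/
def HoldsEdges (L : List (Fin N × Fin N)) (f : ℕ → ℕ) : Prop :=
  ∀ j (h : j < L.length), f (j + j) = L[j].1 ∧ f (j + j + 1) = L[j].2

/-- The real numbers `f` hold the survival probabilities. -/
def HoldsSurvival (A : Arena (Fin N)) (L : List (Fin N × Fin N)) (f : ℕ → ℝ) : Prop :=
  ∀ (c : Fin N) j (h : j < L.length), f (c * L.length + j) = A.survival c s(L[j].1, L[j].2)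

lemma IsEdgeList.mem_edges (hL : IsEdgeList A L) {j : ℕ} (h : j < L.length) :
    s(L[j].1, L[j].2) ∈ A.edges := by
  rw [← hL.2, List.mem_toFinset, List.mem_map]
  exact ⟨L[j], L.getElem_mem h, rfl⟩

lemma IsEdgeList.exists_index (hL : IsEdgeList A L) {x y : Fin N} (h : s(x, y) ∈ A.edges) :
    ∃ (j : ℕ) (h : j < L.length), (L[j].1 = x ∧ L[j].2 = y) ∨ (L[j].1 = y ∧ L[j].2 = x) := by
  rw [← hL.2, List.mem_toFinset, List.mem_map] at h
  obtain ⟨e, he, hxy⟩ := h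
  obtain ⟨j, hj, rfl⟩ := List.getElem_of_mem he
  exact ⟨j, hj, by simpa [Prod.ext_iff] using hxy⟩

/-- Plain assignments are not monotone. The relation used for the loop is instead that each cell is
unchanged or already has its target value. -/
lemma wp_initProg {env : ℕ → ℕ} (hctx : Ctx N L.length W B env) {c : Fin N} (hc : env 5 = c)
    {m : Mem} {Q : Mem → Prop} (hQ : ∀ m', initProg.Frame m m' →
      (∀ x : Fin N, m'.r 1 x = if x = c then 1 else 0) → (∀ x : Fin N, m'.r 2 x = 0) →
      (∀ x : Fin N, m'.w 1 x = x) → Q m') : initProg.wp W B 6 env Q m := by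
  refine Cmd.wp_iter (fun _ => True)
    (fun m m' => ∀ a, (m'.r 1 a = m.r 1 a ∨ m'.r 1 a = 0) ∧ (m'.r 2 a = m.r 2 a ∨ m'.r 2 a = 0) ∧
      (m'.w 1 a = m.w 1 a ∨ m'.w 1 a = a))
    (fun k m => m.r 1 k = 0 ∧ m.r 2 k = 0 ∧ m.w 1 k = k) (by norm_num) trivial
    (fun a => ⟨.inl rfl, .inl rfl, .inl rfl⟩) (fun m₁ m₂ h₁ h₂ a => ?_) (fun k m₁ m₂ h h' => ?_)
    (fun k hk m₁ _ _ => ?_) (fun m₁ hF _ _ hΦ => ?_)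
  · obtain ⟨h₁a, h₁b, h₁c⟩ := h₁ a
    obtain ⟨h₂a, h₂b, h₂c⟩ := h₂ a
    refine ⟨?_, ?_, ?_⟩
    · rcases h₂a with h | h <;> simp [h, h₁a]
    · rcases h₂b with h | h <;> simp [h, h₁b]
    · rcases h₂c with h | h <;> simp [h, h₁c]
  · obtain ⟨ha, hb, hc⟩ := h k
    refine ⟨?_, ?_, ?_⟩
    · rcases ha with h | h <;> simp [h, h'.1]
    · rcases hb with h | h <;> simp [h, h'.2.1]
    · rcases hc with h | h <;> simp [h, h'.2.2]
  · have hk' : k < B := hctx.lt_base (by rw [hctx.h0] at hk; omega)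
    refine ⟨by norm_num, by simp [WExp.Safe], by simpa [WExp.eval] using hk', trivial, by norm_num,
      by simp [WExp.Safe], by simpa [WExp.eval] using hk', trivial, by norm_num,
      by simp [WExp.Safe], by simpa [WExp.eval] using hk', by simp [WExp.Safe], trivial,
      fun a => ?_, ?_⟩
    · by_cases ha : a = k
      · subst ha; simp [WExp.eval, RExp.eval]
      · simp [WExp.eval, RExp.eval, ha]
    · simp [WExp.eval, RExp.eval]
  · refine ⟨by norm_num, by simp [WExp.Safe], by simpa [WExp.eval, hc] using hctx.lt_base c.2.le,
      trivial, hQ _ ?_ ?_ ?_ ?_⟩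
    · refine (hF.mono ?_ ?_).trans ⟨fun k _ => rfl, fun k hk => Mem.setR_frame _ _ _ _ _ fun h => hk ?_⟩
      · decide
      · decide
      · simp only [Finset.mem_singleton] at h; subst h; decide
    · intro x
      have := (hΦ x (by rw [hctx.h0]; exact x.2)).1
      by_cases h : x = c
      · simp [h, WExp.eval, RExp.eval, hc]
      · simp [h, WExp.eval, hc, this, Fin.val_inj]
    · intro x
      simpa using (hΦ x (by rw [hctx.h0]; exact x.2)).2.1
    · intro x
      simpa using (hΦ x (by rw [hctx.h0]; exact x.2)).2.2

/-- What the edge `e` contributes to the chances of a robber who crosses it back and forth. -/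
noncomputable def edgeValue (A : Arena (Fin N)) (c : Fin N) (e : Sym2 (Fin N)) : ℝ :=
  open Classical in if c ∈ e then A.survival c e else 1

lemma wp_edgeProg {env : ℕ → ℕ} (hctx : Ctx N L.length W B env) (hL : IsEdgeList A L) {c : Fin N}
    (hc : env 5 = c) {m : Mem} (hw : HoldsEdges L (m.w 0)) (hr : HoldsSurvival A L (m.r 0))
    (h0 : ∀ x : Fin N, m.r 2 x = 0) {Q : Mem → Prop} (hQ : ∀ m', edgeProg.Frame m m' →
      (∀ x u : Fin N, s(x, u) ∈ A.edges → edgeValue A c s(x, u) ≤ m'.r 2 x) →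
      (∀ x : Fin N, m'.r 2 x = 0 ∨ ∃ u, s(x, u) ∈ A.edges ∧ m'.r 2 x = edgeValue A c s(x, u)) →
      Q m') : edgeProg.wp W B 6 env Q m := by
  -- Cells are indexed by natural numbers; those that name no vertex are left unconstrained.
  set p : ℕ → ℝ → Prop := fun a y => ∀ x : Fin N, a = x → y = 0 ∨
    ∃ u, s(x, u) ∈ A.edges ∧ y = edgeValue A c s(x, u) with hp
  refine Cmd.wp_iter (fun m => ∀ a, p a (m.r 2 a)) (fun m m' => ∀ a, m.r 2 a ≤ m'.r 2 a)
    (fun j m => ∀ h : j < L.length, edgeValue A c s(L[j].1, L[j].2) ≤ m.r 2 L[j].1 ∧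
      edgeValue A c s(L[j].1, L[j].2) ≤ m.r 2 L[j].2) (by norm_num)
    (fun a x hx => .inl (by rw [hx]; exact h0 x)) (fun a => le_rfl)
    (fun m₁ m₂ h₁ h₂ a => (h₁ a).trans (h₂ a))
    (fun j m₁ m₂ h h' hj => ⟨(h' hj).1.trans (h _), (h' hj).2.trans (h _)⟩)
    (fun j hj m₁ hF hJ => ?_) (fun m₁ hF hJ _ hΦ => hQ m₁ hF (fun x u he => ?_) fun x => hJ x x rfl)
  · rw [hctx.h1] at hj
    have hctx' := hctx.update (i := 6) (by norm_num) j
    have hw0 : m₁.w 0 = m.w 0 := hF.1 0 (by decide)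
    have hr0 : m₁.r 0 = m.r 0 := hF.2 0 (by decide)
    obtain ⟨hu, hv⟩ := hw j hj
    have hq := hr c j hj
    have he := hL.mem_edges hj
    have hends := fun m => hctx'.safe_ends (d := 7) (m := m) (j := 6) (by norm_num) (by simpa using hj)
    have hsurv := fun m => hctx'.safe_surv (d := 7) (m := m) (j := 6) (by norm_num) (by norm_num)
      (by simpa using hj) (by simp [hc])
    have hmark : ∀ e : RExp, (e = .one ∨ e = survExp 6) →
        e.eval (Function.update env 6 j) m₁ = edgeValue A c s(L[j].1, L[j].2) →
        (markProg e).wp W B 7 (Function.update env 6 j) (fun m' => (∀ a, p a (m'.r 2 a)) ∧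
          (∀ a, m₁.r 2 a ≤ m'.r 2 a) ∧ ∀ h : j < L.length,
            edgeValue A c s(L[j].1, L[j].2) ≤ m'.r 2 L[j].1 ∧
            edgeValue A c s(L[j].1, L[j].2) ≤ m'.r 2 L[j].2) m₁ := by
      intro e he' hval
      have hes : ∀ m, e.Safe W B 7 (Function.update env 6 j) m := by
        rcases he' with rfl | rfl
        · exact fun _ => trivial
        · exact hsurv
      have heq : ∀ m' : Mem, m'.w = m₁.w → m'.r 0 = m₁.r 0 →
          e.eval (Function.update env 6 j) m' = edgeValue A c s(L[j].1, L[j].2) := by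
        intro m' h h'
        rw [← hval]
        rcases he' with rfl | rfl <;> simp [RExp.eval, survExp, WExp.eval, h']
      refine Cmd.wp_seq (Cmd.wp_rmax hJ L[j].1 _ (by norm_num) (hends _).1 ?_
        (hctx.lt_base L[j].1.2.le) (hes _) hval (fun x hx => ?_) fun m₂ hw₂ hr₂ hJ₂ hle₂ hv₂ =>
        Cmd.wp_rmax hJ₂ L[j].2 _ (by norm_num) (hends _).2 ?_
        (hctx.lt_base L[j].2.2.le) (hes _) (heq _ hw₂ (hr₂ 0 (by norm_num))) (fun x hx => ?_)
        fun m₃ hw₃ hr₃ hJ₃ hle₃ hv₃ => ⟨hJ₃, fun a => (hle₂ a).trans (hle₃ a), fun _ =>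
          ⟨hv₂.trans (hle₃ _), hv₃⟩⟩)
      · simp [fstEnd, WExp.eval, hw0, hu]
      · exact .inr ⟨L[j].2, by rw [← Fin.ext hx]; exact ⟨he, rfl⟩⟩
      · simp [sndEnd, WExp.eval, hw₂, hw0, hv]
      · exact .inr ⟨L[j].1, by rw [← Fin.ext hx, Sym2.eq_swap]; exact ⟨he, rfl⟩⟩
    have hval : (c = L[j].1 ∨ c = L[j].2) →
        (survExp 6).eval (Function.update env 6 j) m₁ = edgeValue A c s(L[j].1, L[j].2) := by
      intro h
      simp [survExp, RExp.eval, WExp.eval, hctx.h1, hc, hr0, hq, edgeValue, Sym2.mem_iff, h]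
    have h5 : (WExp.var 5).eval (Function.update env 6 j) m₁ = c := by simp [WExp.eval, hc]
    have h6 : (fstEnd 6).eval (Function.update env 6 j) m₁ = L[j].1 := by
      simp [fstEnd, WExp.eval, hw0, hu]
    have h7 : (sndEnd 6).eval (Function.update env 6 j) m₁ = L[j].2 := by
      simp [sndEnd, WExp.eval, hw0, hv]
    refine Cmd.wp_ifNe (hends _).1 (by simp [WExp.Safe]) (fun hne => ?_) fun heq => ?_
    · refine Cmd.wp_ifNe (hends _).2 (by simp [WExp.Safe]) (fun hne' => ?_) fun heq => ?_
      · rw [h5, h6, Ne, Fin.val_inj] at hne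
        rw [h5, h7, Ne, Fin.val_inj] at hne'
        refine hmark _ (.inl rfl) ?_
        simp [RExp.eval, edgeValue, Ne.symm hne, Ne.symm hne']
      · rw [h5, h7, Fin.val_inj] at heq
        exact hmark _ (.inr rfl) (hval (.inr heq.symm))
    · rw [h5, h6, Fin.val_inj] at heq
      exact hmark _ (.inr rfl) (hval (.inl heq.symm))
  · obtain ⟨j, hj, ⟨rfl, rfl⟩ | ⟨rfl, rfl⟩⟩ := hL.exists_index he
    · exact (hΦ j (by rwa [hctx.h1]) hj).1
    · rw [Sym2.eq_swap]; exact (hΦ j (by rwa [hctx.h1]) hj).2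

/-- Bellman–Ford relaxation for maximal products: after k rounds the cell of x dominates all walks
from x to c of length at most k. Updating in place may run ahead of the round, so only this lower
bound and attainability are maintained. -/
lemma wp_walkProg {env : ℕ → ℕ} (hctx : Ctx N L.length W B env) (hL : IsEdgeList A L) {c : Fin N}
    (hc : env 5 = c) {m : Mem} (hw : HoldsEdges L (m.w 0)) (hr : HoldsSurvival A L (m.r 0))
    (h0 : ∀ x : Fin N, m.r 1 x = if x = c then 1 else 0) {Q : Mem → Prop}
    (hQ : ∀ m', walkProg.Frame m m' →
      (∀ (x : Fin N) (q : A.graph.Walk x c), q.length ≤ N →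
        (q.edges.map (A.survival c)).prod ≤ m'.r 1 x) →
      (∀ x : Fin N, A.Attained c x (m'.r 1 x)) → Q m') : walkProg.wp W B 6 env Q m := by
  set p : ℕ → ℝ → Prop := fun a y => ∀ x : Fin N, a = x → A.Attained c x y with hp
  refine ⟨by norm_num, fun k m => (∀ b, p b (m.r 1 b)) ∧ ∀ (x : Fin N) (q : A.graph.Walk x c),
    q.length ≤ k → (q.edges.map (A.survival c)).prod ≤ m.r 1 x, ⟨fun b x hx => ?_, fun x q hq => ?_⟩,
    fun k hk m₁ hF₁ ⟨hJ₁, hlow⟩ => ?_, fun m₁ hF₁ ⟨hJ₁, hlow⟩ => hQ m₁ hF₁ ?_ fun x => hJ₁ x x rfl⟩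
  · rw [hx, h0]
    split_ifs with h
    · rw [h]; exact A.attained_one c
    · exact ⟨le_rfl, .inl rfl⟩
  · cases q with
    | nil => simp [h0]
    | cons => simp at hq
  · have hctx₁ := hctx.update (i := 6) (by norm_num) k
    -- Comparison with the values `m₁` at the start of the round is what extends a walk by one edge,
    -- regardless of the order of the edge list.
    refine Cmd.wp_iter (fun m => (∀ b, p b (m.r 1 b)) ∧ ∀ b, m₁.r 1 b ≤ m.r 1 b)
      (fun m m' => ∀ a, m.r 1 a ≤ m'.r 1 a)
      (fun j m => ∀ h : j < L.length,
        m₁.r 1 L[j].1 * A.survival c s(L[j].1, L[j].2) ≤ m.r 1 L[j].2 ∧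
        m₁.r 1 L[j].2 * A.survival c s(L[j].1, L[j].2) ≤ m.r 1 L[j].1) (by norm_num)
      ⟨hJ₁, fun _ => le_rfl⟩ (fun _ => le_rfl) (fun m₁ m₂ h₁ h₂ a => (h₁ a).trans (h₂ a))
      (fun j m₁ m₂ h h' hj => ⟨(h' hj).1.trans (h _), (h' hj).2.trans (h _)⟩)
      (fun j hj m₂ hF₂ ⟨hJ₂, hle₂⟩ => ?_) (fun m₂ hF₂ ⟨hJ₂, _⟩ hle hΦ => ⟨hJ₂, fun x q hq => ?_⟩)
    · rw [hctx₁.h1] at hj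
      have hctx₂ := hctx₁.update (i := 7) (by norm_num) j
      have hw₂ : m₂.w 0 = m.w 0 := (hF₂.1 0 (by decide)).trans (hF₁.1 0 (by decide))
      have hr₂ : m₂.r 0 = m.r 0 := (hF₂.2 0 (by decide)).trans (hF₁.2 0 (by decide))
      obtain ⟨hu, hv⟩ := hw j hj
      have hq := hr c j hj
      have he := hL.mem_edges hj
      have hq0 := A.survival_nonneg c _ he
      have hends := fun m => hctx₂.safe_ends (d := 8) (m := m) (j := 7) (by norm_num)
        (by simpa using hj)
      have hsurv := fun m => hctx₂.safe_surv (d := 8) (m := m) (j := 7) (by norm_num) (by norm_num)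
        (by simpa using hj) (by simp [hc])
      refine Cmd.wp_seq (Cmd.wp_rmax hJ₂ L[j].2 (m₂.r 1 L[j].1 * A.survival c s(L[j].1, L[j].2))
        (by norm_num) (hends _).2 ?_ (hctx.lt_base L[j].2.2.le)
        ⟨⟨by norm_num, (hends _).1, ?_⟩, hsurv _⟩ ?_ (fun x hx => ?_)
        fun m₃ hw₃ hr₃ hJ₃ hle₃ hv₃ =>
        Cmd.wp_rmax hJ₃ L[j].1 (m₃.r 1 L[j].2 * A.survival c s(L[j].1, L[j].2))
        (by norm_num) (hends _).1 ?_ (hctx.lt_base L[j].1.2.le)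
        ⟨⟨by norm_num, (hends _).2, ?_⟩, hsurv _⟩ ?_ (fun x hx => ?_)
        fun m₄ hw₄ hr₄ hJ₄ hle₄ hv₄ => ⟨⟨hJ₄, fun a => (hle₂ a).trans ((hle₃ a).trans (hle₄ a))⟩,
          fun a => (hle₃ a).trans (hle₄ a), fun _ => ⟨?_, ?_⟩⟩)
      · simp [sndEnd, WExp.eval, hw₂, hv]
      · simpa [fstEnd, WExp.eval, hw₂, hu] using hctx.lt_base L[j].1.2.le
      · simp [RExp.eval, fstEnd, survExp, WExp.eval, hw₂, hu, hr₂, hctx.h1, hc, hq]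
      · rw [← Fin.ext hx]
        exact (hJ₂ _ _ rfl).step he
      · simp [fstEnd, WExp.eval, hw₃, hw₂, hu]
      · simpa [sndEnd, WExp.eval, hw₃, hw₂, hv] using hctx.lt_base L[j].2.2.le
      · simp [RExp.eval, sndEnd, survExp, WExp.eval, hw₃, hw₂, hv, hr₃, hr₂, hctx.h1, hc, hq]
      · rw [← Fin.ext hx, Sym2.eq_swap]
        exact (hJ₃ _ _ rfl).step (Sym2.eq_swap ▸ he)
      · exact (mul_le_mul_of_nonneg_right (hle₂ _) hq0).trans (hv₃.trans (hle₄ _))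
      · exact (mul_le_mul_of_nonneg_right ((hle₂ _).trans (hle₃ _)) hq0).trans hv₄
    · cases q with
      | nil => exact (hlow c .nil (by simp)).trans (hle _)
      | @cons _ y _ hxy q =>
        have hxy := (Arena.graph_adj.1 hxy).1
        have hq' := hlow y q (by simpa using hq)
        simp only [SimpleGraph.Walk.edges_cons, List.map_cons, List.prod_cons]
        refine (mul_le_mul_of_nonneg_left hq' (A.survival_nonneg c _ hxy)).trans ?_
        rw [mul_comm]
        obtain ⟨j, hj, ⟨rfl, rfl⟩ | ⟨rfl, rfl⟩⟩ := hL.exists_index hxy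
        · exact (hΦ j (by rwa [hctx₁.h1]) hj).2
        · rw [Sym2.eq_swap]; exact (hΦ j (by rwa [hctx₁.h1]) hj).1
  · rwa [hctx.h0] at hlow

/-- A label is always the number of a vertex in the same component, and after k rounds it is at most
every vertex within k steps. After N rounds it is the least vertex of the component, hence a
complete invariant. -/
lemma wp_labelProg {env : ℕ → ℕ} (hctx : Ctx N L.length W B env) (hL : IsEdgeList A L) {c : Fin N}
    (hc : env 5 = c) {m : Mem} (hw : HoldsEdges L (m.w 0))
    (h0 : ∀ x : Fin N, m.w 1 x = x) {Q : Mem → Prop}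
    (hQ : ∀ m', labelProg.Frame m m' →
      (∀ x y : Fin N, m'.w 1 x = m'.w 1 y ↔ (A.avoid c).Reachable x y) → Q m') :
    labelProg.wp W B 6 env Q m := by
  set p : ℕ → ℕ → Prop := fun a y => ∀ x : Fin N, a = x →
    ∃ z : Fin N, y = z ∧ (A.avoid c).Reachable x z with hp
  refine ⟨by norm_num, fun k m => (∀ b, p b (m.w 1 b)) ∧ ∀ (x y : Fin N) (q : (A.avoid c).Walk x y),
    q.length ≤ k → m.w 1 x ≤ y, ⟨fun b x hx => ⟨x, by rw [hx, h0], .refl _⟩, fun x y q hq => ?_⟩,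
    fun k hk m₁ hF₁ ⟨hJ₁, hlow⟩ => ?_, fun m₁ hF₁ ⟨hJ₁, hlow⟩ => hQ m₁ hF₁ fun x y => ?_⟩
  · cases q with
    | nil => simp [h0]
    | cons => simp at hq
  · have hctx₁ := hctx.update (i := 6) (by norm_num) k
    refine Cmd.wp_iter (fun m => (∀ b, p b (m.w 1 b)) ∧ ∀ b, m.w 1 b ≤ m₁.w 1 b)
      (fun m m' => ∀ a, m'.w 1 a ≤ m.w 1 a)
      (fun j m => ∀ h : j < L.length, c ≠ L[j].1 → c ≠ L[j].2 →
        m.w 1 L[j].2 ≤ m₁.w 1 L[j].1 ∧ m.w 1 L[j].1 ≤ m₁.w 1 L[j].2) (by norm_num)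
      ⟨hJ₁, fun _ => le_rfl⟩ (fun _ => le_rfl) (fun m₁ m₂ h₁ h₂ a => (h₂ a).trans (h₁ a))
      (fun j m₁ m₂ h h' hj hu hv => ⟨(h _).trans (h' hj hu hv).1, (h _).trans (h' hj hu hv).2⟩)
      (fun j hj m₂ hF₂ ⟨hJ₂, hle₂⟩ => ?_) (fun m₂ hF₂ ⟨hJ₂, _⟩ hle hΦ => ⟨hJ₂, fun x y q hq => ?_⟩)
    · rw [hctx₁.h1] at hj
      have hctx₂ := hctx₁.update (i := 7) (by norm_num) j
      have hw₂ : m₂.w 0 = m.w 0 := (hF₂.1 0 (by decide)).trans (hF₁.1 0 (by decide))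
      obtain ⟨hu, hv⟩ := hw j hj
      have he := hL.mem_edges hj
      have hends := fun m => hctx₂.safe_ends (d := 8) (m := m) (j := 7) (by norm_num)
        (by simpa using hj)
      set env' := Function.update (Function.update env 6 k) 7 j with henv
      have h5 : (WExp.var 5).eval env' m₂ = c := by simp [WExp.eval, hc, henv]
      have h6 : (fstEnd 7).eval env' m₂ = L[j].1 := by simp [fstEnd, WExp.eval, hw₂, hu, henv]
      have h7 : (sndEnd 7).eval env' m₂ = L[j].2 := by simp [sndEnd, WExp.eval, hw₂, hv, henv]
      have hs5 : (WExp.var 5).Safe W B 8 env' m₂ := by simp [WExp.Safe]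
      refine Cmd.wp_ifNe (hends _).1 hs5 (fun hne => Cmd.wp_ifNe (hends _).2 hs5 (fun hne' => ?_)
        fun heq => ?_) fun heq => ?_
      · rw [h5, h6, Ne, Fin.val_inj] at hne
        rw [h5, h7, Ne, Fin.val_inj] at hne'
        have hreach : (A.avoid c).Reachable L[j].1 L[j].2 := by
          by_cases h : L[j].1 = L[j].2
          · rw [h]
          · exact (Arena.avoid_adj.2 ⟨⟨he, Ne.symm hne, Ne.symm hne'⟩, h⟩).reachable
        refine Cmd.wp_seq (Cmd.wp_wmin hJ₂ L[j].2 (m₂.w 1 L[j].1) (by norm_num) (hends _).2 h7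
          (hctx.lt_base L[j].2.2.le) ⟨by norm_num, (hends _).1, ?_⟩ ?_ (fun x hx => ?_)
          fun m₃ hr₃ hw₃ hJ₃ hle₃ hv₃ => Cmd.wp_wmin hJ₃ L[j].1 (m₃.w 1 L[j].2)
          (by norm_num) (hends _).1 ?_
          (hctx.lt_base L[j].1.2.le) ⟨by norm_num, (hends _).2, ?_⟩ ?_ (fun x hx => ?_)
          fun m₄ hr₄ hw₄ hJ₄ hle₄ hv₄ => ⟨⟨hJ₄, fun a => (hle₄ a).trans ((hle₃ a).trans (hle₂ a))⟩,
            fun a => (hle₄ a).trans (hle₃ a), fun _ _ _ => ⟨?_, ?_⟩⟩)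
        · rw [h6]; exact hctx.lt_base L[j].1.2.le
        · rw [WExp.eval, h6]
        · obtain ⟨z, hz, hzr⟩ := hJ₂ _ L[j].1 rfl
          exact ⟨z, hz, by rw [← Fin.ext hx]; exact hreach.symm.trans hzr⟩
        · simp [fstEnd, WExp.eval, hw₃, hw₂, hu, henv]
        · simpa [sndEnd, WExp.eval, hw₃, hw₂, hv, henv] using hctx.lt_base L[j].2.2.le
        · simp [sndEnd, WExp.eval, hw₃, hw₂, hv, henv]
        · obtain ⟨z, hz, hzr⟩ := hJ₃ _ L[j].2 rfl
          exact ⟨z, hz, by rw [← Fin.ext hx]; exact hreach.trans hzr⟩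
        · exact (hle₄ _).trans (hv₃.trans (hle₂ _))
        · exact hv₄.trans ((hle₃ _).trans (hle₂ _))
      · rw [h5, h7, Fin.val_inj] at heq
        exact ⟨⟨hJ₂, hle₂⟩, fun _ => le_rfl, fun _ _ h => absurd heq.symm h⟩
      · rw [h5, h6, Fin.val_inj] at heq
        exact ⟨⟨hJ₂, hle₂⟩, fun _ => le_rfl, fun _ h => absurd heq.symm h⟩
    · cases q with
      | nil => exact (hle _).trans (hlow x x .nil (by simp))
      | @cons _ z _ hxz q =>
        obtain ⟨⟨hxz, hcx, hcz⟩, -⟩ := Arena.avoid_adj.1 hxz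
        have hq' := hlow z y q (by simpa using hq)
        obtain ⟨j, hj, ⟨rfl, rfl⟩ | ⟨rfl, rfl⟩⟩ := hL.exists_index hxz
        · exact (hΦ j (by rwa [hctx₁.h1]) hj hcx hcz).2.trans hq'
        · exact (hΦ j (by rwa [hctx₁.h1]) hj hcz hcx).1.trans hq'
  · rw [hctx.h0] at hlow
    obtain ⟨x', hx, hxr⟩ := hJ₁ x x rfl
    obtain ⟨y', hy, hyr⟩ := hJ₁ y y rfl
    have hle : ∀ {x y : Fin N}, (A.avoid c).Reachable x y → m₁.w 1 x ≤ y := by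
      intro x y h
      obtain ⟨q, hq⟩ := h.exists_isPath
      refine hlow x y q ?_
      simpa using hq.length_lt.le
    refine ⟨fun h => ?_, fun h => le_antisymm ?_ ?_⟩
    · rw [hx, hy] at h
      rw [Fin.ext h] at hxr
      exact hxr.trans hyr.symm
    · rw [hy]; exact hle (h.trans hyr)
    · rw [hx]; exact hle (h.symm.trans hxr)

/-- At every position of the table of best survival probabilities, `y` is the right value. -/
def TableEntry (A : Arena (Fin N)) (a : ℕ) (y : ℝ) : Prop :=
  ∀ c r r' : Fin N, a = (c * (N + 1) + r) * (N + 1) + r' → A.IsBest c r r' y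

/-- The position determines the triple, so one correct value settles the entry. Writes for other
triples therefore cannot spoil finished ones. -/
lemma TableEntry.of_isBest {c r r' : Fin N} {y : ℝ} (h : A.IsBest c r r' y) :
    TableEntry A ((c * (N + 1) + r) * (N + 1) + r') y := by
  intro c₁ r₁ r₁' h'
  rw [idx_inj (by omega) (by omega), idx_inj (by omega) (by omega), Fin.val_inj, Fin.val_inj,
    Fin.val_inj] at h'
  obtain ⟨⟨rfl, rfl⟩, rfl⟩ := h'
  exact h

lemma wp_tableProg {env : ℕ → ℕ} (hctx : Ctx N L.length W B env) {c : Fin N}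
    (hc : env 5 = c) {m : Mem} (hself : ∀ r : Fin N, A.IsBest c r r (m.r 2 r))
    (hconn : ∀ r r' : Fin N, r ≠ r' → m.w 1 r = m.w 1 r' → A.IsBest c r r' 1)
    (hdisc : ∀ r r' : Fin N, r ≠ r' → m.w 1 r ≠ m.w 1 r' → A.IsBest c r r' (m.r 1 r * m.r 1 r'))
    {Q : Mem → Prop}
    (hQ : ∀ m', tableProg.Frame m m' →
      (∀ a, m'.r 3 a = m.r 3 a ∨ TableEntry A a (m'.r 3 a)) →
      (∀ r r' : Fin N, TableEntry A ((c * (N + 1) + r) * (N + 1) + r')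
        (m'.r 3 ((c * (N + 1) + r) * (N + 1) + r'))) → Q m') :
    tableProg.wp W B 6 env Q m := by
  have htrans : ∀ m₀ m₁ m₂ : Mem, (∀ a, m₁.r 3 a = m₀.r 3 a ∨ TableEntry A a (m₁.r 3 a)) →
      (∀ a, m₂.r 3 a = m₁.r 3 a ∨ TableEntry A a (m₂.r 3 a)) →
      ∀ a, m₂.r 3 a = m₀.r 3 a ∨ TableEntry A a (m₂.r 3 a) := by
    intro m₀ m₁ m₂ h h' a
    rcases h' a with h' | h'
    · rw [h']; exact h a
    · exact .inr h'
  have hpers : ∀ (m₁ m₂ : Mem) a, (∀ a, m₂.r 3 a = m₁.r 3 a ∨ TableEntry A a (m₂.r 3 a)) →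
      TableEntry A a (m₁.r 3 a) → TableEntry A a (m₂.r 3 a) := by
    intro m₁ m₂ a h h'
    rcases h a with h | h
    · rwa [h]
    · exact h
  refine Cmd.wp_iter (fun _ => True)
    (fun m m' => ∀ a, m'.r 3 a = m.r 3 a ∨ TableEntry A a (m'.r 3 a))
    (fun r m => ∀ r' < N, TableEntry A ((c * (N + 1) + r) * (N + 1) + r')
        (m.r 3 ((c * (N + 1) + r) * (N + 1) + r'))) (by norm_num) trivial (fun _ => .inl rfl)
    (fun _ _ => htrans _ _ _) (fun r m₁ m₂ h h' r' hr' => hpers _ _ _ h (h' r' hr'))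
    (fun r hr m₁ hF₁ _ => ?_) (fun m₁ hF₁ _ hR hΦ => hQ m₁ hF₁ hR fun r r' =>
      hΦ r (by rw [hctx.h0]; exact r.2) r' r'.2)
  have hctx₁ := hctx.update (i := 6) (by norm_num) r
  refine Cmd.wp_iter (fun _ => True)
    (fun m m' => ∀ a, m'.r 3 a = m.r 3 a ∨ TableEntry A a (m'.r 3 a))
    (fun r' m => TableEntry A ((c * (N + 1) + r) * (N + 1) + r')
        (m.r 3 ((c * (N + 1) + r) * (N + 1) + r'))) (by norm_num) trivial (fun _ => .inl rfl)
    (fun _ _ => htrans _ _ _) (fun r' m₁ m₂ h h' => hpers _ _ _ h h')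
    (fun r' hr' m₂ hF₂ _ => ?_) (fun m₂ hF₂ _ hR hΦ => ⟨trivial, hR, fun r' hr' =>
      hΦ r' (by rwa [hctx₁.h0])⟩)
  have hctx₂ := hctx₁.update (i := 7) (by norm_num) r'
  rw [hctx.h0] at hr
  rw [hctx₁.h0] at hr'
  have h1 : m₂.r 1 = m.r 1 := (hF₂.2 1 (by decide)).trans (hF₁.2 1 (by decide))
  have h2 : m₂.r 2 = m.r 2 := (hF₂.2 2 (by decide)).trans (hF₁.2 2 (by decide))
  have h3 : m₂.w 1 = m.w 1 := (hF₂.1 1 (by decide)).trans (hF₁.1 1 (by decide))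
  set env' := Function.update (Function.update env 6 r) 7 r' with henv
  have e5 : (WExp.var 5).eval env' m₂ = c := by simp [WExp.eval, henv, hc]
  have e6 : (WExp.var 6).eval env' m₂ = r := by simp [WExp.eval, henv]
  have e7 : (WExp.var 7).eval env' m₂ = r' := by simp [WExp.eval, henv]
  have hs5 : (WExp.var 5).Safe W B 8 env' m₂ := by simp [WExp.Safe]
  have hs6 : (WExp.var 6).Safe W B 8 env' m₂ := by simp [WExp.Safe]
  have hs7 : (WExp.var 7).Safe W B 8 env' m₂ := by simp [WExp.Safe]
  obtain ⟨hs, hlt⟩ := hctx₂.safe_idx₃ (m := m₂) (by norm_num) hs5 hs6 hs7 (e5.trans_le c.2.le)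
    (e6.trans_le hr.le) (e7.trans_le hr'.le)
  have hidx : (idx₃ (.var 5) (.var 6) (.var 7)).eval env' m₂ =
      (c * (N + 1) + r) * (N + 1) + r' := by
    simp only [idx₃, idx₂, WExp.eval] at e5 e6 e7 ⊢
    rw [e5, e6, e7, hctx₂.h3]
  rw [hidx] at hlt
  have hset : ∀ (e : RExp) (v : ℝ), e.Safe W B 8 env' m₂ → e.eval env' m₂ = v →
      A.IsBest c ⟨r, hr⟩ ⟨r', hr'⟩ v →
      (Cmd.rset 3 (idx₃ (.var 5) (.var 6) (.var 7)) e).wp W B 8 env'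
        (fun m' => True ∧ (∀ a, m'.r 3 a = m₂.r 3 a ∨ TableEntry A a (m'.r 3 a)) ∧
          TableEntry A ((c * (N + 1) + r) * (N + 1) + r')
            (m'.r 3 ((c * (N + 1) + r) * (N + 1) + r'))) m₂ := by
    intro e v hse hv hbest
    have hT := TableEntry.of_isBest hbest
    refine Cmd.wp_rset _ v (by norm_num) hs hidx hlt hse hv ⟨trivial, fun a => ?_, ?_⟩
    · by_cases ha : a = (c * (N + 1) + r) * (N + 1) + r'
      · right; subst ha; simpa using hT
      · left; simp [ha]
    · simpa using hT
  have hB6 : (WExp.var 6).eval env' m₂ < B := by rw [e6]; exact hctx.lt_base hr.le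
  have hB7 : (WExp.var 7).eval env' m₂ < B := by rw [e7]; exact hctx.lt_base hr'.le
  have e6' : (WExp.load 1 (.var 6)).eval env' m₂ = m.w 1 r := by rw [WExp.eval, e6, h3]
  have e7' : (WExp.load 1 (.var 7)).eval env' m₂ = m.w 1 r' := by rw [WExp.eval, e7, h3]
  refine Cmd.wp_ifNe hs6 hs7 (fun hne => Cmd.wp_ifNe ⟨by norm_num, hs6, hB6⟩ ⟨by norm_num, hs7, hB7⟩
    (fun hne' => ?_) fun heq' => ?_) fun heq => ?_
  · rw [e6, e7] at hne
    rw [e6', e7'] at hne'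
    refine hset _ _ ⟨⟨by norm_num, hs6, hB6⟩, ⟨by norm_num, hs7, hB7⟩⟩ ?_
      (hdisc ⟨r, hr⟩ ⟨r', hr'⟩ (by simpa using hne) hne')
    rw [RExp.eval, RExp.eval, RExp.eval, e6, e7, h1]
  · rw [e6, e7] at hne
    rw [e6', e7'] at heq'
    exact hset _ _ trivial rfl (hconn ⟨r, hr⟩ ⟨r', hr'⟩ (by simpa using hne) heq')
  · rw [e6, e7] at heq
    subst heq
    refine hset _ _ ⟨by norm_num, hs6, hB6⟩ ?_ (hself ⟨r, hr⟩)
    rw [RExp.eval, e6, h2]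

/-- The auxiliary arrays are rebuilt for each position of the cop; only array 3 accumulates, and its
finished entries stay correct. -/
lemma wp_prepProg {env : ℕ → ℕ} (hctx : Ctx N L.length W B env) (hL : IsEdgeList A L)
    {m : Mem} (hw : HoldsEdges L (m.w 0)) (hr : HoldsSurvival A L (m.r 0)) {Q : Mem → Prop}
    (hQ : ∀ m', prepProg.Frame m m' → (∀ c r r' : Fin N,
      A.IsBest c r r' (m'.r 3 ((c * (N + 1) + r) * (N + 1) + r'))) → Q m') :
    prepProg.wp W B 5 env Q m := by
  refine Cmd.wp_iter (fun _ => True)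
    (fun m m' => ∀ a, m'.r 3 a = m.r 3 a ∨ TableEntry A a (m'.r 3 a))
    (fun c m => ∀ r r' : Fin N, TableEntry A ((c * (N + 1) + r) * (N + 1) + r')
        (m.r 3 ((c * (N + 1) + r) * (N + 1) + r'))) (by norm_num) trivial (fun _ => .inl rfl)
    (fun m₁ m₂ h h' a => ?_) (fun r m₁ m₂ h h' r₁ r₂ => ?_)
    (fun c hc m₁ hF₁ _ => ?_) (fun m₁ hF₁ _ _ hΦ => hQ m₁ hF₁ fun c r r' =>
      hΦ c (by rw [hctx.h0]; exact c.2) r r' c r r' rfl)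
  · rcases h' a with h' | h'
    · rw [h']; exact h a
    · exact .inr h'
  · rcases h ((r * (N + 1) + r₁) * (N + 1) + r₂) with h | h
    · rw [h]; exact h' r₁ r₂
    · exact h
  · rw [hctx.h0] at hc
    have hctx₁ := hctx.update (i := 5) (by norm_num) c
    have h5 : Function.update env 5 c 5 = (⟨c, hc⟩ : Fin N) := by simp
    have hw₁ : m₁.w 0 = m.w 0 := hF₁.1 0 (by decide)
    have hr₁ : m₁.r 0 = m.r 0 := hF₁.2 0 (by decide)
    rw [← hw₁] at hw
    rw [← hr₁] at hr
    refine Cmd.wp_seq (wp_initProg hctx₁ h5 fun m₂ hF₂ hD₂ hS₂ hC₂ => ?_)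
    rw [← hF₂.1 0 (by decide)] at hw
    rw [← hF₂.2 0 (by decide)] at hr
    refine Cmd.wp_seq (wp_edgeProg hctx₁ hL h5 hw hr hS₂ fun m₃ hF₃ hge₃ hat₃ => ?_)
    rw [← hF₃.2 1 (by decide)] at hD₂
    rw [← hF₃.1 1 (by decide)] at hC₂
    rw [← hF₃.1 0 (by decide)] at hw
    rw [← hF₃.2 0 (by decide)] at hr
    refine Cmd.wp_seq (wp_walkProg hctx₁ hL h5 hw hr hD₂ fun m₄ hF₄ hlow₄ hat₄ => ?_)
    rw [← hF₄.2 2 (by decide)] at hge₃ hat₃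
    rw [← hF₄.1 1 (by decide)] at hC₂
    rw [← hF₄.1 0 (by decide)] at hw
    refine Cmd.wp_seq (wp_labelProg hctx₁ hL h5 hw hC₂ fun m₅ hF₅ hlab₅ => ?_)
    rw [← hF₅.2 2 (by decide)] at hge₃ hat₃
    rw [← hF₅.2 1 (by decide)] at hlow₄ hat₄
    refine wp_tableProg hctx₁ h5 (fun r => .of_edges ?_ ?_)
      (fun r r' hne h => .of_reachable hne ((hlab₅ r r').1 h))
      (fun r r' hne h => .of_not_reachable hne (fun h' => h ((hlab₅ r r').2 h'))
        (D := fun x => m₅.r 1 x) (fun x q hq => hlow₄ x q (by simpa using hq.le)) hat₄)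
      fun m₆ hF₆ hR₆ hT₆ => ⟨trivial, ?_, hT₆⟩
    · intro u hu
      convert hge₃ r u hu using 1
      simp [edgeValue]
    · convert hat₃ r using 6
      simp [edgeValue]
    · have h3 : m₅.r 3 = m₁.r 3 := (hF₅.2 3 (by decide)).trans ((hF₄.2 3 (by decide)).trans
        ((hF₃.2 3 (by decide)).trans (hF₂.2 3 (by decide))))
      rwa [h3] at hR₆

end Specs

end FastRobber

namespace FastRobber

/-! ### Correctness of one turn and of the whole computation. -/

section Turns

variable {N W B : ℕ} {A : Arena (Fin N)} {L : List (Fin N × Fin N)}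

lemma posIndex_le (r : Option (Fin N)) : posIndex r ≤ N := by
  rcases r with _ | r
  · exact le_rfl
  · exact r.2.le

lemma posIndex_inj {r r' : Option (Fin N)} (h : posIndex r = posIndex r') : r = r' := by
  rcases r with _ | r <;> rcases r' with _ | r' <;> simp only [posIndex] at h
  · rfl
  · omega
  · omega
  · rw [Fin.ext h]

lemma wp_resetProg {E k d : ℕ} {env : ℕ → ℕ} (hctx : Ctx N E W B env) (hk : k < 8) (hd : 4 < d)
    {m : Mem} {Q : Mem → Prop} (hQ : ∀ m', (resetProg k d).Frame m m' →
      (∀ a ≤ N, ∀ b ≤ N, m'.r k (a * (N + 1) + b) = 0) →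
      (∀ a, (N + 1) * (N + 1) ≤ a → m'.r k a = m.r k a) → Q m') :
    (resetProg k d).wp W B d env Q m := by
  have htrans : ∀ m₀ m₁ m₂ : Mem, (∀ a, (m₁.r k a = m₀.r k a ∨ m₁.r k a = 0) ∧
      ((N + 1) * (N + 1) ≤ a → m₁.r k a = m₀.r k a)) → (∀ a, (m₂.r k a = m₁.r k a ∨ m₂.r k a = 0) ∧
      ((N + 1) * (N + 1) ≤ a → m₂.r k a = m₁.r k a)) → ∀ a, (m₂.r k a = m₀.r k a ∨ m₂.r k a = 0) ∧
      ((N + 1) * (N + 1) ≤ a → m₂.r k a = m₀.r k a) := by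
    intro m₀ m₁ m₂ h h' a
    refine ⟨?_, fun ha => ((h' a).2 ha).trans ((h a).2 ha)⟩
    rcases (h' a).1 with h' | h'
    · rw [h']; exact (h a).1
    · exact .inr h'
  have hpers : ∀ (m₁ m₂ : Mem) a, (∀ a, (m₂.r k a = m₁.r k a ∨ m₂.r k a = 0) ∧
      ((N + 1) * (N + 1) ≤ a → m₂.r k a = m₁.r k a)) → m₁.r k a = 0 → m₂.r k a = 0 := by
    intro m₁ m₂ a h h'
    rcases (h a).1 with h | h
    · rwa [h]
    · exact h
  refine Cmd.wp_iter (fun _ => True) (fun m m' => ∀ a, (m'.r k a = m.r k a ∨ m'.r k a = 0) ∧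
      ((N + 1) * (N + 1) ≤ a → m'.r k a = m.r k a))
    (fun a m => ∀ b ≤ N, m.r k (a * (N + 1) + b) = 0) (by norm_num) trivial
    (fun _ => ⟨.inl rfl, fun _ => rfl⟩) (fun _ _ => htrans _ _ _)
    (fun a m₁ m₂ h h' b hb => hpers _ _ _ h (h' b hb)) (fun a ha m₁ _ _ => ?_)
    (fun m₁ hF _ hR hΦ => hQ m₁ hF (fun a ha b hb => hΦ a (by rw [hctx.h3]; omega) b hb)
      fun a ha => (hR a).2 ha)
  have hctx₁ := hctx.update (i := d) hd a
  refine Cmd.wp_iter (fun _ => True) (fun m m' => ∀ a, (m'.r k a = m.r k a ∨ m'.r k a = 0) ∧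
      ((N + 1) * (N + 1) ≤ a → m'.r k a = m.r k a))
    (fun b m => m.r k (a * (N + 1) + b) = 0) (by norm_num) trivial
    (fun _ => ⟨.inl rfl, fun _ => rfl⟩) (fun _ _ => htrans _ _ _)
    (fun b m₁ m₂ h h' => hpers _ _ _ h h') (fun b hb m₂ _ _ => ?_)
    (fun m₁ hF _ hR hΦ => ⟨trivial, hR, fun b hb => hΦ b (by rw [hctx₁.h3]; omega)⟩)
  have hctx₂ := hctx₁.update (i := d + 1) (by omega) b
  rw [hctx.h3] at ha
  rw [hctx₁.h3] at hb
  set env' := Function.update (Function.update env d a) (d + 1) b with henv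
  have e1 : (WExp.var d).eval env' m₂ = a := by simp [WExp.eval, henv]
  have e2 : (WExp.var (d + 1)).eval env' m₂ = b := by simp [WExp.eval, henv]
  obtain ⟨hs, hlt⟩ := hctx₂.safe_idx₂' (m := m₂) (d := d + 1 + 1) (a := .var d) (b := .var (d + 1))
    (by omega) (by simp only [WExp.Safe]; omega) (by simp only [WExp.Safe]; omega) (by omega) (by omega)
  have hidx : (idx₂ (.var d) (.var (d + 1))).eval env' m₂ = a * (N + 1) + b := by
    simp only [idx₂, WExp.eval] at e1 e2 ⊢
    rw [e1, e2, hctx₂.h3]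
  refine Cmd.wp_rset _ 0 hk hs hidx (hidx ▸ hlt) trivial rfl ⟨trivial, fun x => ⟨?_, fun hx => ?_⟩, ?_⟩
  · by_cases hx : x = a * (N + 1) + b
    · right; subst hx; simp
    · left; simp [hx]
  · have := Ctx.sq_lt (N := N) (a := a) (b := b) (by omega) (by omega)
    simp [show x ≠ a * (N + 1) + b by omega]
  · simp

lemma wp_runProg {E : ℕ} {env : ℕ → ℕ} (hctx : Ctx N E W B env) {m : Mem}
    (h0 : ∀ a ≤ N, ∀ b ≤ N, m.r 4 (a * (N + 1) + b) = 0) {Q : Mem → Prop}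
    (hQ : ∀ m', runProg.Frame m m' →
      (∀ c : Fin N, m'.r 4 (c * (N + 1) + N) = 0) →
      (∀ c r r' : Fin N, m.r 3 ((c * (N + 1) + r) * (N + 1) + r') *
        (1 - m.r 0 (c * (N + 1) + r')) ≤ m'.r 4 (c * (N + 1) + r)) →
      (∀ c r : Fin N, m'.r 4 (c * (N + 1) + r) = 0 ∨ ∃ r' : Fin N, m'.r 4 (c * (N + 1) + r) =
        m.r 3 ((c * (N + 1) + r) * (N + 1) + r') * (1 - m.r 0 (c * (N + 1) + r'))) → Q m') :
    runProg.wp W B 6 env Q m := by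
  -- Column N belongs to the robber's starting point. It must remain zero here, since the next phase
  -- maximizes into it.
  set p : ℕ → ℝ → Prop := fun x y => (∀ c : Fin N, x = c * (N + 1) + N → y = 0) ∧
    ∀ c r : Fin N, x = c * (N + 1) + r → y = 0 ∨ ∃ r' : Fin N, y =
        m.r 3 ((c * (N + 1) + r) * (N + 1) + r') * (1 - m.r 0 (c * (N + 1) + r')) with hp
  have htrans : ∀ m₀ m₁ m₂ : Mem, (∀ a, m₀.r 4 a ≤ m₁.r 4 a) → (∀ a, m₁.r 4 a ≤ m₂.r 4 a) →
    ∀ a, m₀.r 4 a ≤ m₂.r 4 a := fun _ _ _ h h' a => (h a).trans (h' a)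
  refine Cmd.wp_iter (fun m => ∀ x, p x (m.r 4 x)) (fun m m' => ∀ a, m.r 4 a ≤ m'.r 4 a)
    (fun c m₁ => ∀ r < N, ∀ r' < N, m.r 3 ((c * (N + 1) + r) * (N + 1) + r') *
        (1 - m.r 0 (c * (N + 1) + r')) ≤ m₁.r 4 (c * (N + 1) + r)) (by norm_num)
    (fun x => ⟨fun c hc => by rw [hc]; exact h0 _ c.2.le _ le_rfl,
      fun c r hx => .inl (by rw [hx]; exact h0 _ c.2.le _ r.2.le)⟩) (fun _ => le_rfl)
    (fun _ _ => htrans _ _ _) (fun _ _ _ h h' r hr r' hr' => (h' r hr r' hr').trans (h _))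
    (fun c hc m₁ hF₁ hJ₁ => ?_) (fun m₁ hF₁ hJ₁ hR hΦ => hQ m₁ hF₁ (fun c => (hJ₁ _).1 c rfl)
      (fun c r r' => hΦ c (by rw [hctx.h0]; exact c.2) r r.2 r' r'.2) fun c r => (hJ₁ _).2 c r rfl)
  have hctx₁ := hctx.update (i := 6) (by norm_num) c
  refine Cmd.wp_iter (fun m => ∀ x, p x (m.r 4 x)) (fun m m' => ∀ a, m.r 4 a ≤ m'.r 4 a)
    (fun r m₁ => ∀ r' < N, m.r 3 ((c * (N + 1) + r) * (N + 1) + r') *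
        (1 - m.r 0 (c * (N + 1) + r')) ≤ m₁.r 4 (c * (N + 1) + r)) (by norm_num)
    hJ₁ (fun _ => le_rfl)
    (fun _ _ => htrans _ _ _) (fun _ _ _ h h' r' hr' => (h' r' hr').trans (h _))
    (fun r hr m₂ hF₂ hJ₂ => ?_) (fun m₂ hF₂ hJ₂ hR hΦ => ⟨hJ₂, hR,
      fun r hr => hΦ r (by rwa [hctx₁.h0])⟩)
  have hctx₂ := hctx₁.update (i := 7) (by norm_num) r
  refine Cmd.wp_iter (fun m => ∀ x, p x (m.r 4 x)) (fun m m' => ∀ a, m.r 4 a ≤ m'.r 4 a)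
    (fun r' m₁ => m.r 3 ((c * (N + 1) + r) * (N + 1) + r') *
        (1 - m.r 0 (c * (N + 1) + r')) ≤ m₁.r 4 (c * (N + 1) + r)) (by norm_num)
    hJ₂ (fun _ => le_rfl)
    (fun _ _ => htrans _ _ _) (fun _ _ _ h h' => h'.trans (h _))
    (fun r' hr' m₃ hF₃ hJ₃ => ?_) (fun m₃ hF₃ hJ₃ hR hΦ => ⟨hJ₃, hR,
      fun r' hr' => hΦ r' (by rwa [hctx₂.h0])⟩)
  have hctx₃ := hctx₂.update (i := 8) (by norm_num) r'
  rw [hctx.h0] at hc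
  rw [hctx₁.h0] at hr
  rw [hctx₂.h0] at hr'
  have hr3 : m₃.r 3 = m.r 3 := (hF₃.2 3 (by decide)).trans ((hF₂.2 3 (by decide)).trans
    (hF₁.2 3 (by decide)))
  have hr0 : m₃.r 0 = m.r 0 := (hF₃.2 0 (by decide)).trans ((hF₂.2 0 (by decide)).trans
    (hF₁.2 0 (by decide)))
  set env' := Function.update (Function.update (Function.update env 6 c) 7 r) 8 r' with henv
  have e6 : (WExp.var 6).eval env' m₃ = c := by simp [WExp.eval, henv]
  have e7 : (WExp.var 7).eval env' m₃ = r := by simp [WExp.eval, henv]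
  have e8 : (WExp.var 8).eval env' m₃ = r' := by simp [WExp.eval, henv]
  have hs6 : (WExp.var 6).Safe W B 9 env' m₃ := by simp [WExp.Safe]
  have hs7 : (WExp.var 7).Safe W B 9 env' m₃ := by simp [WExp.Safe]
  have hs8 : (WExp.var 8).Safe W B 9 env' m₃ := by simp [WExp.Safe]
  obtain ⟨hs, hlt⟩ := hctx₃.safe_idx₂' (by norm_num) hs6 hs7 (e6.trans_le hc.le) (e7.trans_le hr.le)
  obtain ⟨hs', hlt'⟩ := hctx₃.safe_idx₂' (by norm_num) hs6 hs8 (e6.trans_le hc.le)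
    (e8.trans_le hr'.le)
  obtain ⟨hs'', hlt''⟩ := hctx₃.safe_idx₃ (by norm_num) hs6 hs7 hs8 (e6.trans_le hc.le)
    (e7.trans_le hr.le) (e8.trans_le hr'.le)
  simp only [idx₂, WExp.eval] at e6 e7 e8 hlt
  rw [e6, e7, hctx₃.h3] at hlt
  refine Cmd.wp_rmax hJ₃ (c * (N + 1) + r) (m.r 3 ((c * (N + 1) + r) * (N + 1) + r') *
    (1 - m.r 0 (c * (N + 1) + r'))) (by norm_num) hs ?_ hlt
    ⟨⟨by norm_num, hs'', hlt''⟩, trivial, by norm_num, hs', hlt'⟩ ?_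
    ⟨fun c₁ h => ?_, fun c₁ r₁ h => ?_⟩ fun m₄ _ _ hJ₄ hle₄ hv₄ => ⟨hJ₄, hle₄, hv₄⟩
  · simp only [idx₂, WExp.eval, e6, e7, hctx₃.h3]
  · simp only [RExp.eval, idx₃, idx₂, WExp.eval, e6, e7, e8, hctx₃.h3, hr3, hr0]
  · rw [idx_inj (by omega) (by omega)] at h
    omega
  · rw [idx_inj (by omega) (by omega)] at h
    obtain ⟨rfl, rfl⟩ := h
    exact .inr ⟨⟨r', hr'⟩, rfl⟩

lemma wp_startProg {E : ℕ} {env : ℕ → ℕ} (hctx : Ctx N E W B env) {m : Mem}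
    (h0 : ∀ c : Fin N, m.r 4 (c * (N + 1) + N) = 0) {Q : Mem → Prop}
    (hQ : ∀ m', startProg.Frame m m' →
      (∀ c r : Fin N, m'.r 4 (c * (N + 1) + r) = m.r 4 (c * (N + 1) + r)) →
      (∀ c r' : Fin N, 1 - m.r 0 (c * (N + 1) + r') ≤ m'.r 4 (c * (N + 1) + N)) →
      (∀ c : Fin N, m'.r 4 (c * (N + 1) + N) = 0 ∨ ∃ r' : Fin N, m'.r 4 (c * (N + 1) + N) =
        1 - m.r 0 (c * (N + 1) + r')) → Q m') :
    startProg.wp W B 6 env Q m := by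
  -- Both phases write to array 4, so the frame does not protect the earlier columns; the first
  -- clause does.
  set p : ℕ → ℝ → Prop := fun x y => (∀ c r : Fin N, x = c * (N + 1) + r → y = m.r 4 x) ∧
    ∀ c : Fin N, x = c * (N + 1) + N → y = 0 ∨ ∃ r' : Fin N, y = 1 - m.r 0 (c * (N + 1) + r') with hp
  have htrans : ∀ m₀ m₁ m₂ : Mem, (∀ a, m₀.r 4 a ≤ m₁.r 4 a) → (∀ a, m₁.r 4 a ≤ m₂.r 4 a) →
    ∀ a, m₀.r 4 a ≤ m₂.r 4 a := fun _ _ _ h h' a => (h a).trans (h' a)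
  refine Cmd.wp_iter (fun m => ∀ x, p x (m.r 4 x)) (fun m m' => ∀ a, m.r 4 a ≤ m'.r 4 a)
    (fun c m₁ => ∀ r' < N, 1 - m.r 0 (c * (N + 1) + r') ≤ m₁.r 4 (c * (N + 1) + N)) (by norm_num)
    (fun x => ⟨fun _ _ _ => rfl, fun c hx => .inl (by rw [hx]; exact h0 _)⟩) (fun _ => le_rfl)
    (fun _ _ => htrans _ _ _) (fun _ _ _ h h' r' hr' => (h' r' hr').trans (h _))
    (fun c hc m₁ hF₁ hJ₁ => ?_) (fun m₁ hF₁ hJ₁ hR hΦ => hQ m₁ hF₁ (fun c r => (hJ₁ _).1 c r rfl)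
      (fun c r' => hΦ c (by rw [hctx.h0]; exact c.2) r' r'.2) fun c => (hJ₁ _).2 c rfl)
  have hctx₁ := hctx.update (i := 6) (by norm_num) c
  refine Cmd.wp_iter (fun m => ∀ x, p x (m.r 4 x)) (fun m m' => ∀ a, m.r 4 a ≤ m'.r 4 a)
    (fun r' m₁ => 1 - m.r 0 (c * (N + 1) + r') ≤ m₁.r 4 (c * (N + 1) + N)) (by norm_num)
    hJ₁ (fun _ => le_rfl)
    (fun _ _ => htrans _ _ _) (fun _ _ _ h h' => h'.trans (h _))
    (fun r' hr' m₂ hF₂ hJ₂ => ?_) (fun m₂ hF₂ hJ₂ hR hΦ => ⟨hJ₂, hR,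
      fun r' hr' => hΦ r' (by rwa [hctx₁.h0])⟩)
  have hctx₂ := hctx₁.update (i := 7) (by norm_num) r'
  rw [hctx.h0] at hc
  rw [hctx₁.h0] at hr'
  have hr0 : m₂.r 0 = m.r 0 := (hF₂.2 0 (by decide)).trans (hF₁.2 0 (by decide))
  set env' := Function.update (Function.update env 6 c) 7 r' with henv
  have e6 : (WExp.var 6).eval env' m₂ = c := by simp [WExp.eval, henv]
  have e7 : (WExp.var 7).eval env' m₂ = r' := by simp [WExp.eval, henv]
  have e0 : (WExp.var 0).eval env' m₂ = N := hctx₂.h0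
  have hs6 : (WExp.var 6).Safe W B 8 env' m₂ := by simp [WExp.Safe]
  have hs7 : (WExp.var 7).Safe W B 8 env' m₂ := by simp [WExp.Safe]
  have hs0 : (WExp.var 0).Safe W B 8 env' m₂ := by simp [WExp.Safe]
  obtain ⟨hs, hlt⟩ := hctx₂.safe_idx₂' (by norm_num) hs6 hs0 (e6.trans_le hc.le) e0.le
  obtain ⟨hs', hlt'⟩ := hctx₂.safe_idx₂' (by norm_num) hs6 hs7 (e6.trans_le hc.le)
    (e7.trans_le hr'.le)
  simp only [idx₂, WExp.eval] at e6 e7 e0 hlt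
  rw [e6, e0, hctx₂.h3] at hlt
  refine Cmd.wp_rmax hJ₂ (c * (N + 1) + N) (1 - m.r 0 (c * (N + 1) + r')) (by norm_num) hs ?_ hlt
    ⟨trivial, by norm_num, hs', hlt'⟩ ?_
    ⟨fun c₁ r₁ h => ?_, fun c₁ h => ?_⟩ fun m₄ _ _ hJ₄ hle₄ hv₄ => ⟨hJ₄, hle₄, hv₄⟩
  · simp only [idx₂, WExp.eval, e6, e0, hctx₂.h3]
  · simp only [RExp.eval, idx₂, WExp.eval, e6, e7, hctx₂.h3, hr0]
  · rw [idx_inj (by omega) (by omega)] at h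
    omega
  · rw [idx_inj (by omega) (by omega)] at h
    obtain ⟨rfl, -⟩ := h
    exact .inr ⟨⟨r', hr'⟩, rfl⟩

/-- The value `y` at position `x` of the state array is zero or an option of the cop, where `u` holds
the robber's chances after his move; the jail keeps its value. -/
def StateOption (A : Arena (Fin N)) (u : ℕ → ℝ) (x : ℕ) (y : ℝ) : Prop :=
  (x = (N + 1) * (N + 1) → y = 1) ∧ ∀ c r : Option (Fin N), x = posIndex c * (N + 1) + posIndex r →
    y = 0 ∨ ∃ a : Fin N, A.CopMove c a ∧ y = 1 - u (a * (N + 1) + posIndex r)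

lemma StateOption.of_move {u : ℕ → ℝ} {c : Option (Fin N)} {a : Fin N} (h : A.CopMove c a) {r : ℕ}
    (hr : r ≤ N) : StateOption A u (posIndex c * (N + 1) + r) (1 - u (a * (N + 1) + r)) := by
  refine ⟨fun hx => ?_, fun c' r' hx => ?_⟩
  · have := Ctx.sq_lt (posIndex_le c) hr
    omega
  · rw [idx_inj (by omega) (Nat.lt_succ_of_le (posIndex_le r'))] at hx
    obtain ⟨hc, rfl⟩ := hx
    rw [← posIndex_inj hc]
    exact .inr ⟨a, h, rfl⟩

lemma wp_stayProg {E : ℕ} {env : ℕ → ℕ} (hctx : Ctx N E W B env) {m : Mem}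
    (h0 : ∀ x, StateOption A (m.r 4) x (m.r 0 x)) {Q : Mem → Prop}
    (hQ : ∀ m', stayProg.Frame m m' → (∀ x, StateOption A (m.r 4) x (m'.r 0 x)) →
      (∀ (c : Fin N), ∀ r ≤ N, 1 - m.r 4 (c * (N + 1) + r) ≤ m'.r 0 (c * (N + 1) + r)) →
      (∀ (c : Fin N), ∀ r ≤ N, 1 - m.r 4 (c * (N + 1) + r) ≤ m'.r 0 (N * (N + 1) + r)) → Q m') :
    stayProg.wp W B 6 env Q m := by
  have htrans : ∀ m₀ m₁ m₂ : Mem, (∀ a, m₀.r 0 a ≤ m₁.r 0 a) → (∀ a, m₁.r 0 a ≤ m₂.r 0 a) →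
    ∀ a, m₀.r 0 a ≤ m₂.r 0 a := fun _ _ _ h h' a => (h a).trans (h' a)
  refine Cmd.wp_iter (fun m' => ∀ x, StateOption A (m.r 4) x (m'.r 0 x))
    (fun m m' => ∀ a, m.r 0 a ≤ m'.r 0 a)
    (fun c m₁ => ∀ r ≤ N, 1 - m.r 4 (c * (N + 1) + r) ≤ m₁.r 0 (c * (N + 1) + r) ∧
      1 - m.r 4 (c * (N + 1) + r) ≤ m₁.r 0 (N * (N + 1) + r)) (by norm_num) h0 (fun _ => le_rfl)
    (fun _ _ => htrans _ _ _)
    (fun _ _ _ h h' r hr => ⟨(h' r hr).1.trans (h _), (h' r hr).2.trans (h _)⟩)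
    (fun c hc m₁ hF₁ hJ₁ => ?_) (fun m₁ hF₁ hJ₁ hR hΦ => hQ m₁ hF₁ hJ₁
      (fun c r hr => (hΦ c (by rw [hctx.h0]; exact c.2) r hr).1)
      fun c r hr => (hΦ c (by rw [hctx.h0]; exact c.2) r hr).2)
  have hctx₁ := hctx.update (i := 6) (by norm_num) c
  refine Cmd.wp_iter (fun m' => ∀ x, StateOption A (m.r 4) x (m'.r 0 x))
    (fun m m' => ∀ a, m.r 0 a ≤ m'.r 0 a)
    (fun r m₁ => 1 - m.r 4 (c * (N + 1) + r) ≤ m₁.r 0 (c * (N + 1) + r) ∧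
      1 - m.r 4 (c * (N + 1) + r) ≤ m₁.r 0 (N * (N + 1) + r)) (by norm_num) hJ₁ (fun _ => le_rfl)
    (fun _ _ => htrans _ _ _) (fun _ _ _ h h' => ⟨h'.1.trans (h _), h'.2.trans (h _)⟩)
    (fun r hr m₂ hF₂ hJ₂ => ?_) (fun m₂ hF₂ hJ₂ hR hΦ => ⟨hJ₂, hR,
      fun r hr => hΦ r (by rw [hctx₁.h3]; omega)⟩)
  have hctx₂ := hctx₁.update (i := 7) (by norm_num) r
  rw [hctx.h0] at hc
  rw [hctx₁.h3] at hr
  have hrN : r ≤ N := by omega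
  have hr4 : m₂.r 4 = m.r 4 := (hF₂.2 4 (by decide)).trans (hF₁.2 4 (by decide))
  set env' := Function.update (Function.update env 6 c) 7 r with henv
  have e6 : env' 6 = c := by simp [henv]
  have e7 : env' 7 = r := by simp [henv]
  have e0 : env' 0 = N := hctx₂.h0
  have hs := fun m => hctx₂.safe_idx₂' (m := m) (d := 8) (a := .var 6) (b := .var 7) (by norm_num)
    (by simp [WExp.Safe]) (by simp [WExp.Safe]) (e6.trans_le hc.le) (e7.trans_le hrN)
  have hs' := fun m => hctx₂.safe_idx₂' (m := m) (d := 8) (a := .var 0) (b := .var 7) (by norm_num)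
    (by simp [WExp.Safe]) (by simp [WExp.Safe]) e0.le (e7.trans_le hrN)
  have hidx : ∀ m, (idx₂ (.var 6) (.var 7)).eval env' m = c * (N + 1) + r := by
    intro m; simp only [idx₂, WExp.eval, e6, e7, hctx₂.h3]
  have hidx' : ∀ m, (idx₂ (.var 0) (.var 7)).eval env' m = N * (N + 1) + r := by
    intro m; simp only [idx₂, WExp.eval, e0, e7, hctx₂.h3]
  refine Cmd.wp_seq (Cmd.wp_rmax hJ₂ _ (1 - m.r 4 (c * (N + 1) + r))
    (by norm_num) (hs _).1 (hidx _) (hidx m₂ ▸ (hs _).2) ⟨trivial, by norm_num, (hs _).1, (hs _).2⟩ ?_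
    (StateOption.of_move (c := some ⟨c, hc⟩) (a := ⟨c, hc⟩) (.inl rfl) hrN)
    fun m₃ hw₃ hr₃ hJ₃ hle₃ hv₃ => Cmd.wp_rmax hJ₃ _ (1 - m.r 4 (c * (N + 1) + r))
    (by norm_num) (hs' _).1 (hidx' _) (hidx' m₂ ▸ (hs' _).2) ⟨trivial, by norm_num, (hs _).1, (hs _).2⟩
    ?_ (StateOption.of_move (c := none) (a := ⟨c, hc⟩) trivial hrN)
    fun m₄ hw₄ hr₄ hJ₄ hle₄ hv₄ => ⟨hJ₄, fun a => (hle₃ a).trans (hle₄ a), hv₃.trans (hle₄ _), hv₄⟩)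
  · simp only [RExp.eval, hidx, hr4]
  · simp only [RExp.eval, hidx, hr₃ 4 (by norm_num), hr4]

lemma wp_crossProg {env : ℕ → ℕ} (hctx : Ctx N L.length W B env) (hL : IsEdgeList A L) {m : Mem}
    (hw : HoldsEdges L (m.w 0))
    (h0 : ∀ x, StateOption A (m.r 4) x (m.r 0 x)) {Q : Mem → Prop}
    (hQ : ∀ m', crossProg.Frame m m' → (∀ x, StateOption A (m.r 4) x (m'.r 0 x)) →
      (∀ x, m.r 0 x ≤ m'.r 0 x) →
      (∀ c a : Fin N, s(c, a) ∈ A.edges → ∀ r ≤ N,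
        1 - m.r 4 (a * (N + 1) + r) ≤ m'.r 0 (c * (N + 1) + r)) → Q m') :
    crossProg.wp W B 6 env Q m := by
  have htrans : ∀ m₀ m₁ m₂ : Mem, (∀ a, m₀.r 0 a ≤ m₁.r 0 a) → (∀ a, m₁.r 0 a ≤ m₂.r 0 a) →
    ∀ a, m₀.r 0 a ≤ m₂.r 0 a := fun _ _ _ h h' a => (h a).trans (h' a)
  refine Cmd.wp_iter (fun m' => ∀ x, StateOption A (m.r 4) x (m'.r 0 x))
    (fun m m' => ∀ a, m.r 0 a ≤ m'.r 0 a)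
    (fun j m₁ => ∀ h : j < L.length, ∀ r ≤ N,
      1 - m.r 4 (L[j].2 * (N + 1) + r) ≤ m₁.r 0 (L[j].1 * (N + 1) + r) ∧
      1 - m.r 4 (L[j].1 * (N + 1) + r) ≤ m₁.r 0 (L[j].2 * (N + 1) + r)) (by norm_num)
    h0 (fun _ => le_rfl) (fun _ _ => htrans _ _ _)
    (fun _ _ _ h h' hj r hr => ⟨(h' hj r hr).1.trans (h _), (h' hj r hr).2.trans (h _)⟩)
    (fun j hj m₁ hF₁ hJ₁ => ?_) (fun m₁ hF₁ hJ₁ hR hΦ => hQ m₁ hF₁ hJ₁ hR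
      fun c a hca r hr => ?_)
  · have hctx₁ := hctx.update (i := 6) (by norm_num) j
    rw [hctx.h1] at hj
    refine Cmd.wp_iter (fun m' => ∀ x, StateOption A (m.r 4) x (m'.r 0 x))
      (fun m m' => ∀ a, m.r 0 a ≤ m'.r 0 a)
      (fun r m₁ => 1 - m.r 4 (L[j].2 * (N + 1) + r) ≤ m₁.r 0 (L[j].1 * (N + 1) + r) ∧
        1 - m.r 4 (L[j].1 * (N + 1) + r) ≤ m₁.r 0 (L[j].2 * (N + 1) + r)) (by norm_num) hJ₁
      (fun _ => le_rfl) (fun _ _ => htrans _ _ _)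
      (fun _ _ _ h h' => ⟨h'.1.trans (h _), h'.2.trans (h _)⟩)
      (fun r hr m₂ hF₂ hJ₂ => ?_) (fun m₂ hF₂ hJ₂ hR hΦ => ⟨hJ₂, hR,
        fun _ r hr => hΦ r (by rw [hctx₁.h3]; omega)⟩)
    have hctx₂ := hctx₁.update (i := 7) (by norm_num) r
    rw [hctx₁.h3] at hr
    have hrN : r ≤ N := by omega
    have hr4 : m₂.r 4 = m.r 4 := (hF₂.2 4 (by decide)).trans (hF₁.2 4 (by decide))
    have hw₂ : m₂.w 0 = m.w 0 := (hF₂.1 0 (by decide)).trans (hF₁.1 0 (by decide))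
    obtain ⟨hu, hv⟩ := hw j hj
    have he := hL.mem_edges hj
    set env' := Function.update (Function.update env 6 j) 7 r with henv
    have e6 : env' 6 = j := by simp [henv]
    have e7 : env' 7 = r := by simp [henv]
    have hends := fun m => hctx₂.safe_ends (d := 8) (m := m) (j := 6) (by norm_num) (by rwa [e6])
    have e1 : ∀ m', m'.w = m₂.w → (fstEnd 6).eval env' m' = L[j].1 := by
      intro m' h; simp [fstEnd, WExp.eval, e6, h, hw₂, hu]
    have e2 : ∀ m', m'.w = m₂.w → (sndEnd 6).eval env' m' = L[j].2 := by
      intro m' h; simp [sndEnd, WExp.eval, e6, h, hw₂, hv]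
    have hs := fun m' h => hctx₂.safe_idx₂' (m := m') (d := 8) (a := fstEnd 6) (b := .var 7)
      (by norm_num) (hends _).1 (by simp [WExp.Safe]) ((e1 m' h).trans_le L[j].1.2.le)
      (e7.trans_le hrN)
    have hs' := fun m' h => hctx₂.safe_idx₂' (m := m') (d := 8) (a := sndEnd 6) (b := .var 7)
      (by norm_num) (hends _).2 (by simp [WExp.Safe]) ((e2 m' h).trans_le L[j].2.2.le)
      (e7.trans_le hrN)
    have hidx : ∀ m', m'.w = m₂.w →
        (idx₂ (fstEnd 6) (.var 7)).eval env' m' = L[j].1 * (N + 1) + r := by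
      intro m' h
      change (fstEnd 6).eval env' m' * env' 3 + env' 7 = _
      rw [e1 m' h, e7, hctx₂.h3]
    have hidx' : ∀ m', m'.w = m₂.w →
        (idx₂ (sndEnd 6) (.var 7)).eval env' m' = L[j].2 * (N + 1) + r := by
      intro m' h
      change (sndEnd 6).eval env' m' * env' 3 + env' 7 = _
      rw [e2 m' h, e7, hctx₂.h3]
    refine Cmd.wp_seq (Cmd.wp_rmax hJ₂ _ (1 - m.r 4 (L[j].2 * (N + 1) + r))
      (by norm_num) (hs _ rfl).1 (hidx _ rfl) (hidx m₂ rfl ▸ (hs _ rfl).2)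
      ⟨trivial, by norm_num, (hs' _ rfl).1, (hs' _ rfl).2⟩ ?_
      (StateOption.of_move (c := some L[j].1) (a := L[j].2) (.inr he) hrN)
      fun m₃ hw₃ hr₃ hJ₃ hle₃ hv₃ => Cmd.wp_rmax hJ₃ _ (1 - m.r 4 (L[j].1 * (N + 1) + r))
      (by norm_num) (hs' _ hw₃).1 (hidx' _ hw₃) (hidx' m₂ rfl ▸ (hs' _ rfl).2)
      ⟨trivial, by norm_num, (hs _ hw₃).1, (hs _ hw₃).2⟩
      ?_ (StateOption.of_move (c := some L[j].2) (a := L[j].1) (.inr (Sym2.eq_swap ▸ he)) hrN)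
      fun m₄ hw₄ hr₄ hJ₄ hle₄ hv₄ => ⟨hJ₄, fun a => (hle₃ a).trans (hle₄ a), hv₃.trans (hle₄ _), hv₄⟩)
    · simp only [RExp.eval, hidx' _ rfl, hr4]
    · simp only [RExp.eval, hidx _ hw₃, hr₃ 4 (by norm_num), hr4]
  · obtain ⟨j, hj, ⟨rfl, rfl⟩ | ⟨rfl, rfl⟩⟩ := hL.exists_index hca
    · exact (hΦ j (by rwa [hctx.h1]) hj r hr).1
    · exact (hΦ j (by rwa [hctx.h1]) hj r hr).2

/-- Array `0` holds the values of all states for `n` turns. -/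
def HoldsValues [NeZero N] (A : Arena (Fin N)) (n : ℕ) (m : Mem) : Prop :=
  ∀ s : Pos (Fin N), m.r 0 (stateIndex s) = A.game.w n s

/-- Array 4 receives the robber's chances U before array 0 is overwritten, so the old values can be
discarded. Only rows of cop vertices are filled, as the cop has always left his starting point when
the robber moves. -/
lemma wp_turnProg [NeZero N] {env : ℕ → ℕ} (hctx : Ctx N L.length W B env) (hL : IsEdgeList A L)
    {m : Mem} (hw : HoldsEdges L (m.w 0))
    (hT : ∀ c r r' : Fin N, A.IsBest c r r' (m.r 3 ((c * (N + 1) + r) * (N + 1) + r')))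
    {n : ℕ} (hV : HoldsValues A n m) :
    turnProg.wp W B 6 env (HoldsValues A (n + 1)) m := by
  refine Cmd.wp_seq (wp_resetProg hctx (by norm_num) (by norm_num) fun m₁ hF₁ hz₁ _ => ?_)
  refine Cmd.wp_seq (wp_runProg hctx hz₁ fun m₂ hF₂ hs₂ hge₂ hat₂ => ?_)
  have h10 : m₁.r 0 = m.r 0 := hF₁.2 0 (by decide)
  have h20 : m₂.r 0 = m.r 0 := (hF₂.2 0 (by decide)).trans h10
  rw [hF₁.2 3 (by decide), h10] at hge₂ hat₂
  refine Cmd.wp_seq (wp_startProg hctx hs₂ fun m₃ hF₃ hr₃ hge₃ hat₃ => ?_)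
  rw [h20] at hge₃ hat₃
  have hval : ∀ c r : Fin N, m.r 0 (c * (N + 1) + r) = A.game.w n (.at (some c) (some r)) :=
    fun c r => hV (.at (some c) (some r))
  have hU : ∀ (a : Fin N) (r : Option (Fin N)),
      A.game.robValue n (.at (some a) r) = 1 - m₃.r 4 (a * (N + 1) + posIndex r) := by
    rintro a (_ | r)
    · refine A.robValue_start (fun r => ?_) ?_
      · rw [← hval]; exact hge₃ a r
      · rcases hat₃ a with h | ⟨r, h⟩
        -- If the maximum kept its initial zero, every 1 - w is at most 0. It is also nonnegative,
        -- so any vertex attains it.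
        · refine ⟨0, le_antisymm ?_ ?_⟩
          · rw [posIndex, h]; exact sub_nonneg.2 (A.game.w_mem n _).2
          · rw [← hval]; exact hge₃ a 0
        · exact ⟨r, by rw [← hval]; exact h⟩
    · rw [posIndex, hr₃]
      refine A.robValue_run (hT a r) (fun r' => ?_) ?_
      · rw [← hval]; exact hge₂ a r r'
      · rcases hat₂ a r with h | ⟨r', h⟩
        · exact .inl h
        · exact .inr ⟨r', by rw [← hval]; exact h⟩
  refine Cmd.wp_seq (wp_resetProg hctx (by norm_num) (by norm_num) fun m₄ hF₄ hz₄ hj₄ => ?_)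
  have h43 : m₄.r 4 = m₃.r 4 := hF₄.2 4 (by decide)
  have hopt₄ : ∀ x, StateOption A (m₄.r 4) x (m₄.r 0 x) := by
    refine fun x => ⟨?_, fun c r hx => .inl ?_⟩
    -- The reset clears only the first (N+1)² cells, so the jail's 1, stored just behind them,
    -- persists.
    · rintro rfl
      rw [hj₄ _ le_rfl, hF₃.2 0 (by decide), h20]
      exact (hV .jail).trans (A.w_jail n)
    · rw [hx]; exact hz₄ _ (posIndex_le c) _ (posIndex_le r)
  refine Cmd.wp_seq (wp_stayProg hctx hopt₄ fun m₅ hF₅ hopt₅ hge₅ hge₅' => ?_)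
  have h54 : m₅.r 4 = m₄.r 4 := hF₅.2 4 (by decide)
  have hw₅ : m₅.w 0 = m.w 0 := (hF₅.1 0 (by decide)).trans ((hF₄.1 0 (by decide)).trans
    ((hF₃.1 0 (by decide)).trans ((hF₂.1 0 (by decide)).trans (hF₁.1 0 (by decide)))))
  rw [← h54] at hopt₅
  refine wp_crossProg hctx hL (hw₅ ▸ hw) hopt₅ fun m₆ hF₆ hopt₆ hle₆ hge₆ => ?_
  rw [h54, h43] at hopt₆ hge₆
  rw [h43] at hge₅ hge₅'
  rintro (_ | ⟨c, r⟩)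
  · rw [A.w_jail]
    exact (hopt₆ _).1 rfl
  · symm
    have hge : ∀ a, A.CopMove c a →
        1 - m₃.r 4 (a * (N + 1) + posIndex r) ≤ m₆.r 0 (stateIndex (.at c r)) := by
      intro a ha
      rcases c with _ | c
      · exact (hge₅' a _ (posIndex_le r)).trans (hle₆ _)
      · rcases ha with rfl | ha
        · exact (hge₅ a _ (posIndex_le r)).trans (hle₆ _)
        · exact hge₆ c a ha _ (posIndex_le r)
    refine A.w_succ_at (fun a => hU a r) hge ?_
    rcases (hopt₆ _).2 c r rfl with h | ⟨a, ha, h⟩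
    -- A remaining zero forces every available option to be 0, because robber values are
    -- nonnegative; any legal move then attains the maximum.
    · obtain ⟨a, ha⟩ : ∃ a, A.CopMove c a := by
        rcases c with _ | c
        · exact ⟨0, trivial⟩
        · exact ⟨c, .inl rfl⟩
      refine ⟨a, ha, le_antisymm ?_ (hge a ha)⟩
      rw [← hU, stateIndex, h]
      exact A.game.robValue_nonneg n _
    · exact ⟨a, ha, h⟩

/-- Real array 0 first holds the input probabilities and then the state values; once array 3 is
complete the probabilities are no longer read. -/
lemma wp_mainCmd [NeZero N] {env : ℕ → ℕ} (hctx : Ctx N L.length W B env) (hL : IsEdgeList A L)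
    {m : Mem} (hw : HoldsEdges L (m.w 0)) (hr : HoldsSurvival A L (m.r 0)) :
    mainCmd.wp W B 5 env (HoldsValues A (env 2)) m := by
  refine Cmd.wp_seq (wp_prepProg hctx hL hw hr fun m₁ hF₁ hT₁ => ?_)
  refine Cmd.wp_seq (wp_resetProg hctx (by norm_num) (by norm_num) fun m₂ hF₂ hz₂ _ => ?_)
  have hsq : (N + 1) * (N + 1) < B := by
    have := hctx.hB
    have hN : 0 < N := Nat.pos_of_ne_zero (NeZero.ne N)
    nlinarith
  have hWB := hctx.hW
  refine Cmd.wp_seq (Cmd.wp_rset ((N + 1) * (N + 1)) 1 (by norm_num)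
    ⟨by simp [WExp.Safe], by simp [WExp.Safe], ?_⟩ ?_ hsq trivial rfl ?_)
  · simp only [WExp.eval, hctx.h3]; omega
  · simp only [WExp.eval, hctx.h3]
  have hw₂ : m₂.w 0 = m.w 0 := (hF₂.1 0 (by decide)).trans (hF₁.1 0 (by decide))
  have h23 : m₂.r 3 = m₁.r 3 := hF₂.2 3 (by decide)
  refine ⟨by norm_num, HoldsValues A, ?_, fun k hk m₃ hF₃ hV₃ => ?_, fun m' _ h => h⟩
  · rintro (_ | ⟨c, r⟩)
    · simp [stateIndex, A.w_jail]
    · have := Ctx.sq_lt (posIndex_le c) (posIndex_le r)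
      simp [stateIndex, A.w_zero_at, hz₂ _ (posIndex_le c) _ (posIndex_le r),
        show posIndex c * (N + 1) + posIndex r ≠ (N + 1) * (N + 1) by omega]
  · refine wp_turnProg (hctx.update (by norm_num) k) hL ?_ ?_ hV₃
    · rw [hF₃.1 0 (by decide)]; simpa [hw₂] using hw
    · rw [hF₃.2 3 (by decide)]; simpa [h23] using hT₁

end Turns

/-! ### Input, output and running time -/

/-- The whole program. -/
def mainProg : Prog :=
  .seq (.seq (.wconst 3 1) (.seq (.wop .add 3 0 3) (.seq (.wop .mul 4 3 3) (.wop .mul 4 4 3))))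
    (mainCmd.compile 5)

lemma getD_flatMap_of_length {α β : Type} {E : ℕ} (g : α → List β) (hg : ∀ a, (g a).length = E)
    (l : List α) (b : β) {i j : ℕ} (hi : i < l.length) (hj : j < E) :
    (l.flatMap g).getD (i * E + j) b = (g l[i]).getD j b := by
  induction l generalizing i with
  | nil => simp at hi
  | cons a l ih =>
    rw [List.flatMap_cons]
    rcases i with _ | i
    · rw [List.getD_append _ _ _ _ (by rw [hg]; omega)]
      simp
    · rw [List.getD_append_right _ _ _ _ (by rw [hg, add_mul]; omega), hg]
      rw [show (i + 1) * E + j - E = i * E + j by rw [add_mul]; omega]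
      simpa using ih (by simpa using hi)

lemma inputStore_wmem {N : ℕ} (A : Arena (Fin N)) (L : List (Fin N × Fin N)) (n : ℕ) :
    HoldsEdges L (inputStore A L n).wmem := by
  intro j hj
  have h1 := getD_flatMap_of_length (fun e : Fin N × Fin N => [(e.1 : ℕ), (e.2 : ℕ)])
    (E := 2) (fun _ => rfl) L 0 hj (j := 0) (by norm_num)
  have h2 := getD_flatMap_of_length (fun e : Fin N × Fin N => [(e.1 : ℕ), (e.2 : ℕ)])
    (E := 2) (fun _ => rfl) L 0 hj (j := 1) (by norm_num)
  rw [mul_two] at h1 h2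
  exact ⟨h1, h2⟩

lemma inputStore_rmem {N : ℕ} (A : Arena (Fin N)) (L : List (Fin N × Fin N)) (n : ℕ) :
    HoldsSurvival A L (inputStore A L n).rmem := by
  intro c j hj
  have h := getD_flatMap_of_length (fun c : Fin N => L.map fun e => A.survival c s(e.1, e.2))
    (E := L.length) (fun _ => by simp) (List.finRange N) 0 (i := c) (by simp) hj
  refine h.trans ?_
  simp [hj]

lemma IsEdgeList.card_edges {N : ℕ} {A : Arena (Fin N)} {L : List (Fin N × Fin N)}
    (hL : IsEdgeList A L) : A.edges.card = L.length := by
  rw [← hL.2, List.toFinset_card_of_nodup hL.1, List.length_map]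

lemma IsEdgeList.length_le {N : ℕ} {A : Arena (Fin N)} {L : List (Fin N × Fin N)}
    (hL : IsEdgeList A L) : L.length ≤ N * N := by
  simpa using (hL.1.of_map _).length_le_card

/-- Every vertex is an endpoint of a listed edge. This lets the cubic terms of the running time be
absorbed into N²E. -/
lemma IsEdgeList.le_two_mul_length {N : ℕ} {A : Arena (Fin N)} {L : List (Fin N × Fin N)}
    (hL : IsEdgeList A L) : N ≤ 2 * L.length := by
  have h : (Finset.univ : Finset (Fin N)) ⊆ (L.map Prod.fst ++ L.map Prod.snd).toFinset := by
    intro v _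
    obtain ⟨u, hu⟩ := A.exists_edge v
    simp only [List.mem_toFinset, List.mem_append, List.mem_map]
    obtain ⟨j, hj, ⟨rfl, -⟩ | ⟨-, rfl⟩⟩ := hL.exists_index hu
    · exact .inl ⟨_, L.getElem_mem hj, rfl⟩
    · exact .inr ⟨_, L.getElem_mem hj, rfl⟩
  have := (Finset.card_le_card h).trans (List.toFinset_card_le _)
  simp at this
  omega

/-- The cost is a polynomial in N, E and n, linear in n. Each monomial is bounded by N²E or 2N²E,
with the factor n where it occurs, and the sum of coefficients stays below the generous constant. -/
lemma cost_mainCmd {N E n : ℕ} {p : ℕ → ℕ} (h0 : p 0 = N) (h1 : p 1 = E) (h2 : p 2 = n)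
    (h3 : p 3 = N + 1) (hN : 0 < N) (hNE : N ≤ 2 * E) :
    mainCmd.cost p ≤ 10000 * ((n + 1) * N ^ 2 * E) := by
  simp only [mainCmd, prepProg, initProg, edgeProg, markProg, walkProg, labelProg, tableProg,
    resetProg, turnProg, runProg, startProg, stayProg, crossProg, Cmd.ifNe, Cmd.cost, WExp.cost,
    RExp.cost, idx₃, idx₂, fstEnd, sndEnd, survExp, h0, h1, h2, h3]
  have hE : 0 < E := by omega
  have b₁ : 1 ≤ N ^ 2 * E := Nat.mul_pos (pow_pos hN 2) hE
  have b₂ : N ≤ N ^ 2 * E := by nlinarith [Nat.mul_pos hN hE]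
  have b₃ : N * E ≤ N ^ 2 * E := Nat.mul_le_mul_right _ (by nlinarith)
  have b₄ : N ^ 2 ≤ N ^ 2 * E := Nat.le_mul_of_pos_right _ hE
  have b₅ : N ^ 3 ≤ 2 * (N ^ 2 * E) := by
    calc N ^ 3 = N ^ 2 * N := by ring
      _ ≤ N ^ 2 * (2 * E) := Nat.mul_le_mul_left _ hNE
      _ = 2 * (N ^ 2 * E) := by ring
  have b₆ : E ≤ N ^ 2 * E := Nat.le_mul_of_pos_left _ (pow_pos hN 2)
  have c₁ := Nat.mul_le_mul_right n b₁
  have c₂ := Nat.mul_le_mul_right n b₂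
  have c₃ := Nat.mul_le_mul_right n b₃
  have c₄ := Nat.mul_le_mul_right n b₄
  have c₅ := Nat.mul_le_mul_right n b₅
  have c₆ := Nat.mul_le_mul_right n b₆
  linarith

end FastRobber

open FastRobber in
theorem mainTheorem11 :
    ∃ (p : Prog) (K : ℕ), ∀ (N : ℕ) [NeZero N] (A : Arena (Fin N)) (L : List (Fin N × Fin N)),
      IsEdgeList A L → ∀ n : ℕ, ∃ (t : ℕ) (τ : Store),
        Run (K * N ^ 3) (K * (N ^ 3 + n)) p (inputStore A L n) t τ ∧
        (t : ℝ) ≤ K * ((N : ℝ) ^ 3 * Real.log N + (n + 1) * (N : ℝ) ^ 2 * A.edges.card) ∧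
        ∀ s : Pos (Fin N), τ.rmem (stateIndex s) = A.game.w n s := by
  -- The constant only has to cover 8(N+1)³ ≤ 64N³ cells, words of that size, and the time bound
  -- with factor 10000 plus four setup steps.
  refine ⟨mainProg, 20000, fun N _ A L hL n => ?_⟩
  have hN : 0 < N := Nat.pos_of_ne_zero (NeZero.ne N)
  have hN3 : N ≤ N ^ 3 := Nat.le_self_pow (by norm_num) N
  have hE := hL.length_le
  have hNE := hL.le_two_mul_length
  have hE0 : 0 < L.length := by omega
  set B := (N + 1) * (N + 1) * (N + 1) with hB
  set M := 20000 * N ^ 3 with hM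
  set W := 20000 * (N ^ 3 + n) with hW
  set σ := inputStore A L n with hσ
  have hBN : B ≤ 8 * N ^ 3 := by
    have : N + 1 ≤ 2 * N := by omega
    calc B ≤ 2 * N * (2 * N) * (2 * N) := by rw [hB]; gcongr
      _ = 8 * N ^ 3 := by ring
  have hsq : (N + 1) * (N + 1) < B := by rw [hB]; nlinarith
  have hBM : 8 * B ≤ M := by omega
  have hBW : 8 * B ≤ W := by omega
  have hEB : L.length ≤ B := by nlinarith
  set f := Function.update (Function.update (Function.update σ.wreg 3 (N + 1)) 4
    ((N + 1) * (N + 1))) 4 B with hf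
  have hpre : Run M W (.seq (.wconst 3 1) (.seq (.wop .add 3 0 3)
      (.seq (.wop .mul 4 3 3) (.wop .mul 4 4 3)))) σ 4 { σ with wreg := f } := by
    have h0 : σ.wreg 0 = N := rfl
    have := Run.seq (M := M) (W := W) (.wconst σ 3 1 (by omega)) (.seq (.wop _ .add 3 0 3 ?_)
      (.seq (.wop _ .mul 4 3 3 ?_) (.wop _ .mul 4 4 3 ?_)))
    · simpa [WordOp.eval, h0, hf, hB] using this
    · simp [WordOp.eval, h0]; omega
    · simp [WordOp.eval, h0]; omega
    · simp [WordOp.eval, h0]; omega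
  have f0 : f 0 = N := by simp [hf, hσ, inputStore]
  have f1 : f 1 = L.length := by simp [hf, hσ, inputStore]
  have f2 : f 2 = n := by simp [hf, hσ, inputStore]
  have f3 : f 3 = N + 1 := by simp [hf]
  have f4 : f 4 = B := by simp [hf]
  have hctx : Ctx N L.length W B f := ⟨f0, f1, f3, hE, le_rfl, hBW⟩
  -- Slicing the input memory into blocks of length B puts the edge list and the probabilities into
  -- the arrays numbered 0, and the output cells are addresses in array 0 as well.
  have hholds : Holds W B 5 f ⟨fun k a => σ.wmem (k * B + a), fun k a => σ.rmem (k * B + a)⟩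
      { σ with wreg := f } := by
    refine ⟨fun _ _ => rfl, fun x hx => ?_, f4, fun _ _ _ _ => rfl, fun _ _ _ _ => rfl⟩
    interval_cases x <;> simp only [f0, f1, f2, f3, f4] <;> omega
  obtain ⟨t, τ, m', hrun, ht, hτ, -, hV⟩ := mainCmd.run hBM hBW (by omega) (p := f) (by norm_num)
    (fun _ _ => rfl) hholds (wp_mainCmd hctx hL
      (by simpa using inputStore_wmem A L n) (by simpa using inputStore_rmem A L n))
  rw [f2] at hV
  refine ⟨4 + t, τ, .seq hpre hrun, ?_, fun s => ?_⟩
  · have hcost := ht.trans (cost_mainCmd f0 f1 f2 f3 hN hNE)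
    have h1 : 1 ≤ (n + 1) * N ^ 2 * L.length :=
      Nat.mul_pos (Nat.mul_pos (Nat.succ_pos n) (pow_pos hN 2)) hE0
    have h2 : 4 + t ≤ 20000 * ((n + 1) * N ^ 2 * L.length) := by omega
    have h3 : ((4 + t : ℕ) : ℝ) ≤ 20000 * ((n + 1) * (N : ℝ) ^ 2 * L.length) := by exact_mod_cast h2
    -- The logarithmic term enters only through its sign.
    have h4 : 0 ≤ (N : ℝ) ^ 3 * Real.log N := mul_nonneg (by positivity) (Real.log_natCast_nonneg N)
    rw [hL.card_edges]
    push_cast at h3 ⊢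
    linarith
  · have hs : stateIndex s < B := by
      rcases s with _ | ⟨c, r⟩
      · exact hsq
      · exact (Ctx.sq_lt (posIndex_le c) (posIndex_le r)).trans hsq
    rw [← hV s, ← hτ.real 0 (by norm_num) _ hs, zero_mul, zero_add]
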